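/- Let $(M,g,J)$ be an almost Hermitian manifold of indefinite metric, of real dimension $2n$: $M$ is a smooth manifold, $J$ a smooth almost complex structure ($J^2=-\mathrm{id}$) and $g$ a smooth pseudo-Riemannian metric with $g(JX,JY)=g(X,Y)$, of signature $(2s,2(n-s))$ ($2s$ minus signs, $2(n-s)$ plus signs). Assume $s\ge 2$ and $n-s\ge 2$. A 2-plane $\alpha\subset T_pM$ is *strongly isotropic* if $g|_\alpha=0$, and *antiholomorphic* if $J\alpha\perp\alpha$ and $J\alpha\neq\alpha$. $M$ satisfies the *axiom of strongly isotropic antiholomorphic 2-planes* if for each $p\in M$ and each strongly isotropic antiholomorphic 2-plane $\alpha\subset T_pM$ there is a totally geodesic submanifold $M'$ of $M$ containing $p$ such that $T_pM'=\alpha$ and all tangent spaces of $M'$ are strongly isotropic antiholomorphic 2-planes. (Totally geodesic: the Levi-Civita derivative $\nabla_XY$ of fields $X,Y$ tangent to $M'$ is tangent to $M'$.) Let $R(X,Y)=[\nabla_X,\nabla_Y]-\nabla_{[X,Y]}$ for the Levi-Civita connection $\nabla$ and $R(x,y,z,u)=g(R(x,y)z,u)$. For a curvature-like tensor $T$ on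 $T_pM$ and an orthonormal basis $e_1,\dots,e_{2n}$ of $T_pM$ put $$\rho(T)(y,z)=\sum_i g(e_i,e_i)T(e_i,y,z,e_i),\qquad \rho^*(T)(y,z)=\sum_i g(e_i,e_i)T(e_i,y,Jz,Je_i),$$ $$\tau(T)=\sum_i g(e_i,e_i)\rho(T)(e_i,e_i),\qquad \tau^*(T)=\sum_i g(e_i,e_i)\rho^*(T)(e_i,e_i),$$ and, for a $(0,2)$-tensor $S$, $$\varphi(S)(x,y,z,u)=g(y,z)S(x,u)-g(x,z)S(y,u)+g(x,u)S(y,z)-g(y,u)S(x,z),$$ $$\psi(S)(x,y,z,u)=g(y,Jz)S(x,Ju)-g(x,Jz)S(y,Ju)-2g(x,Jy)S(z,Ju)+g(x,Ju)S(y,Jz)-g(y,Ju)S(x,Jz)-2g(z,Ju)S(x,Jy),$$ $\pi_1=\tfrac12\varphi(g)$, $\pi_2=\tfrac12\psi(g)$ and $\overline R(x,y,z,u)=R(Jx,Jy,Jz,Ju)$. The Bochner curvature tensor of $M$ is $$B(R)=R-\frac{(\varphi+\psi)\big((\rho+3\rho^*)(R+\overline R)\big)}{16(n+2)}-\frac{(3\varphi-\psi)\big((\rho-\rho^*)(R+\overline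 R)\big)}{16(n-2)}-\frac{\psi\big(\rho^*(R-\overline R)\big)}{4(n+1)}-\frac{\varphi\big(\rho(R-\overline R)\big)}{4(n-1)}$$ $$\qquad+\frac{(\tau+3\tau^*)(R)}{16(n+1)(n+2)}(\pi_1+\pi_2)+\frac{(\tau-\tau^*)(R)}{16(n-1)(n-2)}(3\pi_1-\pi_2).$$ If $M$ satisfies the axiom of strongly isotropic antiholomorphic 2-planes, then its Bochner curvature tensor vanishes: $B(R)=0$ at every point of $M$. -/

import Mathlib

open scoped Manifold ContDiff Bundle

universe u v

noncomputable section

/-! ### Multilinear algebra on a tangent space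

`V` is a real vector space with a scalar product `g`, a complex structure `J` and a `g`-orthonormal
basis `e`. Tensors of type (0,4) are functions `V → V → V → V → ℝ`, tensors of type (0,2)
are functions `V → V → ℝ`. -/

namespace CurvatureAlgebra

variable {V : Type*} {m : ℕ}

/-- Orthonormality for a scalar product of arbitrary signature. -/
def IsOrthonormal (g : V → V → ℝ) (e : Fin m → V) : Prop :=
  (∀ i j, i ≠ j → g (e i) (e j) = 0) ∧ ∀ i, g (e i) (e i) = 1 ∨ g (e i) (e i) = -1

/-- The Ricci tensor `ρ(T)(y,z) = ∑ᵢ g(eᵢ,eᵢ) T(eᵢ,y,z,eᵢ)`. -/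
def ricci (g : V → V → ℝ) (e : Fin m → V) (T : V → V → V → V → ℝ) : V → V → ℝ :=
  fun y z => ∑ i, g (e i) (e i) * T (e i) y z (e i)

/-- The Ricci *-tensor `ρ*(T)(y,z) = ∑ᵢ g(eᵢ,eᵢ) T(eᵢ,y,Jz,Jeᵢ)`. -/
def starRicci (g : V → V → ℝ) (J : V → V) (e : Fin m → V) (T : V → V → V → V → ℝ) :
    V → V → ℝ :=
  fun y z => ∑ i, g (e i) (e i) * T (e i) y (J z) (J (e i))

/-- The metric trace `∑ᵢ g(eᵢ,eᵢ) S(eᵢ,eᵢ)` of a (0,2)-tensor. -/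
def metricTrace (g : V → V → ℝ) (e : Fin m → V) (S : V → V → ℝ) : ℝ :=
  ∑ i, g (e i) (e i) * S (e i) (e i)

/-- The scalar curvature `τ(T)`. -/
def scalar (g : V → V → ℝ) (e : Fin m → V) (T : V → V → V → V → ℝ) : ℝ :=
  metricTrace g e (ricci g e T)

/-- The scalar *-curvature `τ*(T)`. -/
def starScalar (g : V → V → ℝ) (J : V → V) (e : Fin m → V) (T : V → V → V → V → ℝ) : ℝ :=
  metricTrace g e (starRicci g J e T)

/-- The (0,4)-tensor `φ(S)`. -/
def phi (g : V → V → ℝ) (S : V → V → ℝ) : V → V → V → V → ℝ :=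
  fun x y z u => g y z * S x u - g x z * S y u + g x u * S y z - g y u * S x z

/-- The (0,4)-tensor `ψ(S)`. -/
def psi (g : V → V → ℝ) (J : V → V) (S : V → V → ℝ) : V → V → V → V → ℝ :=
  fun x y z u =>
    g y (J z) * S x (J u) - g x (J z) * S y (J u) - 2 * g x (J y) * S z (J u)
      + g x (J u) * S y (J z) - g y (J u) * S x (J z) - 2 * g z (J u) * S x (J y)

/-- The (0,4)-tensor `π₁`. -/
def pi1 (g : V → V → ℝ) : V → V → V → V → ℝ :=
  fun x y z u => g y z * g x u - g x z * g y u

/-- The (0,4)-tensor `π₂`. -/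
def pi2 (g : V → V → ℝ) (J : V → V) : V → V → V → V → ℝ :=
  fun x y z u => g y (J z) * g x (J u) - g x (J z) * g y (J u) - 2 * g x (J y) * g z (J u)

/-- The tensor `T̄(x,y,z,u) = T(Jx,Jy,Jz,Ju)`. -/
def conj (J : V → V) (T : V → V → V → V → ℝ) : V → V → V → V → ℝ :=
  fun x y z u => T (J x) (J y) (J z) (J u)

/-- The Bochner curvature tensor `B(R)` of Tricerri and Vanhecke, in real dimension `2 * n`. -/
def bochner (n : ℕ) (g : V → V → ℝ) (J : V → V) (e : Fin (2 * n) → V)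
    (R : V → V → V → V → ℝ) : V → V → V → V → ℝ :=
  let P := R + conj J R
  let Q := R - conj J R
  let S₁ := ricci g e P + (3 : ℝ) • starRicci g J e P
  let S₂ := ricci g e P - starRicci g J e P
  R - (1 / (16 * ((n : ℝ) + 2))) • (phi g S₁ + psi g J S₁)
    - (1 / (16 * ((n : ℝ) - 2))) • ((3 : ℝ) • phi g S₂ - psi g J S₂)
    - (1 / (4 * ((n : ℝ) + 1))) • psi g J (starRicci g J e Q)
    - (1 / (4 * ((n : ℝ) - 1))) • phi g (ricci g e Q)
    + ((scalar g e R + 3 * starScalar g J e R) / (16 * ((n : ℝ) + 1) * ((n : ℝ) + 2))) •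
        (pi1 g + pi2 g J)
    + ((scalar g e R - starScalar g J e R) / (16 * ((n : ℝ) - 1) * ((n : ℝ) - 2))) •
        ((3 : ℝ) • pi1 g - pi2 g J)

end CurvatureAlgebra

/-! ### Almost Hermitian manifolds of indefinite metric -/

/-- An almost Hermitian structure `(g, J)` with `g` of signature `(2s, 2(n-s))` on a smooth
manifold `M` (without boundary, modelled on the finite-dimensional real space `E`): smooth tensor
fields with `J² = -id`, `g(Jx,Jy) = g(x,y)`, and such that each tangent space is isometric to
`ℝ^{2n}` with the scalar product `-∑_{i ≤ 2s} xⁱyⁱ + ∑_{i > 2s} xⁱyⁱ`. -/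
structure AlmostHermitianStructure (n s : ℕ)
    (E : Type v) [NormedAddCommGroup E] [NormedSpace ℝ E]
    (M : Type u) [TopologicalSpace M] [ChartedSpace E M] [IsManifold 𝓘(ℝ, E) ∞ M] where
  /-- the metric -/
  g : ∀ p : M, TangentSpace 𝓘(ℝ, E) p →L[ℝ] TangentSpace 𝓘(ℝ, E) p →L[ℝ] ℝ
  /-- the almost complex structure -/
  J : ∀ p : M, TangentSpace 𝓘(ℝ, E) p →L[ℝ] TangentSpace 𝓘(ℝ, E) p
  contMDiff_g : ContMDiff 𝓘(ℝ, E) (𝓘(ℝ, E).prod 𝓘(ℝ, E →L[ℝ] E →L[ℝ] ℝ)) ∞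
    (fun p => Bundle.TotalSpace.mk' (E →L[ℝ] E →L[ℝ] ℝ)
      (E := fun p : M => TangentSpace 𝓘(ℝ, E) p →L[ℝ] TangentSpace 𝓘(ℝ, E) p →L[ℝ] ℝ) p (g p))
  contMDiff_J : ContMDiff 𝓘(ℝ, E) (𝓘(ℝ, E).prod 𝓘(ℝ, E →L[ℝ] E)) ∞
    (fun p => Bundle.TotalSpace.mk' (E →L[ℝ] E)
      (E := fun p : M => TangentSpace 𝓘(ℝ, E) p →L[ℝ] TangentSpace 𝓘(ℝ, E) p) p (J p))
  g_symm : ∀ (p : M) (x y : TangentSpace 𝓘(ℝ, E) p), g p x y = g p y x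
  signature : ∀ p : M, ∃ e : Module.Basis (Fin (2 * n)) ℝ (TangentSpace 𝓘(ℝ, E) p),
    ∀ i j, g p (e i) (e j) = if i = j then (if (i : ℕ) < 2 * s then -1 else 1) else 0
  J_sq : ∀ (p : M) (x : TangentSpace 𝓘(ℝ, E) p), J p (J p x) = -x
  g_J : ∀ (p : M) (x y : TangentSpace 𝓘(ℝ, E) p), g p (J p x) (J p y) = g p x y

namespace AlmostHermitianStructure

variable {n s : ℕ} {E : Type v} [NormedAddCommGroup E] [NormedSpace ℝ E]
  {M : Type u} [TopologicalSpace M] [ChartedSpace E M] [IsManifold 𝓘(ℝ, E) ∞ M]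
  (A : AlmostHermitianStructure n s E M)

/-- The metric in the coordinates of the chart at `p₀`:
`(u,v) ↦ g(dφ⁻¹ u, dφ⁻¹ v)` at the point with coordinates `x`. -/
def chartMetric (p₀ : M) (x : E) : E →L[ℝ] E →L[ℝ] ℝ :=
  let D : E →L[ℝ] TangentSpace 𝓘(ℝ, E) ((extChartAt 𝓘(ℝ, E) p₀).symm x) :=
    mfderiv 𝓘(ℝ, E) 𝓘(ℝ, E) (extChartAt 𝓘(ℝ, E) p₀).symm x
  (ContinuousLinearMap.precomp ℝ D) ∘L (A.g ((extChartAt 𝓘(ℝ, E) p₀).symm x)) ∘L D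

/-- The Christoffel symbols `Γ(u,v)` of the Levi-Civita connection in the chart at `p₀`:
`2 g(Γ(u,v), w) = ∂_u g(v,w) + ∂_v g(u,w) - ∂_w g(u,v)`. In this chart,
`∇_X Y = ∂_X Y + Γ(X,Y)`. -/
def christoffel (p₀ : M) (x : E) (u v : E) : E :=
  let dG := fderiv ℝ (A.chartMetric p₀) x
  (1 / 2 : ℝ) • (A.chartMetric p₀ x).inverse (dG u v + dG v u - (dG.flip u).flip v)

/-- The curvature operator `R(u,v)w = ∇_u ∇_v w - ∇_v ∇_u w` in the chart at `p₀`, computed on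
vector fields `u, v, w` with constant coordinates (for which `[u,v] = 0`). -/
def chartCurvature (p₀ : M) (x : E) (u v w : E) : E :=
  fderiv ℝ (fun y => A.christoffel p₀ y v w) x u - fderiv ℝ (fun y => A.christoffel p₀ y u w) x v
    + A.christoffel p₀ x u (A.christoffel p₀ x v w)
    - A.christoffel p₀ x v (A.christoffel p₀ x u w)

/-- The curvature tensor `R(x,y,z,u) = g(R(x,y)z,u)` at `p`, computed in the chart at `p`. -/
def curvature (p : M) (x y z u : TangentSpace 𝓘(ℝ, E) p) : ℝ :=
  let φ : M → E := extChartAt 𝓘(ℝ, E) p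
  let D : TangentSpace 𝓘(ℝ, E) p →L[ℝ] E := mfderiv 𝓘(ℝ, E) 𝓘(ℝ, E) φ p
  A.chartMetric p (φ p) (A.chartCurvature p (φ p) (D x) (D y) (D z)) (D u)

/-- The Bochner curvature tensor vanishes: at each point, `B(R) = 0`, the traces being computed
with respect to any orthonormal basis of the tangent space. -/
def BochnerVanishes : Prop :=
  ∀ (p : M) (e : Module.Basis (Fin (2 * n)) ℝ (TangentSpace 𝓘(ℝ, E) p)),
    CurvatureAlgebra.IsOrthonormal (fun x y => A.g p x y) e →
    ∀ x y z u : TangentSpace 𝓘(ℝ, E) p,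
      CurvatureAlgebra.bochner n (fun x y => A.g p x y) (A.J p) e (A.curvature p) x y z u = 0

/-- `α` is a 2-plane on which the metric has rank 0. -/
def IsStronglyIsotropicPlane {p : M} (α : Submodule ℝ (TangentSpace 𝓘(ℝ, E) p)) : Prop :=
  Module.finrank ℝ α = 2 ∧ ∀ x ∈ α, ∀ y ∈ α, A.g p x y = 0

/-- `α` is antiholomorphic: `Jα ⊥ α` and `Jα ≠ α`. -/
def IsAntiholomorphic {p : M} (α : Submodule ℝ (TangentSpace 𝓘(ℝ, E) p)) : Prop :=
  (∀ x ∈ α, ∀ y ∈ α, A.g p (A.J p x) y = 0) ∧ α.map (A.J p).toLinearMap ≠ α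

/-- The surface in `M` given by an injective immersion `f` of the 2-manifold `N` is a totally
geodesic submanifold: the ambient covariant derivative of tangent fields is tangent. In charts of
`N` and `M`, with `F` the coordinate expression of `f`, the covariant derivative along `f` of the
coordinate field `dF(b)` in the direction `dF(a)` is `D²F(a,b) + Γ(dF a, dF b)`. -/
structure IsTotallyGeodesicSurface {N : Type u} [TopologicalSpace N]
    [ChartedSpace (EuclideanSpace ℝ (Fin 2)) N] (f : N → M) : Prop where
  contMDiff : ContMDiff 𝓘(ℝ, EuclideanSpace ℝ (Fin 2)) 𝓘(ℝ, E) ∞ f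
  injective : Function.Injective f
  immersion : ∀ q : N, Function.Injective (mfderiv 𝓘(ℝ, EuclideanSpace ℝ (Fin 2)) 𝓘(ℝ, E) f q)
  totallyGeodesic : ∀ (q₀ : N) (p₀ : M),
    let ψ := extChartAt 𝓘(ℝ, EuclideanSpace ℝ (Fin 2)) q₀
    let φ := extChartAt 𝓘(ℝ, E) p₀
    let F : EuclideanSpace ℝ (Fin 2) → E := fun y => φ (f (ψ.symm y))
    ∀ y ∈ ψ.target, f (ψ.symm y) ∈ φ.source → ∀ a b : EuclideanSpace ℝ (Fin 2),
      ∃ c : EuclideanSpace ℝ (Fin 2),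
        fderiv ℝ (fderiv ℝ F) y a b
          + A.christoffel p₀ (F y) (fderiv ℝ F y a) (fderiv ℝ F y b) = fderiv ℝ F y c

/-- The tangent space at `f q` of the surface given by `f`, as a subspace of `T_{f q} M`. -/
def surfaceTangent (E : Type v) [NormedAddCommGroup E] [NormedSpace ℝ E]
    {M : Type u} [TopologicalSpace M] [ChartedSpace E M] {N : Type u} [TopologicalSpace N]
    [ChartedSpace (EuclideanSpace ℝ (Fin 2)) N] (f : N → M) (q : N) :
    Submodule ℝ (TangentSpace 𝓘(ℝ, E) (f q)) :=
  LinearMap.range (mfderiv 𝓘(ℝ, EuclideanSpace ℝ (Fin 2)) 𝓘(ℝ, E) f q).toLinearMap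

/-- The axiom of strongly isotropic antiholomorphic 2-planes: for each `p` and each strongly
isotropic antiholomorphic 2-plane `α` in `T_p M` there is a totally geodesic submanifold through
`p` with tangent space `α` at `p`, all of whose tangent spaces are strongly isotropic
antiholomorphic 2-planes. -/
def AxiomStronglyIsotropicAntiholomorphicPlanes : Prop :=
  ∀ (p : M) (α : Submodule ℝ (TangentSpace 𝓘(ℝ, E) p)),
    A.IsStronglyIsotropicPlane α → A.IsAntiholomorphic α →
    ∃ (N : Type u) (_ : TopologicalSpace N) (_ : ChartedSpace (EuclideanSpace ℝ (Fin 2)) N)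
      (_ : IsManifold 𝓘(ℝ, EuclideanSpace ℝ (Fin 2)) ∞ N) (f : N → M),
      A.IsTotallyGeodesicSurface f ∧
      (∃ (q : N) (h : f q = p), surfaceTangent E f q = h ▸ α) ∧
      ∀ q : N, A.IsStronglyIsotropicPlane (surfaceTangent E f q) ∧
        A.IsAntiholomorphic (surfaceTangent E f q)

end AlmostHermitianStructure

end

/-! Geometry enters only once. Along a totally geodesic surface, covariant derivatives of tangent
fields stay tangent, so R(x,y)z is tangent for tangent x, y, z; if the tangent spaces are isotropic,
R(x,y,z,u) = 0 on tangent vectors. The axiom therefore makes R(x,y,y,x) vanish on every strongly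
isotropic antiholomorphic plane (`vanishesOnIsotropic_curvature`).

The rest is algebra in one tangent space. Every correction term of B(R) carries a factor g(a,b) or
g(a,Jb) with a, b in the plane, so B = B(R) vanishes on these planes too. Moreover B is
curvature-like, and its coefficients are those for which ρ(B) = ρ*(B) = 0. These properties force B
= 0 (`bochner_eq_zero`), for the following reasons.

If x, y are negative and z, u positive Hermitian-orthogonal unit vectors, the planes spanned by x ±
z and y ± u are strongly isotropic and antiholomorphic; polarization and the Bianchi identity give
B(x,y,z,u) = 0. Since s ≥ 2 and n - s ≥ 2, every unitary frame has two vectors of each sign, and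
linearity in spare vectors removes the restriction on signs (`VanishesOnIsotropic.vanishesOnOrth`).

A bilinear form that vanishes on all orthogonal pairs of a plane is proportional to g on the
diagonal (`rotation`). Thus B(x,z,x,u)/g(x,x) does not depend on x, and similarly for other
components. A contraction over a unitary frame then reduces to a multiple of one component plus a
few exceptional terms, and the two trace conditions become linear systems that are nonsingular for n
≥ 4. They kill the components on three complex lines (`FrameTraceFree.eq_zero_of_triple`), hence
those of the form B(x,Jx,x,u), and the sectional ones (`VanishesOffPairs.sectional_eq_zero`). So
B(x,·,·,x) = 0 for non-isotropic x; isotropic x are reached along a line x + tp, and polarization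
gives B = 0. -/

noncomputable section

namespace CurvatureAlgebra

variable {V : Type*} [AddCommGroup V] [Module ℝ V]

/-! ### Curvature-like tensors -/

/-- A (0,4)-tensor with the algebraic symmetries of a curvature tensor. -/
structure IsCurvatureLike (T : V → V → V → V → ℝ) : Prop where
  add₁ : ∀ x x' y z u, T (x + x') y z u = T x y z u + T x' y z u
  smul₁ : ∀ (a : ℝ) x y z u, T (a • x) y z u = a * T x y z u
  swap₁₂ : ∀ x y z u, T x y z u = -T y x z u
  swap₃₄ : ∀ x y z u, T x y z u = -T x y u z
  bianchi : ∀ x y z u, T x y z u + T y z x u + T z x y u = 0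

namespace IsCurvatureLike

variable {T T' : V → V → V → V → ℝ} (h : IsCurvatureLike T) (h' : IsCurvatureLike T')

include h

theorem pair_swap (x y z u : V) : T x y z u = T z u x y := by
  have h1 := h.bianchi x y z u
  have h2 := h.bianchi y z u x
  have h3 := h.bianchi z u x y
  have h4 := h.bianchi u x y z
  linarith [h.swap₁₂ x y z u, h.swap₁₂ y z x u, h.swap₁₂ z x y u, h.swap₁₂ z u y x,
    h.swap₁₂ u y z x, h.swap₁₂ x z u y, h.swap₁₂ u x z y, h.swap₁₂ x y u z, h.swap₁₂ y u x z,
    h.swap₁₂ z u x y, h.swap₁₂ u x y z, h.swap₁₂ y z u x,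
    h.swap₃₄ x y z u, h.swap₃₄ y z x u, h.swap₃₄ z x y u, h.swap₃₄ z u y x,
    h.swap₃₄ u y z x, h.swap₃₄ x z u y, h.swap₃₄ u x z y, h.swap₃₄ x y u z, h.swap₃₄ y u x z,
    h.swap₃₄ z u x y, h.swap₃₄ u x y z, h.swap₃₄ y z u x]

theorem add₂ (x y y' z u : V) : T x (y + y') z u = T x y z u + T x y' z u := by
  rw [h.swap₁₂, h.add₁, h.swap₁₂ x y, h.swap₁₂ x y']; ring

theorem add₃ (x y z z' u : V) : T x y (z + z') u = T x y z u + T x y z' u := by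
  rw [h.pair_swap, h.add₁, h.pair_swap x y z, h.pair_swap x y z']

theorem add₄ (x y z u u' : V) : T x y z (u + u') = T x y z u + T x y z u' := by
  rw [h.pair_swap, h.add₂, h.pair_swap x y z, h.pair_swap x y z]

theorem smul₂ (a : ℝ) (x y z u : V) : T x (a • y) z u = a * T x y z u := by
  rw [h.swap₁₂, h.smul₁, h.swap₁₂ x y]; ring

theorem smul₃ (a : ℝ) (x y z u : V) : T x y (a • z) u = a * T x y z u := by
  rw [h.pair_swap, h.smul₁, h.pair_swap x y z]

theorem smul₄ (a : ℝ) (x y z u : V) : T x y z (a • u) = a * T x y z u := by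
  rw [h.pair_swap, h.smul₂, h.pair_swap x y z]

theorem neg₂ (x y z u : V) : T x (-y) z u = -T x y z u := by
  simpa using h.smul₂ (-1) x y z u

theorem neg₃ (x y z u : V) : T x y (-z) u = -T x y z u := by
  simpa using h.smul₃ (-1) x y z u

theorem neg₄ (x y z u : V) : T x y z (-u) = -T x y z u := by
  simpa using h.smul₄ (-1) x y z u

theorem self₁₂ (x z u : V) : T x x z u = 0 := by linarith [h.swap₁₂ x x z u]

theorem self₃₄ (x z u : V) : T x z u u = 0 := by linarith [h.swap₃₄ x z u u]

/-- A curvature-like tensor with vanishing sectional part is zero. -/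
theorem eq_zero_of_diag (h0 : ∀ x y, T x y y x = 0) (x y z u : V) : T x y z u = 0 := by
  have p1 : ∀ x y z, T x y z x = 0 := fun x y z => by
    have := h0 x (y + z)
    simp only [h.add₂, h.add₃, h0] at this
    linarith [h.pair_swap x z y x, h.swap₁₂ y x x z, h.swap₃₄ x y x z]
  -- Skew symmetry in the outer pair, together with that in slots 1, 2 and 3, 4, makes `T` totally
  -- skew; cyclic permutations of three slots are even, so the Bianchi identity reads 3T = 0.
  have p2 : ∀ x y z u, T x y z u = -T u y z x := fun x y z u => by
    have := p1 (x + u) y z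
    simp only [h.add₁, h.add₄, p1] at this
    linarith
  have b := h.bianchi x y z u
  have e1 := p2 x y z u
  have e2 := p2 y z x u
  have e3 := p2 z x y u
  linarith [h.pair_swap u y z x, h.pair_swap u z x y, h.pair_swap u x y z,
    h.swap₁₂ z x u y, h.swap₃₄ z x y u, h.swap₁₂ x y u z, h.swap₃₄ x y z u,
    h.swap₁₂ y z u x, h.swap₃₄ y z x u]

include h'

theorem add : IsCurvatureLike (T + T') where
  add₁ x x' y z u := by simp only [Pi.add_apply, h.add₁, h'.add₁]; ring
  smul₁ a x y z u := by simp only [Pi.add_apply, h.smul₁, h'.smul₁]; ring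
  swap₁₂ x y z u := by simp only [Pi.add_apply]; rw [h.swap₁₂, h'.swap₁₂]; ring
  swap₃₄ x y z u := by simp only [Pi.add_apply]; rw [h.swap₃₄, h'.swap₃₄]; ring
  bianchi x y z u := by
    simp only [Pi.add_apply]; linarith [h.bianchi x y z u, h'.bianchi x y z u]

omit h'

theorem smul (c : ℝ) : IsCurvatureLike (c • T) where
  add₁ x x' y z u := by simp only [Pi.smul_apply, smul_eq_mul, h.add₁]; ring
  smul₁ a x y z u := by simp only [Pi.smul_apply, smul_eq_mul, h.smul₁]; ring
  swap₁₂ x y z u := by simp only [Pi.smul_apply, smul_eq_mul]; rw [h.swap₁₂]; ring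
  swap₃₄ x y z u := by simp only [Pi.smul_apply, smul_eq_mul]; rw [h.swap₃₄]; ring
  bianchi x y z u := by
    simp only [Pi.smul_apply, smul_eq_mul]; linear_combination c * h.bianchi x y z u

include h'

theorem sub : IsCurvatureLike (T - T') := by
  have := h.add (h'.smul (-1))
  rwa [neg_one_smul, ← sub_eq_add_neg] at this

end IsCurvatureLike

/-! ### Hermitian forms of arbitrary signature -/

/-- `J` is a complex structure and `g` a nondegenerate `J`-invariant scalar product. -/
structure IsHermitianForm (g : V →ₗ[ℝ] V →ₗ[ℝ] ℝ) (J : V →ₗ[ℝ] V) : Prop where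
  symm : ∀ x y, g x y = g y x
  J_sq : ∀ x, J (J x) = -x
  map_J : ∀ x y, g (J x) (J y) = g x y
  nondeg : ∀ x, (∀ y, g x y = 0) → x = 0

variable {g : V →ₗ[ℝ] V →ₗ[ℝ] ℝ} {J : V →ₗ[ℝ] V} {T : V → V → V → V → ℝ}

theorem IsHermitianForm.J_left (h : IsHermitianForm g J) (x y : V) : g (J x) y = -g x (J y) := by
  have := h.map_J x (J y)
  rw [h.J_sq, map_neg] at this
  linarith

theorem IsHermitianForm.self_J (h : IsHermitianForm g J) (x : V) : g x (J x) = 0 := by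
  have := h.J_left x x
  rw [h.symm] at this
  linarith

/-- Orthogonality with respect to the Hermitian form determined by `g` and `J`. -/
def HOrth (g : V →ₗ[ℝ] V →ₗ[ℝ] ℝ) (J : V →ₗ[ℝ] V) (x y : V) : Prop :=
  g x y = 0 ∧ g y x = 0 ∧ g x (J y) = 0 ∧ g y (J x) = 0

theorem HOrth.symm {x y : V} (h : HOrth g J x y) : HOrth g J y x :=
  ⟨h.2.1, h.1, h.2.2.2, h.2.2.1⟩

theorem HOrth.comb {x y z : V} (hx : HOrth g J x z) (hy : HOrth g J y z) (a b : ℝ) :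
    HOrth g J (a • x + b • y) z := by
  simp only [HOrth] at *
  simp [hx, hy]

theorem IsHermitianForm.hOrth_of (h : IsHermitianForm g J) {x y : V} (h1 : g x y = 0)
    (h2 : g x (J y) = 0) : HOrth g J x y :=
  ⟨h1, by rw [h.symm, h1], h2, by rw [h.symm, h.J_left, h2, neg_zero]⟩

theorem HOrth.J_left {x y : V} (hxy : HOrth g J x y) (h : IsHermitianForm g J) :
    HOrth g J (J x) y :=
  (h.hOrth_of (by rw [h.symm, hxy.2.2.2]) (by rw [h.map_J, hxy.1]))

theorem HOrth.J_right {x y : V} (hxy : HOrth g J x y) (h : IsHermitianForm g J) :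
    HOrth g J x (J y) :=
  (hxy.symm.J_left h).symm

/-- A list of non-isotropic, pairwise Hermitian-orthogonal vectors. -/
def OrthSystem (g : V →ₗ[ℝ] V →ₗ[ℝ] ℝ) (J : V →ₗ[ℝ] V) (l : List V) : Prop :=
  (∀ x ∈ l, g x x ≠ 0) ∧ l.Pairwise (HOrth g J)

/-- Guarantees that rotated vectors stay non-isotropic in an indefinite plane. The value t = 1 fails
only if -p/q is 1 or 4, and t = 3 only if it is 9 or 36, so one of the two works. The second
condition, at 2t, serves `holomorphic`, which needs two values of the parameter. -/
theorem exists_mul_add_ne_zero (p : ℝ) {q : ℝ} (hq : q ≠ 0) :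
    ∃ t : ℝ, t ≠ 0 ∧ p + t ^ 2 * q ≠ 0 ∧ p + (2 * t) ^ 2 * q ≠ 0 := by
  by_cases h : p + 1 ^ 2 * q ≠ 0 ∧ p + (2 * 1) ^ 2 * q ≠ 0
  · exact ⟨1, one_ne_zero, h⟩
  · refine ⟨3, by norm_num, ?_⟩
    by_contra h'
    rw [not_and_or, not_not, not_not] at h h'
    rcases h with h | h <;> rcases h' with h' | h' <;> exact hq (by linarith)

/-- A bilinear form vanishing on orthogonal non-isotropic pairs of a plane takes proportional
values on the vectors of an orthogonal basis. -/
theorem rotation (β : V → V → ℝ) {x y : V}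
    (hβ : ∀ a b c d : ℝ, β (a • x + b • y) (c • x + d • y) =
      a * c * β x x + a * d * β x y + b * c * β y x + b * d * β y y)
    (hx : g x x ≠ 0) (hy : g y y ≠ 0) (hxy : HOrth g J x y) (hg : IsHermitianForm g J)
    (h0 : ∀ v w, (∀ r, HOrth g J x r → HOrth g J y r → HOrth g J v r) →
      (∀ r, HOrth g J x r → HOrth g J y r → HOrth g J w r) →
      HOrth g J v w → g v v ≠ 0 → g w w ≠ 0 → β v w = 0) :
    g y y * β x x = g x x * β y y := by
  obtain ⟨t, ht, h1, -⟩ := exists_mul_add_ne_zero _ hy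
  have e1 : β x y = 0 := h0 x y (fun _ h _ => h) (fun _ _ h => h) hxy hx hy
  have e2 : β y x = 0 := h0 y x (fun _ _ h => h) (fun _ h _ => h) hxy.symm hy hx
  -- The orthogonal pair x + ty, t g(y,y) x - g(x,x) y. Once the cross terms vanish, β of this pair
  -- is t times the difference of the two sides of the claim.
  have e3 := h0 ((1 : ℝ) • x + t • y) ((t * g y y) • x + (-g x x) • y)
    (fun r h h' => h.comb h' _ _) (fun r h h' => h.comb h' _ _)
    (hg.hOrth_of (by simp [hxy.1, hxy.2.1]; ring)
      (by simp [hxy.2.2.1, hxy.2.2.2, hg.self_J]))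
    (by
      have : g ((1 : ℝ) • x + t • y) ((1 : ℝ) • x + t • y) = g x x + t ^ 2 * g y y := by
        simp [hxy.1, hxy.2.1]; ring
      rwa [this])
    (by
      have : g ((t * g y y) • x + (-g x x) • y) ((t * g y y) • x + (-g x x) • y) =
          g x x * g y y * (g x x + t ^ 2 * g y y) := by
        simp [hxy.1, hxy.2.1]; ring
      rw [this]
      exact mul_ne_zero (mul_ne_zero hx hy) h1)
  rw [hβ, e1, e2] at e3
  have : t * (g y y * β x x - g x x * β y y) = 0 := by linear_combination e3
  have := (mul_eq_zero.1 this).resolve_left ht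
  linarith

/-! ### Consequences of vanishing on orthogonal quadruples -/

/-- `T` vanishes on all Hermitian-orthogonal quadruples of non-isotropic vectors. -/
def VanishesOnOrth (g : V →ₗ[ℝ] V →ₗ[ℝ] ℝ) (J : V →ₗ[ℝ] V) (T : V → V → V → V → ℝ) : Prop :=
  ∀ x y z u, OrthSystem g J [x, y, z, u] → T x y z u = 0

section

variable (hg : IsHermitianForm g J) (hT : IsCurvatureLike T) (hC : VanishesOnOrth g J T)

include hg hT hC

/-- `rotation` for the form (a, b) ↦ T(a,z,b,u): the quotient T(x,z,x,u)/g(x,x) is the same for all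
x in a given orthogonal system with z, u. The next lemma does the same with Jb in place of b. -/
theorem VanishesOnOrth.ratio {x y z u : V} (h : OrthSystem g J [x, y, z, u]) :
    g y y * T x z x u = g x x * T y z y u := by
  simp only [OrthSystem, List.mem_cons, List.not_mem_nil, or_false, forall_eq_or_imp, forall_eq,
    List.pairwise_cons, List.Pairwise.nil, IsEmpty.forall_iff, implies_true, and_true] at h
  obtain ⟨⟨hx, hy, hz, hu⟩, ⟨hxy, hxz, hxu⟩, ⟨hyz, hyu⟩, hzu⟩ := h
  refine rotation (fun a b => T a z b u) (fun a b c d => ?_) hx hy hxy hg ?_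
  · simp only [hT.add₁, hT.smul₁, hT.add₃, hT.smul₃]; ring
  · intro v w hv hw hvw hv0 hw0
    apply hC
    simp only [OrthSystem, List.mem_cons, List.not_mem_nil, or_false, forall_eq_or_imp, forall_eq,
      List.pairwise_cons, List.Pairwise.nil, IsEmpty.forall_iff, implies_true, and_true]
    exact ⟨⟨hv0, hz, hw0, hu⟩, ⟨hv z hxz hyz, hvw, hv u hxu hyu⟩,
      ⟨(hw z hxz hyz).symm, hzu⟩, hw u hxu hyu⟩

theorem VanishesOnOrth.ratio_J {x y z u : V} (h : OrthSystem g J [x, y, z, u]) :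
    g y y * T x z (J x) u = g x x * T y z (J y) u := by
  simp only [OrthSystem, List.mem_cons, List.not_mem_nil, or_false, forall_eq_or_imp, forall_eq,
    List.pairwise_cons, List.Pairwise.nil, IsEmpty.forall_iff, implies_true, and_true] at h
  obtain ⟨⟨hx, hy, hz, hu⟩, ⟨hxy, hxz, hxu⟩, ⟨hyz, hyu⟩, hzu⟩ := h
  refine rotation (fun a b => T a z (J b) u) (fun a b c d => ?_) hx hy hxy hg ?_
  · simp only [map_add, map_smul, hT.add₁, hT.smul₁, hT.add₃, hT.smul₃]; ring
  · intro v w hv hw hvw hv0 hw0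
    apply hC
    simp only [OrthSystem, List.mem_cons, List.not_mem_nil, or_false, forall_eq_or_imp, forall_eq,
      List.pairwise_cons, List.Pairwise.nil, IsEmpty.forall_iff, implies_true, and_true]
    exact ⟨⟨hv0, hz, by rwa [hg.map_J], hu⟩, ⟨hv z hxz hyz, hvw.J_right hg, hv u hxu hyu⟩,
      ⟨((hw z hxz hyz).J_left hg).symm, hzu⟩, (hw u hxu hyu).J_left hg⟩

/-- Apply `ratio` to v = x + rz and w = J(r g(z,z) x - g(x,x) z), which are Hermitian-orthogonal,
with y as the comparison vector. The part odd in r, isolated by r = ±t, contains T(x,Jx,x,u). -/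
theorem VanishesOnOrth.triple {x y z u : V} (h : OrthSystem g J [x, y, z, u]) :
    g z z * T x (J x) x u = g x x * (T z (J x) z u + 3 * T z x (J z) u) := by
  have rat := @VanishesOnOrth.ratio V _ _ g J T hg hT hC
  have ratJ := @VanishesOnOrth.ratio_J V _ _ g J T hg hT hC
  simp only [OrthSystem, List.mem_cons, List.not_mem_nil, or_false, forall_eq_or_imp, forall_eq,
    List.pairwise_cons, List.Pairwise.nil, IsEmpty.forall_iff, implies_true, and_true]
    at h rat ratJ
  obtain ⟨⟨hx, hy, hz, hu⟩, ⟨hxy, hxz, hxu⟩, ⟨hyz, hyu⟩, hzu⟩ := h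
  obtain ⟨t, ht, ht1, -⟩ := exists_mul_add_ne_zero _ hz
  have key : ∀ r : ℝ, g x x + r ^ 2 * g z z ≠ 0 →
      g y y * T (x + r • z) ((r * g z z) • J x + (-g x x) • J z) (x + r • z) u =
        (g x x + r ^ 2 * g z z) * T y ((r * g z z) • J x + (-g x x) • J z) y u := by
    intro r hr
    have hv : g (x + r • z) (x + r • z) = g x x + r ^ 2 * g z z := by
      simp [hxz.1, hxz.2.1]; ring
    have ho := hg.hOrth_of (x := (r * g z z) • J x + (-g x x) • J z) (y := x + r • z)
      (by simp [hg.J_left, hg.self_J, hxz.2.2])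
      (by simp [hg.map_J, hxz.1, hxz.2.1]; ring)
    have hw : g ((r * g z z) • J x + (-g x x) • J z) ((r * g z z) • J x + (-g x x) • J z) =
        g x x * g z z * (g x x + r ^ 2 * g z z) := by
      simp [hg.map_J, hxz.1, hxz.2.1]; ring
    have hvr : ∀ s, HOrth g J x s → HOrth g J z s → HOrth g J (x + r • z) s := fun s h1 h2 => by
      simpa using h1.comb h2 1 r
    have hwr : ∀ s, HOrth g J x s → HOrth g J z s →
        HOrth g J ((r * g z z) • J x + (-g x x) • J z) s := fun s h1 h2 =>
      (h1.J_left hg).comb (h2.J_left hg) _ _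
    have := rat (x := x + r • z) (y := y) (z := (r * g z z) • J x + (-g x x) • J z) (u := u)
      ⟨⟨by rwa [hv], hy, by rw [hw]; exact mul_ne_zero (mul_ne_zero hx hz) hr, hu⟩,
        ⟨hvr y hxy hyz.symm, ho.symm, hvr u hxu hzu⟩, ⟨(hwr y hxy hyz.symm).symm, hyu⟩,
        hwr u hxu hzu⟩
    rwa [hv] at this
  have k1 := key t ht1
  have k2 := key (-t) (by rwa [neg_sq])
  simp only [hT.add₁, hT.smul₁, hT.add₂, hT.smul₂, hT.add₃, hT.smul₃] at k1 k2
  have r1 := rat (x := z) (y := y) (z := J x) (u := u) ⟨⟨hz, hy, by rwa [hg.map_J], hu⟩,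
    ⟨hyz.symm, hxz.symm.J_right hg, hzu⟩, ⟨hxy.symm.J_right hg, hyu⟩, hxu.J_left hg⟩
  have r3 := ratJ (x := z) (y := y) (z := x) (u := u) ⟨⟨hz, hy, hx, hu⟩,
    ⟨hyz.symm, hxz.symm, hzu⟩, ⟨hxy.symm, hyu⟩, hxu⟩
  have r4 := ratJ (x := J z) (y := y) (z := x) (u := u) ⟨⟨by rwa [hg.map_J], hy, hx, hu⟩,
    ⟨hyz.symm.J_left hg, hxz.symm.J_left hg, hzu.J_left hg⟩, ⟨hxy.symm, hyu⟩, hxu⟩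
  rw [hg.J_sq, hg.map_J, hT.neg₃] at r4
  -- Comparing z and Jz with the same y by `ratio_J` gives this sign rule, because J² = -1. With the
  -- Bianchi identity it turns both mixed terms into multiples of T(z,x,Jz,u), with total
  -- coefficient 3.
  have s1 : T (J z) x z u = -T z x (J z) u := by
    have : g y y * (T (J z) x z u + T z x (J z) u) = 0 := by linear_combination r3 - r4
    linarith [(mul_eq_zero.1 this).resolve_left hy]
  have s2 := hT.bianchi z (J z) x u
  have s3 := hT.swap₁₂ x z (J z) u
  have s4 := hT.swap₁₂ x (J z) z u
  -- In the difference of `k1` and `k2` the t³ terms cancel by `r1`, leaving a common factor t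
  -- g(y,y).
  have : t * g y y * (g z z * T x (J x) x u - g x x * (T z (J x) z u + 3 * T z x (J z) u)) = 0 := by
    have e2 : T z (J z) x u = 2 * T z x (J z) u := by linarith
    have e4 : T x (J z) z u = T z x (J z) u := by linarith
    rw [e2, e4] at k1 k2
    linear_combination (k1 - k2) / 2 - t * (g x x + t ^ 2 * g z z) * r1
  have := (mul_eq_zero.1 this).resolve_left (mul_ne_zero ht hy)
  linarith

end

end CurvatureAlgebra

end

noncomputable section

namespace CurvatureAlgebra

variable {V : Type*} [AddCommGroup V] [Module ℝ V]
  {g : V →ₗ[ℝ] V →ₗ[ℝ] ℝ} {J : V →ₗ[ℝ] V} {T : V → V → V → V → ℝ}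

/-! ### Unitary frames -/

/-- A family of non-isotropic, pairwise Hermitian-orthogonal vectors. -/
structure IsFrame {ι : Type*} (g : V →ₗ[ℝ] V →ₗ[ℝ] ℝ) (J : V →ₗ[ℝ] V) (E : ι → V) : Prop where
  ne_zero : ∀ a, g (E a) (E a) ≠ 0
  orth : ∀ a b, a ≠ b → HOrth g J (E a) (E b)

/-- The orthogonal projection to the complex span of a frame. -/
def frameProj {ι : Type*} [Fintype ι] (g : V →ₗ[ℝ] V →ₗ[ℝ] ℝ) (J : V →ₗ[ℝ] V) (E : ι → V)
    (v : V) : V :=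
  ∑ a, (g (E a) (E a))⁻¹ • (g v (E a) • E a + g v (J (E a)) • J (E a))

namespace IsFrame

variable {ι : Type*} [Fintype ι] {E : ι → V} (hE : IsFrame g J E) (hg : IsHermitianForm g J)

include hE hg

theorem proj_apply (v : V) (b : ι) : g (frameProj g J E v) (E b) = g v (E b) := by
  rw [frameProj, map_sum, LinearMap.sum_apply, Finset.sum_eq_single b]
  · have := hE.ne_zero b
    simp [hg.J_left, hg.self_J]
    field_simp
  · intro a _ hab
    simp [hg.J_left, (hE.orth a b hab).1, (hE.orth a b hab).2.2.1]
  · simp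

theorem proj_apply_J (v : V) (b : ι) : g (frameProj g J E v) (J (E b)) = g v (J (E b)) := by
  rw [frameProj, map_sum, LinearMap.sum_apply, Finset.sum_eq_single b]
  · have := hE.ne_zero b
    simp [hg.map_J, hg.self_J]
    field_simp
  · intro a _ hab
    simp [hg.map_J, (hE.orth a b hab).1, (hE.orth a b hab).2.2.1]
  · simp

theorem orth_sub_proj (v : V) (b : ι) : HOrth g J (v - frameProj g J E v) (E b) :=
  hg.hOrth_of (by simp [hE.proj_apply hg]) (by simp [hE.proj_apply_J hg])

/-- Otherwise the orthogonal complement of the frame would be totally isotropic, and by polarization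
g would vanish on it. Since V is the span of the frame plus this complement, w would lie in the
radical of g. -/
theorem exists_orth {w : V} (hw : w ≠ 0) (hw' : ∀ a, HOrth g J w (E a)) :
    ∃ v, g v v ≠ 0 ∧ ∀ a, HOrth g J v (E a) := by
  by_contra! H
  have null : ∀ v, (∀ a, HOrth g J v (E a)) → g v v = 0 := fun v hv => by
    by_contra h
    obtain ⟨a, ha⟩ := H v h
    exact ha (hv a)
  refine hw (hg.nondeg w fun v => ?_)
  set v' := v - frameProj g J E v with hv'
  have h1 : g w (frameProj g J E v) = 0 := by
    simp [frameProj, (hw' _).1, (hw' _).2.2.1]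
  have h2 := null w hw'
  have h3 := null v' (hE.orth_sub_proj hg v)
  have h4 := null (w + v') fun a => by
    simpa using (hw' a).comb (hE.orth_sub_proj hg v a) 1 1
  simp only [map_add, LinearMap.add_apply, h2, h3, hg.symm v' w] at h4
  have h5 : g w v' = 0 := by linarith
  rw [hv', map_sub, h1] at h5
  linarith

omit [Fintype ι] in
theorem linearIndependent : LinearIndependent ℝ (Sum.elim E (J ∘ E)) := by
  refine LinearMap.linearIndependent_of_isOrthoᵢ (B := g) ?_ ?_
  · rw [LinearMap.isOrthoᵢ_def]
    rintro (a | a) (b | b) hab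
    · exact (hE.orth a b (by simpa using hab)).1
    · rcases eq_or_ne a b with rfl | h
      · exact hg.self_J _
      · exact (hE.orth a b h).2.2.1
    · rcases eq_or_ne a b with rfl | h
      · simp [hg.J_left, hg.self_J]
      · simp [hg.J_left, (hE.orth a b h).2.2.1]
    · simpa [hg.map_J] using (hE.orth a b (by simpa using hab)).1
  · rintro (a | a)
    · exact hE.ne_zero a
    · simpa [hg.map_J] using hE.ne_zero a

theorem card_le [FiniteDimensional ℝ V] : 2 * Fintype.card ι ≤ Module.finrank ℝ V := by
  have := (hE.linearIndependent hg).fintype_card_le_finrank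
  rw [Fintype.card_sum] at this
  omega

end IsFrame

theorem IsFrame.snoc {m : ℕ} {E : Fin m → V} (hE : IsFrame g J E) {v : V} (hv : g v v ≠ 0)
    (hv' : ∀ a, HOrth g J v (E a)) : IsFrame g J (Fin.snoc E v : Fin (m + 1) → V) where
  ne_zero a := by
    refine Fin.lastCases ?_ (fun a => ?_) a
    · simpa using hv
    · simpa using hE.ne_zero a
  orth a b := by
    refine Fin.lastCases ?_ (fun a => ?_) a <;> refine Fin.lastCases ?_ (fun b => ?_) b
    · simp
    · intro _; simpa using hv' b
    · intro _; simpa using (hv' a).symm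
    · intro h; simpa using hE.orth a b (by simpa using h)

/-- Hermitian orthogonality to m vectors is 2m real linear conditions, so a nonzero solution exists;
`exists_orth` replaces it by a non-isotropic one. -/
theorem IsFrame.exists_orth_of_lt [FiniteDimensional ℝ V] {m : ℕ} {E : Fin m → V}
    (hE : IsFrame g J E) (hg : IsHermitianForm g J) (hm : 2 * m < Module.finrank ℝ V) :
    ∃ v, g v v ≠ 0 ∧ ∀ a, HOrth g J v (E a) := by
  let f : V →ₗ[ℝ] (Fin m ⊕ Fin m → ℝ) := LinearMap.pi fun i => g.flip (Sum.elim E (J ∘ E) i)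
  have hf : LinearMap.ker f ≠ ⊥ := LinearMap.ker_ne_bot_of_finrank_lt (by simp; omega)
  obtain ⟨w, hw, hw0⟩ := Submodule.exists_mem_ne_zero_of_ne_bot hf
  have hw' := fun i => congrFun (LinearMap.mem_ker.1 hw) i
  exact hE.exists_orth hg hw0 fun a =>
    hg.hOrth_of (by simpa [f] using hw' (Sum.inl a)) (by simpa [f] using hw' (Sum.inr a))

theorem IsFrame.exists_extension [FiniteDimensional ℝ V] {k n : ℕ} {E : Fin k → V}
    (hE : IsFrame g J E) (hg : IsHermitianForm g J) (hkn : k ≤ n)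
    (hn : 2 * n ≤ Module.finrank ℝ V) :
    ∃ F : Fin n → V, IsFrame g J F ∧ ∀ i, F (Fin.castLE hkn i) = E i := by
  induction n, hkn using Nat.le_induction with
  | base => exact ⟨E, hE, fun i => rfl⟩
  | succ n hkn ih =>
    obtain ⟨F, hF, hFE⟩ := ih (by omega)
    obtain ⟨v, hv, hv'⟩ := hF.exists_orth_of_lt hg (by omega)
    refine ⟨Fin.snoc F v, hF.snoc hv hv', fun i => ?_⟩
    have : Fin.castLE (hkn.trans n.le_succ) i = Fin.castSucc (Fin.castLE hkn i) := rfl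
    rw [this, Fin.snoc_castSucc, hFE]

/-- A nonzero remainder v - proj v would allow the frame to be enlarged to n + 1 vectors,
contradicting `card_le`. -/
theorem IsFrame.proj_eq [FiniteDimensional ℝ V] {n : ℕ} {E : Fin n → V}
    (hE : IsFrame g J E) (hg : IsHermitianForm g J) (hn : Module.finrank ℝ V = 2 * n) (v : V) :
    frameProj g J E v = v := by
  by_contra h
  obtain ⟨w, hw, hw'⟩ := hE.exists_orth hg (sub_ne_zero.2 (Ne.symm h)) (hE.orth_sub_proj hg v)
  have := (hE.snoc hw hw').card_le hg
  simp at this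
  omega

theorem IsFrame.apply_eq [FiniteDimensional ℝ V] {n : ℕ} {E : Fin n → V}
    (hE : IsFrame g J E) (hg : IsHermitianForm g J) (hn : Module.finrank ℝ V = 2 * n)
    (f : V →ₗ[ℝ] ℝ) (v : V) :
    f v = ∑ a, (g (E a) (E a))⁻¹ * (g v (E a) * f (E a) + g v (J (E a)) * f (J (E a))) := by
  have := congrArg f (hE.proj_eq hg hn v)
  rw [← this, frameProj, map_sum]
  simp [mul_add]

/-- The negative definite 3-space spanned by ν meets the orthogonal complement of the complex line
of `E a₀`, of real codimension 2, in a nonzero vector. Its negative square is a sum over the frame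
without an `a₀` term, so another frame vector is negative. -/
theorem IsFrame.exists_neg [FiniteDimensional ℝ V] {n : ℕ} {E : Fin n → V}
    (hE : IsFrame g J E) (hg : IsHermitianForm g J) (hn : Module.finrank ℝ V = 2 * n)
    (ν : Fin 3 → V) (hν : ∀ i j, g (ν i) (ν j) = if i = j then -1 else 0) (a₀ : Fin n) :
    ∃ a, a ≠ a₀ ∧ g (E a) (E a) < 0 := by
  by_contra! H
  let c : (Fin 3 → ℝ) →ₗ[ℝ] V := Fintype.linearCombination ℝ ν
  let f : (Fin 3 → ℝ) →ₗ[ℝ] (Fin 2 → ℝ) :=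
    (LinearMap.pi ![g.flip (E a₀), g.flip (J (E a₀))]).comp c
  have hf : LinearMap.ker f ≠ ⊥ := LinearMap.ker_ne_bot_of_finrank_lt (by simp)
  obtain ⟨r, hr, hr0⟩ := Submodule.exists_mem_ne_zero_of_ne_bot hf
  have h0 : g (c r) (E a₀) = 0 := by simpa [f] using congrFun (LinearMap.mem_ker.1 hr) 0
  have h1 : g (c r) (J (E a₀)) = 0 := by simpa [f] using congrFun (LinearMap.mem_ker.1 hr) 1
  have h2 : g (c r) (c r) = -(r 0 ^ 2 + r 1 ^ 2 + r 2 ^ 2) := by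
    simp [c, Fintype.linearCombination_apply, Fin.sum_univ_three, hν]
    ring
  have h3 : 0 < r 0 ^ 2 + r 1 ^ 2 + r 2 ^ 2 := by
    by_contra h
    refine hr0 (funext fun i => ?_)
    have := sq_nonneg (r 0); have := sq_nonneg (r 1); have := sq_nonneg (r 2)
    have e0 : r 0 ^ 2 = 0 := by linarith
    have e1 : r 1 ^ 2 = 0 := by linarith
    have e2 : r 2 ^ 2 = 0 := by linarith
    rw [sq_eq_zero_iff] at e0 e1 e2
    fin_cases i <;> assumption
  have h4 : g (c r) (c r) = ∑ a, (g (E a) (E a))⁻¹ * (g (c r) (E a) ^ 2 + g (c r) (J (E a)) ^ 2) := by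
    rw [hE.apply_eq hg hn (g (c r)) (c r)]
    exact Finset.sum_congr rfl fun a _ => by ring
  have h5 : 0 ≤ g (c r) (c r) := by
    rw [h4]
    refine Finset.sum_nonneg fun a _ => ?_
    rcases eq_or_ne a a₀ with rfl | ha
    · simp [h0, h1]
    · exact mul_nonneg (inv_nonneg.2 (H a ha)) (by positivity)
  linarith

/-- Traces of bilinear forms can be computed in a unitary frame. -/
theorem metricTrace_eq_frame [FiniteDimensional ℝ V] {n m : ℕ} {E : Fin n → V}
    (hE : IsFrame g J E) (hg : IsHermitianForm g J) (hn : Module.finrank ℝ V = 2 * n)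
    (e : Module.Basis (Fin m) ℝ V) (he : IsOrthonormal (fun x y => g x y) e)
    {S : V → V → ℝ} (hS : IsBilinearMap ℝ S) :
    metricTrace (fun x y => g x y) e S =
      ∑ a, (g (E a) (E a))⁻¹ * (S (E a) (E a) + S (J (E a)) (J (E a))) := by
  obtain ⟨L, hL⟩ : ∃ L : V →ₗ[ℝ] V →ₗ[ℝ] ℝ, ∀ x y, L x y = S x y := ⟨hS.toLinearMap, fun _ _ => rfl⟩
  have hsq : ∀ i, g (e i) (e i) * g (e i) (e i) = 1 := fun i => by
    rcases he.2 i with h | h <;> simp only [h] <;> norm_num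
  have hexp : ∀ x, ∑ i, (g (e i) (e i) * g (e i) x) • e i = x := fun x => by
    conv_rhs => rw [← e.sum_repr x]
    refine Finset.sum_congr rfl fun i _ => ?_
    congr 1
    conv_lhs => rw [← e.sum_repr x]
    rw [map_sum, Finset.sum_eq_single i]
    · rw [map_smul, smul_eq_mul, mul_left_comm, hsq, mul_one]
    · intro j _ hj
      rw [map_smul, show g (e i) (e j) = 0 from he.1 i j hj.symm, smul_zero]
    · simp
  have key : ∀ x y, ∑ i, g (e i) (e i) * (g (e i) x * L (e i) y) = L x y := fun x y => by
    conv_rhs => rw [← hexp x]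
    simp [mul_assoc]
  simp only [metricTrace, ← hL]
  -- The second argument of L is expanded in the unitary frame; summing over i then contracts the
  -- first by the orthonormal expansion `key`. The inverses occur because frame vectors are not
  -- normalized.
  calc ∑ i, g (e i) (e i) * L (e i) (e i)
      = ∑ i, ∑ a, g (e i) (e i) * ((g (E a) (E a))⁻¹ *
          (g (e i) (E a) * L (e i) (E a) + g (e i) (J (E a)) * L (e i) (J (E a)))) := by
        refine Finset.sum_congr rfl fun i _ => ?_
        rw [← Finset.mul_sum]
        congr 1
        exact hE.apply_eq hg hn (L (e i)) (e i)
    _ = ∑ a, (g (E a) (E a))⁻¹ * (L (E a) (E a) + L (J (E a)) (J (E a))) := by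
        rw [Finset.sum_comm]
        refine Finset.sum_congr rfl fun a _ => ?_
        rw [← key (E a) (E a), ← key (J (E a)) (J (E a)), ← Finset.sum_add_distrib, Finset.mul_sum]
        refine Finset.sum_congr rfl fun i _ => ?_
        ring

end CurvatureAlgebra

end

noncomputable section

namespace CurvatureAlgebra

variable {V : Type*} [AddCommGroup V] [Module ℝ V]
  {g : V →ₗ[ℝ] V →ₗ[ℝ] ℝ} {J : V →ₗ[ℝ] V} {T : V → V → V → V → ℝ}

/-! ### From isotropic planes to orthogonal quadruples -/

/-- `T` vanishes on the planes `span {x, y}` that are strongly isotropic and antiholomorphic. -/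
def VanishesOnIsotropic (g : V →ₗ[ℝ] V →ₗ[ℝ] ℝ) (J : V →ₗ[ℝ] V) (T : V → V → V → V → ℝ) :
    Prop :=
  ∀ x y, LinearIndependent ℝ ![x, y] → (∀ a b : ℝ, J x ≠ a • x + b • y) →
    g x x = 0 → g x y = 0 → g y y = 0 → g x (J y) = 0 → T x y y x = 0

/-- `T` vanishes on the four vectors, taken in any order. -/
def VanishesOn (T : V → V → V → V → ℝ) (x y z u : V) : Prop :=
  T x y z u = 0 ∧ T x z y u = 0 ∧ T x u y z = 0

namespace VanishesOn

variable (hT : IsCurvatureLike T) {x y z u : V} (h : VanishesOn T x y z u)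

include hT h

theorem swap₁₂ : VanishesOn T y x z u :=
  ⟨by rw [hT.swap₁₂, h.1, neg_zero],
    by rw [hT.pair_swap, h.2.2],
    by rw [hT.pair_swap, h.2.1]⟩

theorem swap₂₃ : VanishesOn T x z y u :=
  ⟨h.2.1, h.1, by rw [hT.swap₃₄, h.2.2, neg_zero]⟩

theorem swap₃₄ : VanishesOn T x y u z :=
  ⟨by rw [hT.swap₃₄, h.1, neg_zero], h.2.2, h.2.1⟩

omit h in
-- The device that removes sign conditions: u is a combination of v and v + cu, both of which may
-- have a sign for which vanishing is known.
theorem of_comb {c : ℝ} (hc : c ≠ 0) {v : V} (h1 : VanishesOn T x y z v)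
    (h2 : VanishesOn T x y z (v + c • u)) : VanishesOn T x y z u := by
  obtain ⟨a1, a2, a3⟩ := h1
  obtain ⟨b1, b2, b3⟩ := h2
  simp only [hT.add₄, hT.smul₄, hT.add₂, hT.smul₂, a1, a2, a3, zero_add, mul_eq_zero, hc,
    false_or] at b1 b2 b3
  exact ⟨b1, b2, b3⟩

end VanishesOn

/-- A small perturbation of a positive vector stays positive. For q < 0 the choice c = p/(p - q)
turns the expression into p(p² - pq + q²)/(p - q)². -/
theorem exists_pos_comb {p q : ℝ} (hp : 0 < p) : ∃ c : ℝ, c ≠ 0 ∧ 0 < p + c ^ 2 * q := by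
  by_cases hq : 0 ≤ q
  · exact ⟨1, one_ne_zero, by nlinarith⟩
  · refine ⟨p / (p - q), by have : 0 < p - q := by linarith
                            positivity, ?_⟩
    have h : 0 < p - q := by linarith
    have : p + (p / (p - q)) ^ 2 * q = p * (p ^ 2 - p * q + q ^ 2) / (p - q) ^ 2 := by
      field_simp
      ring
    rw [this]
    have : 0 < p ^ 2 - p * q + q ^ 2 := by nlinarith
    positivity

section

variable (hg : IsHermitianForm g J) (hT : IsCurvatureLike T) (hS : VanishesOnIsotropic g J T)

include hg hT hS

/-- For signs a, b = ±1 the vectors x + az and y + bu span a strongly isotropic antiholomorphic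
plane. Combining the four choices of signs extracts the coefficient of ab, which is twice the stated
sum. -/
theorem VanishesOnIsotropic.sum_eq_zero {x y z u : V} (hx : g x x = -1) (hy : g y y = -1)
    (hz : g z z = 1) (hu : g u u = 1) (hxy : HOrth g J x y) (hxz : HOrth g J x z)
    (hxu : HOrth g J x u) (hyz : HOrth g J y z) (hyu : HOrth g J y u) (hzu : HOrth g J z u) :
    T x y u z + T x u y z = 0 := by
  have key : ∀ a b : ℝ, a ^ 2 = 1 → b ^ 2 = 1 →
      T (x + a • z) (y + b • u) (y + b • u) (x + a • z) = 0 := by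
    intro a b ha hb
    simp only [HOrth] at hxy hxz hxu hyz hyu hzu
    refine hS _ _ ?_ ?_ ?_ ?_ ?_ ?_
    · rw [LinearIndependent.pair_iff]
      intro s t hst
      have h1 := congrArg (fun v => g v x) hst
      have h2 := congrArg (fun v => g v y) hst
      simp [hx, hxy, hxz, hxu] at h1
      simp [hy, hxy, hyz, hyu] at h2
      exact ⟨h1, h2⟩
    · intro s t hst
      have h1 := congrArg (fun v => g v (J x)) hst
      simp [hx, hxy, hxz, hxu, hg.map_J, hg.self_J] at h1
    · simp [hx, hz, hxz]; linear_combination ha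
    · simp [hxy, hxu, hyz, hzu]
    · simp [hy, hu, hyu]; linear_combination hb
    · simp [hxy, hxu, hyz, hzu]
  have k1 := key 1 1 (by norm_num) (by norm_num)
  have k2 := key 1 (-1) (by norm_num) (by norm_num)
  have k3 := key (-1) 1 (by norm_num) (by norm_num)
  have k4 := key (-1) (-1) (by norm_num) (by norm_num)
  simp only [hT.add₁, hT.smul₁, hT.add₂, hT.smul₂, hT.add₃, hT.smul₃, hT.add₄, hT.smul₄]
    at k1 k2 k3 k4
  have e1 : T z u y x = T x y u z := by
    rw [hT.pair_swap, hT.swap₁₂, hT.swap₃₄]; ring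
  have e2 : T z y u x = T x u y z := by
    rw [hT.pair_swap, hT.swap₁₂, hT.swap₃₄]; ring
  linarith

/-- `sum_eq_zero`, and the same with z and u exchanged, express the other two components as ±
T(x,y,z,u); the Bianchi identity becomes 3T(x,y,z,u) = 0. -/
theorem VanishesOnIsotropic.of_unit {x y z u : V} (hx : g x x = -1) (hy : g y y = -1)
    (hz : g z z = 1) (hu : g u u = 1) (hxy : HOrth g J x y) (hxz : HOrth g J x z)
    (hxu : HOrth g J x u) (hyz : HOrth g J y z) (hyu : HOrth g J y u) (hzu : HOrth g J z u) :
    VanishesOn T x y z u := by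
  have h1 := hS.sum_eq_zero hg hT hx hy hz hu hxy hxz hxu hyz hyu hzu
  have h2 := hS.sum_eq_zero hg hT hx hy hu hz hxy hxu hxz hyu hyz hzu.symm
  have b := hT.bianchi x y z u
  have := hT.swap₃₄ x y z u
  have := hT.pair_swap y z x u
  have := hT.swap₁₂ z x y u
  have := hT.swap₃₄ x u y z
  exact ⟨by linarith, by linarith, by linarith⟩

theorem VanishesOnIsotropic.of_neg_neg_pos_pos {x y z u : V} (hx : g x x < 0) (hy : g y y < 0)
    (hz : 0 < g z z) (hu : 0 < g u u) (ho : [x, y, z, u].Pairwise (HOrth g J)) :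
    VanishesOn T x y z u := by
  simp only [List.mem_cons, List.not_mem_nil, or_false, forall_eq_or_imp, forall_eq,
    List.pairwise_cons, List.Pairwise.nil, IsEmpty.forall_iff, implies_true, and_true] at ho
  obtain ⟨⟨hxy, hxz, hxu⟩, ⟨hyz, hyu⟩, hzu⟩ := ho
  have neg : ∀ v, g v v < 0 → ∃ c : ℝ, c ≠ 0 ∧ g (c • v) (c • v) = -1 := fun v hv => by
    have h0 : 0 < √(-g v v) := Real.sqrt_pos.2 (by linarith)
    refine ⟨(√(-g v v))⁻¹, by positivity, ?_⟩
    have := Real.sq_sqrt (show 0 ≤ -g v v by linarith)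
    simp
    field_simp
    linarith
  have pos : ∀ v, 0 < g v v → ∃ c : ℝ, c ≠ 0 ∧ g (c • v) (c • v) = 1 := fun v hv => by
    have h0 : 0 < √(g v v) := Real.sqrt_pos.2 hv
    refine ⟨(√(g v v))⁻¹, by positivity, ?_⟩
    have := Real.sq_sqrt hv.le
    simp
    field_simp
    linarith
  have orth : ∀ {v w : V} (a b : ℝ), HOrth g J v w → HOrth g J (a • v) (b • w) :=
    fun a b h => by simp only [HOrth] at *; simp [h]
  obtain ⟨a, ha, hxa⟩ := neg x hx
  obtain ⟨b, hb, hyb⟩ := neg y hy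
  obtain ⟨c, hc, hzc⟩ := pos z hz
  obtain ⟨d, hd, hud⟩ := pos u hu
  have := hS.of_unit hg hT hxa hyb hzc hud (orth a b hxy) (orth a c hxz) (orth a d hxu)
    (orth b c hyz) (orth b d hyu) (orth c d hzu)
  simpa only [VanishesOn, hT.smul₁, hT.smul₂, hT.smul₃, hT.smul₄, mul_eq_zero, ha, hb, hc, hd,
    false_or] using this

/-- Here the sign of u is arbitrary. The spare positive vector p takes its place, as does p + cu for
a suitable c ≠ 0, and linearity recovers u. -/
theorem VanishesOnIsotropic.of_neg_neg_pos {x y z u p : V} (hx : g x x < 0) (hy : g y y < 0)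
    (hz : 0 < g z z) (hp : 0 < g p p) (ho : [x, y, z, u, p].Pairwise (HOrth g J)) :
    VanishesOn T x y z u := by
  simp only [List.mem_cons, List.not_mem_nil, or_false, forall_eq_or_imp, forall_eq,
    List.pairwise_cons, List.Pairwise.nil, IsEmpty.forall_iff, implies_true, and_true] at ho
  obtain ⟨⟨hxy, hxz, hxu, hxp⟩, ⟨hyz, hyu, hyp⟩, ⟨hzu, hzp⟩, hup⟩ := ho
  obtain ⟨c, hc, hc'⟩ := exists_pos_comb (q := g u u) hp
  have comb : ∀ {v}, HOrth g J v u → HOrth g J v p → HOrth g J v (p + c • u) := fun h1 h2 => by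
    simpa using (h2.symm.comb h1.symm 1 c).symm
  refine VanishesOn.of_comb hT hc (v := p) ?_ ?_
  · exact hS.of_neg_neg_pos_pos hg hT hx hy hz hp (by simp [*])
  · refine hS.of_neg_neg_pos_pos hg hT hx hy hz ?_ (by simp [*])
    have : g (p + c • u) (p + c • u) = g p p + c ^ 2 * g u u := by
      simp [hup.1, hup.2.1]; ring
    rwa [this]

/-- The same perturbation once more, with two spare positive vectors, frees the signs of both z and
u. -/
theorem VanishesOnIsotropic.of_neg_neg {x y z u p q : V} (hx : g x x < 0) (hy : g y y < 0)
    (hp : 0 < g p p) (hq : 0 < g q q) (ho : [x, y, z, u, p, q].Pairwise (HOrth g J)) :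
    VanishesOn T x y z u := by
  simp only [List.mem_cons, List.not_mem_nil, or_false, forall_eq_or_imp, forall_eq,
    List.pairwise_cons, List.Pairwise.nil, IsEmpty.forall_iff, implies_true, and_true] at ho
  obtain ⟨⟨hxy, hxz, hxu, hxp, hxq⟩, ⟨hyz, hyu, hyp, hyq⟩, ⟨hzu, hzp, hzq⟩, ⟨hup, huq⟩, hpq⟩ := ho
  obtain ⟨c, hc, hc'⟩ := exists_pos_comb (q := g u u) hp
  have comb : ∀ {v}, HOrth g J v u → HOrth g J v p → HOrth g J v (p + c • u) := fun h1 h2 => by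
    simpa using (h2.symm.comb h1.symm 1 c).symm
  refine VanishesOn.of_comb hT hc (v := p) ?_ ?_
  · exact (hS.of_neg_neg_pos hg hT hx hy hp hq (u := z)
      (by simp [*, hzp.symm])).swap₃₄ hT
  · refine (hS.of_neg_neg_pos hg hT hx hy ?_ hq (u := z)
      (by simp [*, (comb hzu hzp).symm, (comb huq.symm hpq.symm).symm])).swap₃₄ hT
    have : g (p + c • u) (p + c • u) = g p p + c ^ 2 * g u u := by
      simp [hup.1, hup.2.1]; ring
    rwa [this]

end

theorem IsHermitianForm.neg (hg : IsHermitianForm g J) : IsHermitianForm (-g) J where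
  symm x y := by simp [hg.symm x y]
  J_sq := hg.J_sq
  map_J x y := by simp [hg.map_J]
  nondeg x hx := hg.nondeg x fun y => by simpa using hx y

theorem HOrth.neg {x y : V} (h : HOrth g J x y) : HOrth (-g) J x y := by
  simpa [HOrth] using h

theorem IsFrame.neg {ι : Type*} {E : ι → V} (h : IsFrame g J E) : IsFrame (-g) J E :=
  ⟨fun a => by simpa using h.ne_zero a, fun a b hab => (h.orth a b hab).neg⟩

/-- The hypothesis does not see the sign of g, so statements about two negative vectors also yield
those about two positive ones. -/
theorem VanishesOnIsotropic.neg (hS : VanishesOnIsotropic g J T) :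
    VanishesOnIsotropic (-g) J T := fun x y h1 h2 h3 h4 h5 h6 =>
  hS x y h1 h2 (by simpa using h3) (by simpa using h4) (by simpa using h5) (by simpa using h6)

theorem VanishesOnIsotropic.frame_neg_neg (hg : IsHermitianForm g J) (hT : IsCurvatureLike T)
    (hS : VanishesOnIsotropic g J T) [FiniteDimensional ℝ V] {n : ℕ}
    (hn : Module.finrank ℝ V = 2 * n) {ν : Fin 3 → V}
    (hν : ∀ i j, g (ν i) (ν j) = if i = j then 1 else 0) {E : Fin n → V} (hE : IsFrame g J E)
    {a b c d : Fin n} (hab : a ≠ b) (hac : a ≠ c) (had : a ≠ d) (hbc : b ≠ c) (hbd : b ≠ d)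
    (hcd : c ≠ d) (ha : g (E a) (E a) < 0) (hb : g (E b) (E b) < 0) :
    VanishesOn T (E a) (E b) (E c) (E d) := by
  -- `exists_neg` for -g: the frame contains at least two positive vectors. These are the spares,
  -- distinct by sign from the negative vectors of the quadruple.
  have pos : ∀ i, ∃ j, j ≠ i ∧ 0 < g (E j) (E j) := fun i => by
    obtain ⟨j, hj, hj'⟩ := hE.neg.exists_neg hg.neg hn ν
      (fun i j => by simp [hν]; split_ifs <;> simp) i
    exact ⟨j, hj, by simpa using hj'⟩
  have ne : ∀ {i j}, g (E i) (E i) < 0 → 0 < g (E j) (E j) → i ≠ j := fun h1 h2 h => by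
    subst h; linarith
  have o := hE.orth
  by_cases hc : 0 < g (E c) (E c)
  · by_cases hd : 0 < g (E d) (E d)
    · exact hS.of_neg_neg_pos_pos hg hT ha hb hc hd (by simp [*])
    · have hd := lt_of_le_of_ne (not_lt.1 hd) (hE.ne_zero d)
      obtain ⟨p, hp, hp'⟩ := pos c
      exact hS.of_neg_neg_pos hg hT ha hb hc hp'
        (by simp [*, ne ha hp', ne hb hp', ne hd hp', hp.symm])
  · have hc := lt_of_le_of_ne (not_lt.1 hc) (hE.ne_zero c)
    by_cases hd : 0 < g (E d) (E d)
    · obtain ⟨p, hp, hp'⟩ := pos d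
      exact (hS.of_neg_neg_pos hg hT ha hb hd hp' (u := E c)
        (by simp [*, ne ha hp', ne hb hp', ne hc hp', hp.symm, hcd.symm])).swap₃₄ hT
    · have hd := lt_of_le_of_ne (not_lt.1 hd) (hE.ne_zero d)
      obtain ⟨p, hp, hp'⟩ := pos d
      obtain ⟨q, hq, hq'⟩ := pos p
      exact hS.of_neg_neg hg hT ha hb hp' hq'
        (by simp [*, ne ha hp', ne hb hp', ne hc hp', ne hd hp', ne ha hq', ne hb hq', ne hc hq',
          ne hd hq', hq.symm])

/-- Among the signs of x, y, z two agree. Extending the quadruple to a full frame, `frame_neg_neg`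
applies to that pair, for g or for -g; the symmetries of `VanishesOn` restore the order. -/
theorem VanishesOnIsotropic.vanishesOnOrth (hg : IsHermitianForm g J) (hT : IsCurvatureLike T)
    (hS : VanishesOnIsotropic g J T) [FiniteDimensional ℝ V] {n : ℕ} (h4 : 4 ≤ n)
    (hn : Module.finrank ℝ V = 2 * n) {ν ν' : Fin 3 → V}
    (hν : ∀ i j, g (ν i) (ν j) = if i = j then 1 else 0)
    (hν' : ∀ i j, g (ν' i) (ν' j) = if i = j then -1 else 0) : VanishesOnOrth g J T := by
  intro x y z u ho
  simp only [OrthSystem, List.mem_cons, List.not_mem_nil, or_false, forall_eq_or_imp, forall_eq,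
    List.pairwise_cons, List.Pairwise.nil, IsEmpty.forall_iff, implies_true, and_true] at ho
  obtain ⟨⟨hx, hy, hz, hu⟩, ⟨hxy, hxz, hxu⟩, ⟨hyz, hyu⟩, hzu⟩ := ho
  have hF : IsFrame g J ![x, y, z, u] := by
    refine ⟨fun a => by fin_cases a <;> simpa, fun a b hab => ?_⟩
    fin_cases a <;> fin_cases b <;> first
      | exact absurd rfl hab
      | exact hxy | exact hxz | exact hxu | exact hyz | exact hyu | exact hzu
      | exact hxy.symm | exact hxz.symm | exact hxu.symm | exact hyz.symm | exact hyu.symm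
      | exact hzu.symm
  obtain ⟨E, hE, hE'⟩ := hF.exists_extension hg h4 (by omega)
  have e0 : E (Fin.castLE h4 0) = x := hE' 0
  have e1 : E (Fin.castLE h4 1) = y := hE' 1
  have e2 : E (Fin.castLE h4 2) = z := hE' 2
  have e3 : E (Fin.castLE h4 3) = u := hE' 3
  have main : ∀ (i j k l : Fin 4), i ≠ j → i ≠ k → i ≠ l → j ≠ k → j ≠ l → k ≠ l →
      0 < g (E (Fin.castLE h4 i)) (E (Fin.castLE h4 i)) *
        g (E (Fin.castLE h4 j)) (E (Fin.castLE h4 j)) →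
      VanishesOn T (E (Fin.castLE h4 i)) (E (Fin.castLE h4 j)) (E (Fin.castLE h4 k))
        (E (Fin.castLE h4 l)) := by
    intro i j k l hij hik hil hjk hjl hkl hpos
    have inj := Fin.castLE_injective h4
    rcases mul_pos_iff.1 hpos with h | h
    · exact hS.neg.frame_neg_neg hg.neg hT hn (ν := ν')
        (fun i j => by simp [hν']; split_ifs <;> simp) hE.neg
        (inj.ne hij) (inj.ne hik) (inj.ne hil) (inj.ne hjk) (inj.ne hjl) (inj.ne hkl)
        (by simpa using h.1) (by simpa using h.2)
    · exact hS.frame_neg_neg hg hT hn hν hE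
        (inj.ne hij) (inj.ne hik) (inj.ne hil) (inj.ne hjk) (inj.ne hjl) (inj.ne hkl) h.1 h.2
  have m01 := main 0 1 2 3 (by decide) (by decide) (by decide) (by decide) (by decide) (by decide)
  have m02 := main 0 2 1 3 (by decide) (by decide) (by decide) (by decide) (by decide) (by decide)
  have m12 := main 1 2 0 3 (by decide) (by decide) (by decide) (by decide) (by decide) (by decide)
  rw [e0, e1, e2, e3] at m01 m02 m12
  by_cases c1 : 0 < g x x * g y y
  · exact (m01 c1).1
  by_cases c2 : 0 < g x x * g z z
  · exact ((m02 c2).swap₂₃ hT).1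
  by_cases c3 : 0 < g y y * g z z
  · exact (((m12 c3).swap₂₃ hT).swap₁₂ hT).1
  exfalso
  have d1 : g x x * g y y < 0 := lt_of_le_of_ne (not_lt.1 c1) (mul_ne_zero hx hy)
  have d2 : g x x * g z z < 0 := lt_of_le_of_ne (not_lt.1 c2) (mul_ne_zero hx hz)
  have d3 : 0 < (g x x * g y y) * (g x x * g z z) := mul_pos_of_neg_of_neg d1 d2
  exact c3 (by
    have : (g x x * g y y) * (g x x * g z z) = g x x ^ 2 * (g y y * g z z) := by ring
    rw [this] at d3
    exact (mul_pos_iff_of_pos_left (by positivity)).1 d3)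

end CurvatureAlgebra

end

noncomputable section

namespace CurvatureAlgebra

variable {V : Type*} [AddCommGroup V] [Module ℝ V]
  {g : V →ₗ[ℝ] V →ₗ[ℝ] ℝ} {J : V →ₗ[ℝ] V} {T : V → V → V → V → ℝ}

/-! ### Trace-free tensors vanishing on orthogonal quadruples -/

/-- The traces of `T` over a complete unitary frame vanish. -/
def FrameTraceFree (n : ℕ) (g : V →ₗ[ℝ] V →ₗ[ℝ] ℝ) (J : V →ₗ[ℝ] V) (T : V → V → V → V → ℝ) :
    Prop :=
  ∀ E : Fin n → V, IsFrame g J E → ∀ z u,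
    ∑ a, (g (E a) (E a))⁻¹ * (T (E a) z u (E a) + T (J (E a)) z u (J (E a))) = 0 ∧
    ∑ a, (g (E a) (E a))⁻¹ * (T (E a) z u (J (E a)) - T (J (E a)) z u (E a)) = 0

section

variable (hg : IsHermitianForm g J) (hT : IsCurvatureLike T) (hC : VanishesOnOrth g J T)

include hg hT hC

/-- x and Jx have the same square and are compared by `ratio` with the same y. -/
theorem VanishesOnOrth.ratio_self {x y z u : V} (h : OrthSystem g J [x, y, z, u]) :
    T (J x) z (J x) u = T x z x u := by
  have h1 := hC.ratio hg hT h
  have h2 := hC.ratio hg hT (x := J x) (y := y) (z := z) (u := u) (by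
    simp [OrthSystem, hg.map_J] at h ⊢
    exact ⟨h.1, ⟨h.2.1.1.J_left hg, h.2.1.2.1.J_left hg, h.2.1.2.2.J_left hg⟩, h.2.2⟩)
  rw [hg.map_J, ← h1] at h2
  exact mul_left_cancel₀ (h.1 y (by simp)) h2

theorem VanishesOnOrth.ratio_J_self {x y z u : V} (h : OrthSystem g J [x, y, z, u]) :
    T (J x) z x u = -T x z (J x) u := by
  have h1 := hC.ratio_J hg hT h
  have h2 := hC.ratio_J hg hT (x := J x) (y := y) (z := z) (u := u) (by
    simp [OrthSystem, hg.map_J] at h ⊢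
    exact ⟨h.1, ⟨h.2.1.1.J_left hg, h.2.1.2.1.J_left hg, h.2.1.2.2.J_left hg⟩, h.2.2⟩)
  rw [hg.map_J, ← h1, hg.J_sq, hT.neg₃] at h2
  have := mul_left_cancel₀ (h.1 y (by simp)) (h2.trans rfl)
  linarith

omit hC in
-- The (z,u) components of the two traces, in a frame containing x, z, u. By `ratio` and `ratio_J`
-- the n - 3 remaining complex lines contribute as much as the line of x, namely -2A or -2B over
-- g(x,x); the lines of z and u are evaluated by `triple`. The totals are 2n - 2 and 2n + 2.
theorem FrameTraceFree.relations (hC : VanishesOnOrth g J T) [FiniteDimensional ℝ V] {n : ℕ}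
    (h4 : 4 ≤ n) (hn : Module.finrank ℝ V = 2 * n) (hF : FrameTraceFree n g J T) {x z u : V}
    (h : OrthSystem g J [x, z, u]) :
    (2 * (n : ℝ) - 2) * T x z x u = 3 * T x (J z) (J x) u - 3 * T x z (J x) (J u) ∧
    (2 * (n : ℝ) + 2) * T x z (J x) u = T x z x (J u) - T x (J z) x u := by
  obtain ⟨m, rfl⟩ : ∃ m, n = m + 3 := ⟨n - 3, by omega⟩
  have ratio := @VanishesOnOrth.ratio V _ _ g J T hg hT hC
  have ratio_J := @VanishesOnOrth.ratio_J V _ _ g J T hg hT hC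
  have ratio_self := @VanishesOnOrth.ratio_self V _ _ g J T hg hT hC
  have ratio_J_self := @VanishesOnOrth.ratio_J_self V _ _ g J T hg hT hC
  have triple := @VanishesOnOrth.triple V _ _ g J T hg hT hC
  simp only [OrthSystem, List.mem_cons, List.not_mem_nil, or_false, forall_eq_or_imp, forall_eq,
    List.pairwise_cons, List.Pairwise.nil, IsEmpty.forall_iff, implies_true, and_true]
    at h ratio ratio_J ratio_self ratio_J_self triple
  obtain ⟨⟨hx, hz, hu⟩, ⟨hxz, hxu⟩, hzu⟩ := h
  have hE₀ : IsFrame g J ![x, z, u] := by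
    refine ⟨fun a => by fin_cases a <;> simpa, fun a b hab => ?_⟩
    fin_cases a <;> fin_cases b <;> first
      | exact absurd rfl hab
      | exact hxz | exact hxu | exact hzu
      | exact hxz.symm | exact hxu.symm | exact hzu.symm
  obtain ⟨E, hE, hE'⟩ := hE₀.exists_extension hg (show 3 ≤ m + 3 by omega) (by omega)
  have e0 : E 0 = x := hE' 0
  have e1 : E (Fin.succ 0) = z := hE' 1
  have e2 : E (Fin.succ (Fin.succ 0)) = u := hE' 2
  obtain ⟨hr, -⟩ := hF E hE z u
  obtain ⟨-, hs⟩ := hF E hE z u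
  rw [Fin.sum_univ_succ, Fin.sum_univ_succ, Fin.sum_univ_succ, e0, e1, e2] at hr hs
  set W : Fin m → V := fun i => E i.succ.succ.succ with hW
  have wn : ∀ i, g (W i) (W i) ≠ 0 := fun i => hE.ne_zero _
  have wx : ∀ i, HOrth g J (W i) x := fun i => by
    rw [← e0]; exact hE.orth _ _ (Fin.succ_ne_zero _)
  have wz : ∀ i, HOrth g J (W i) z := fun i => by
    rw [← e1]; exact hE.orth _ _ ((Fin.succ_injective _).ne (Fin.succ_ne_zero _))
  have wu : ∀ i, HOrth g J (W i) u := fun i => by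
    rw [← e2]
    exact hE.orth _ _ ((Fin.succ_injective _).ne ((Fin.succ_injective _).ne (Fin.succ_ne_zero _)))
  -- This is where n ≥ 4 is needed: the identities for quadruples require a comparison vector
  -- besides x, z, u.
  obtain ⟨y, hy, hyx, hyz, hyu⟩ : ∃ y, g y y ≠ 0 ∧ HOrth g J y x ∧ HOrth g J y z ∧ HOrth g J y u :=
    ⟨W ⟨0, by omega⟩, wn _, wx _, wz _, wu _⟩
  set A := T x z x u with hA
  set B := T x z (J x) u with hB
  have x1 : T (J x) z (J x) u = A := ratio_self (y := y)
    ⟨⟨hx, hy, hz, hu⟩, ⟨hyx.symm, hxz, hxu⟩, ⟨hyz, hyu⟩, hzu⟩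
  have x2 : ∀ z' u', g z' z' ≠ 0 → g u' u' ≠ 0 → HOrth g J x z' → HOrth g J x u' →
      HOrth g J y z' → HOrth g J y u' → HOrth g J z' u' → T (J x) z' x u' = -T x z' (J x) u' :=
    fun z' u' h1 h2 h3 h4 h5 h6 h7 => ratio_J_self (y := y)
      ⟨⟨hx, hy, h1, h2⟩, ⟨hyx.symm, h3, h4⟩, ⟨h5, h6⟩, h7⟩
  have xB := x2 z u hz hu hxz hxu hyz hyu hzu
  have xBJ := x2 z (J u) hz (by rwa [hg.map_J]) hxz (hxu.J_right hg) hyz (hyu.J_right hg)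
    (hzu.J_right hg)
  have w1 : ∀ i, g x x * T (W i) z (W i) u = g (W i) (W i) * A := fun i =>
    ratio ⟨⟨wn i, hx, hz, hu⟩, ⟨wx i, wz i, wu i⟩, ⟨hxz, hxu⟩, hzu⟩
  have w2 : ∀ i, g x x * T (J (W i)) z (J (W i)) u = g (W i) (W i) * A := fun i => by
    have := ratio (x := J (W i)) (y := x) (z := z) (u := u) ⟨⟨by rw [hg.map_J]; exact wn i,
      hx, hz, hu⟩, ⟨(wx i).J_left hg, (wz i).J_left hg, (wu i).J_left hg⟩, ⟨hxz, hxu⟩, hzu⟩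
    rwa [hg.map_J] at this
  have w3 : ∀ i, g x x * T (W i) z (J (W i)) u = g (W i) (W i) * B := fun i =>
    ratio_J ⟨⟨wn i, hx, hz, hu⟩, ⟨wx i, wz i, wu i⟩, ⟨hxz, hxu⟩, hzu⟩
  have w4 : ∀ i, T (J (W i)) z (W i) u = -T (W i) z (J (W i)) u := fun i =>
    ratio_J_self ⟨⟨wn i, hx, hz, hu⟩, ⟨wx i, wz i, wu i⟩, ⟨hxz, hxu⟩, hzu⟩
  have t1 := triple (x := J z) (y := y) (z := x) (u := u) ⟨⟨by rwa [hg.map_J], hy, hx, hu⟩,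
    ⟨(hyz.J_right hg).symm, (hxz.J_right hg).symm, hzu.J_left hg⟩, ⟨hyx, hyu⟩, hxu⟩
  have t2 := triple (x := J u) (y := y) (z := x) (u := z) ⟨⟨by rwa [hg.map_J], hy, hx, hz⟩,
    ⟨(hyu.J_right hg).symm, (hxu.J_right hg).symm, hzu.symm.J_left hg⟩, ⟨hyx, hyz⟩, hxz⟩
  have t3 := triple (x := z) (y := y) (z := x) (u := u) ⟨⟨hz, hy, hx, hu⟩,
    ⟨hyz.symm, hxz.symm, hzu⟩, ⟨hyx, hyu⟩, hxu⟩
  have t4 := triple (x := u) (y := y) (z := x) (u := z) ⟨⟨hu, hy, hx, hz⟩,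
    ⟨hyu.symm, hxu.symm, hzu.symm⟩, ⟨hyx, hyz⟩, hxz⟩
  rw [hg.map_J, hg.J_sq, hT.neg₂, hT.neg₂] at t1 t2
  have p1 : T x u x z = A := hT.pair_swap _ _ _ _
  have p2 : T x (J u) (J x) z = -T x z (J x) (J u) := by rw [hT.pair_swap, xBJ]
  have p3 : T x (J u) x z = T x z x (J u) := hT.pair_swap _ _ _ _
  have p4 : T x u (J x) z = -B := by rw [hT.pair_swap, xB]
  constructor
  · have s0 : (g x x)⁻¹ * (T x z u x + T (J x) z u (J x)) = (g x x)⁻¹ * (-2 * A) := by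
      rw [hT.swap₃₄ x z u x, hT.swap₃₄ (J x) z u, x1]; ring
    have s1 : (g z z)⁻¹ * (T z z u z + T (J z) z u (J z)) =
        (g x x)⁻¹ * (-A + 3 * T x (J z) (J x) u) := by
      rw [hT.self₁₂, hT.swap₃₄ (J z) z u]
      field_simp
      linarith
    have s2 : (g u u)⁻¹ * (T u z u u + T (J u) z u (J u)) =
        (g x x)⁻¹ * (-A - 3 * T x z (J x) (J u)) := by
      rw [hT.self₃₄, hT.pair_swap (J u) z, hT.swap₁₂ u (J u)]
      field_simp
      rw [p1, p2] at t2
      linarith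
    have s3 : ∀ i, (g (W i) (W i))⁻¹ * (T (W i) z u (W i) + T (J (W i)) z u (J (W i))) =
        (g x x)⁻¹ * (-2 * A) := fun i => by
      rw [hT.swap₃₄ (W i) z u, hT.swap₃₄ (J (W i)) z u]
      have := wn i
      field_simp
      linarith [w1 i, w2 i]
    rw [s0, s1, s2, Finset.sum_congr rfl (fun i _ => s3 i), Finset.sum_const, Finset.card_univ,
      Fintype.card_fin, nsmul_eq_mul] at hr
    field_simp at hr
    push_cast
    linarith
  · have s0 : (g x x)⁻¹ * (T x z u (J x) - T (J x) z u x) = (g x x)⁻¹ * (-2 * B) := by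
      rw [hT.swap₃₄ x z u, hT.swap₃₄ (J x) z u, xB]; ring
    have s1 : (g z z)⁻¹ * (T z z u (J z) - T (J z) z u z) =
        (g x x)⁻¹ * (-T x (J z) x u - 3 * B) := by
      rw [hT.self₁₂, hT.swap₃₄ (J z) z u, hT.swap₁₂ (J z) z]
      field_simp
      linarith
    have s2 : (g u u)⁻¹ * (T u z u (J u) - T (J u) z u u) =
        (g x x)⁻¹ * (T x z x (J u) - 3 * B) := by
      rw [hT.self₃₄, hT.pair_swap u z]
      field_simp
      rw [p3, p4] at t4
      linarith
    have s3 : ∀ i, (g (W i) (W i))⁻¹ * (T (W i) z u (J (W i)) - T (J (W i)) z u (W i)) =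
        (g x x)⁻¹ * (-2 * B) := fun i => by
      rw [hT.swap₃₄ (W i) z u, hT.swap₃₄ (J (W i)) z u, w4]
      have := wn i
      field_simp
      linarith [w3 i]
    rw [s0, s1, s2, Finset.sum_congr rfl (fun i _ => s3 i), Finset.sum_const, Finset.card_univ,
      Fintype.card_fin, nsmul_eq_mul] at hs
    field_simp at hs
    push_cast
    linarith

/-- The relations for (z,u), (Jz,Ju), (Jz,u) and (z,Ju) form a closed linear system in the
components obtained by inserting J. -/
theorem FrameTraceFree.eq_zero_of_triple [FiniteDimensional ℝ V] {n : ℕ}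
    (h4 : 4 ≤ n) (hn : Module.finrank ℝ V = 2 * n) (hF : FrameTraceFree n g J T) {x z u : V}
    (h : OrthSystem g J [x, z, u]) : T x z x u = 0 ∧ T x z (J x) u = 0 := by
  have hN : (4 : ℝ) ≤ n := by exact_mod_cast h4
  have A0 : ∀ {z u : V}, OrthSystem g J [x, z, u] → T x z x u = 0 := fun {z u} h => by
    have sys : OrthSystem g J [x, J z, u] ∧ OrthSystem g J [x, z, J u] ∧
        OrthSystem g J [x, J z, J u] := by
      simp [OrthSystem, hg.map_J] at h ⊢
      obtain ⟨⟨hx, hz, hu⟩, ⟨hxz, hxu⟩, hzu⟩ := h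
      simp [*, hxz.J_right hg, hxu.J_right hg, hzu.J_right hg, hzu.J_left hg,
        (hzu.J_right hg).J_left hg]
    have r1 := (hF.relations hg hT hC h4 hn h).1
    have r2 := (hF.relations hg hT hC h4 hn sys.2.2).1
    have r3 := (hF.relations hg hT hC h4 hn sys.1).2
    have r4 := (hF.relations hg hT hC h4 hn sys.2.1).2
    simp only [hg.J_sq, hT.neg₂, hT.neg₄] at r2 r3 r4
    have e1 : (2 * (n : ℝ) - 2) * (T x z x u - T x (J z) x (J u)) = 0 := by linarith
    have e2 := (mul_eq_zero.1 e1).resolve_left (by linarith)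
    have e3 : T x (J z) x (J u) = T x z x u := by linarith
    rw [e3] at r3 r4
    -- The determinant is 4n² - 16, nonzero because n ≥ 4.
    have e4 : ((2 * (n : ℝ) - 2) * (2 * n + 2) - 12) * T x z x u = 0 := by
      linear_combination (2 * (n : ℝ) + 2) * r1 + 3 * r3 - 3 * r4
    exact (mul_eq_zero.1 e4).resolve_left (by nlinarith)
  refine ⟨A0 h, ?_⟩
  have sys : OrthSystem g J [x, J z, u] ∧ OrthSystem g J [x, z, J u] := by
    simp [OrthSystem, hg.map_J] at h ⊢
    obtain ⟨⟨hx, hz, hu⟩, ⟨hxz, hxu⟩, hzu⟩ := h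
    simp [*, hxz.J_right hg, hxu.J_right hg, hzu.J_right hg, hzu.J_left hg]
  have r := (hF.relations hg hT hC h4 hn h).2
  rw [A0 sys.1, A0 sys.2, sub_zero] at r
  exact (mul_eq_zero.1 r).resolve_left (by linarith)

/-- `triple` expresses T(x,Jx,x,u) through components on three complex lines, which are already
zero; a frame of four vectors supplies the third line and the comparison vector. -/
theorem FrameTraceFree.eq_zero_of_pair [FiniteDimensional ℝ V] {n : ℕ}
    (h4 : 4 ≤ n) (hn : Module.finrank ℝ V = 2 * n) (hF : FrameTraceFree n g J T) {x u : V}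
    (h : OrthSystem g J [x, u]) : T x (J x) x u = 0 := by
  have tri := @FrameTraceFree.eq_zero_of_triple V _ _ g J T hg hT hC _ n h4 hn hF
  have triple := @VanishesOnOrth.triple V _ _ g J T hg hT hC
  simp only [OrthSystem, List.mem_cons, List.not_mem_nil, or_false, forall_eq_or_imp, forall_eq,
    List.pairwise_cons, List.Pairwise.nil, IsEmpty.forall_iff, implies_true, and_true]
    at h tri triple
  obtain ⟨⟨hx, hu⟩, hxu⟩ := h
  have hE₀ : IsFrame g J ![x, u] := by
    refine ⟨fun a => by fin_cases a <;> simpa, fun a b hab => ?_⟩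
    fin_cases a <;> fin_cases b <;> first
      | exact absurd rfl hab
      | exact hxu | exact hxu.symm
  obtain ⟨E, hE, hE'⟩ := hE₀.exists_extension hg (show 2 ≤ 4 by omega) (by omega)
  have e0 : E 0 = x := hE' 0
  have e1 : E 1 = u := hE' 1
  have o := hE.orth
  have o01 := o 0 2 (by decide)
  have o02 := o 0 3 (by decide)
  have o11 := o 2 1 (by decide)
  have o12 := o 3 1 (by decide)
  have o23 := o 2 3 (by decide)
  rw [e0] at o01 o02
  rw [e1] at o11 o12
  have h2 := hE.ne_zero 2
  have h3 := hE.ne_zero 3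
  have t := triple (x := x) (y := E 3) (z := E 2) (u := u)
    ⟨⟨hx, h3, h2, hu⟩, ⟨o02, o01, hxu⟩, ⟨o23.symm, o12⟩, o11⟩
  rw [(tri (x := E 2) (z := J x) (u := u) ⟨⟨h2, by rwa [hg.map_J], hu⟩,
      ⟨o01.symm.J_right hg, o11⟩, hxu.J_left hg⟩).1,
    (tri (x := E 2) (z := x) (u := u) ⟨⟨h2, hx, hu⟩, ⟨o01.symm, o11⟩, hxu⟩).2] at t
  simpa [h2] using t

end

end CurvatureAlgebra

end

/-! ### Components on one or two complex lines -/

noncomputable section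

namespace CurvatureAlgebra

variable {V : Type*} [AddCommGroup V] [Module ℝ V]
  {g : V →ₗ[ℝ] V →ₗ[ℝ] ℝ} {J : V →ₗ[ℝ] V} {T : V → V → V → V → ℝ}

/-- `T` vanishes on arguments from a unitary frame unless they lie in one complex line or in two
complex lines, two arguments in each. -/
structure VanishesOffPairs (g : V →ₗ[ℝ] V →ₗ[ℝ] ℝ) (J : V →ₗ[ℝ] V) (T : V → V → V → V → ℝ) :
    Prop where
  triple : ∀ x z u, OrthSystem g J [x, z, u] → T x z x u = 0
  triple_J : ∀ x z u, OrthSystem g J [x, z, u] → T x z (J x) u = 0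
  pair : ∀ x u, OrthSystem g J [x, u] → T x (J x) x u = 0

section

variable (hg : IsHermitianForm g J) (hT : IsCurvatureLike T) (hD : VanishesOffPairs g J T)

include hg hT hD

namespace VanishesOffPairs

/-- Now the form (a, b) ↦ T(a,z,b,z) vanishes on orthogonal pairs, so the repeated argument z is
allowed. The two variants that follow insert J in the third slot, or in the third and fourth. -/
theorem ratio {x y z : V} (h : OrthSystem g J [x, y, z]) :
    g y y * T x z x z = g x x * T y z y z := by
  simp only [OrthSystem, List.mem_cons, List.not_mem_nil, or_false, forall_eq_or_imp, forall_eq,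
    List.pairwise_cons, List.Pairwise.nil, IsEmpty.forall_iff, implies_true, and_true] at h
  obtain ⟨⟨hx, hy, hz⟩, ⟨hxy, hxz⟩, hyz⟩ := h
  refine rotation (fun a b => T a z b z) (fun a b c d => ?_) hx hy hxy hg ?_
  · simp only [hT.add₁, hT.smul₁, hT.add₃, hT.smul₃]; ring
  · intro v w hv hw hvw hv0 hw0
    have := hD.triple z v w (by simp [OrthSystem, *, (hv z hxz hyz).symm, (hw z hxz hyz).symm])
    change T v z w z = 0
    rw [hT.swap₁₂, hT.swap₃₄, this]; simp

theorem ratio_J {x y z : V} (h : OrthSystem g J [x, y, z]) :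
    g y y * T x z (J x) z = g x x * T y z (J y) z := by
  simp only [OrthSystem, List.mem_cons, List.not_mem_nil, or_false, forall_eq_or_imp, forall_eq,
    List.pairwise_cons, List.Pairwise.nil, IsEmpty.forall_iff, implies_true, and_true] at h
  obtain ⟨⟨hx, hy, hz⟩, ⟨hxy, hxz⟩, hyz⟩ := h
  refine rotation (fun a b => T a z (J b) z) (fun a b c d => ?_) hx hy hxy hg ?_
  · simp only [map_add, map_smul, hT.add₁, hT.smul₁, hT.add₃, hT.smul₃]; ring
  · intro v w hv hw hvw hv0 hw0
    have := hD.triple z v (J w) (by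
      simp [OrthSystem, *, hg.map_J, (hv z hxz hyz).symm, (hw z hxz hyz).symm.J_right hg,
        hvw.J_right hg])
    change T v z (J w) z = 0
    rw [hT.swap₁₂, hT.swap₃₄, this]; simp

theorem ratio_JJ {x y z : V} (h : OrthSystem g J [x, y, z]) :
    g y y * T x z (J x) (J z) = g x x * T y z (J y) (J z) := by
  simp only [OrthSystem, List.mem_cons, List.not_mem_nil, or_false, forall_eq_or_imp, forall_eq,
    List.pairwise_cons, List.Pairwise.nil, IsEmpty.forall_iff, implies_true, and_true] at h
  obtain ⟨⟨hx, hy, hz⟩, ⟨hxy, hxz⟩, hyz⟩ := h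
  refine rotation (fun a b => T a z (J b) (J z)) (fun a b c d => ?_) hx hy hxy hg ?_
  · simp only [map_add, map_smul, hT.add₁, hT.smul₁, hT.add₃, hT.smul₃]; ring
  · intro v w hv hw hvw hv0 hw0
    have := hD.triple_J z v (J w) (by
      simp [OrthSystem, *, hg.map_J, (hv z hxz hyz).symm, (hw z hxz hyz).symm.J_right hg,
        hvw.J_right hg])
    change T v z (J w) (J z) = 0
    rw [hT.swap₁₂, hT.swap₃₄, this]; simp

omit hT hD in
theorem _root_.CurvatureAlgebra.OrthSystem.J_head {x y z : V} (h : OrthSystem g J [x, y, z]) :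
    OrthSystem g J [J x, y, z] := by
  simp [OrthSystem, hg.map_J] at h ⊢
  exact ⟨h.1, ⟨h.2.1.1.J_left hg, h.2.1.2.J_left hg⟩, h.2.2⟩

theorem diag_J {x y z : V} (h : OrthSystem g J [x, y, z]) : T (J x) z (J x) z = T x z x z := by
  have h1 := hD.ratio hg hT h
  have h2 := hD.ratio hg hT (h.J_head hg)
  rw [hg.map_J, ← h1] at h2
  exact mul_left_cancel₀ (h.1 y (by simp)) h2

theorem mixed_J {x y z : V} (h : OrthSystem g J [x, y, z]) :
    T (J x) z x (J z) = -T x z (J x) (J z) := by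
  have h1 := hD.ratio_JJ hg hT h
  have h2 := hD.ratio_JJ hg hT (h.J_head hg)
  rw [hg.map_J, ← h1, hg.J_sq, hT.neg₃] at h2
  have := mul_left_cancel₀ (h.1 y (by simp)) (h2.trans rfl)
  linarith

/-- Replacing x by Jx preserves the quotient in `ratio_J` but, by J² = -1 and pair symmetry, changes
the sign of the component. -/
theorem skew {x y z : V} (h : OrthSystem g J [x, y, z]) : T x z (J x) z = 0 := by
  have h1 := hD.ratio_J hg hT h
  have h2 := hD.ratio_J hg hT (h.J_head hg)
  rw [hg.map_J, ← h1, hg.J_sq, hT.neg₃, hT.pair_swap] at h2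
  have := mul_left_cancel₀ (h.1 y (by simp)) (h2.trans rfl)
  linarith

/-- The condition T(v,Jv,v,w) = 0 for v = x + ry and its orthogonal partner w = J(r g(y,y) x -
g(x,x) y) is polynomial in r; the identity is its linear coefficient. -/
theorem holomorphic {x y : V} (h : OrthSystem g J [x, y]) :
    g y y * T x (J x) x (J x) =
      g x x * (T y (J x) x (J y) + T x (J y) x (J y) + T x (J x) y (J y)) := by
  simp only [OrthSystem, List.mem_cons, List.not_mem_nil, or_false, forall_eq_or_imp, forall_eq,
    List.pairwise_cons, List.Pairwise.nil, IsEmpty.forall_iff, implies_true, and_true] at h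
  obtain ⟨⟨hx, hy⟩, hxy⟩ := h
  obtain ⟨t, ht, ht1, ht2⟩ := exists_mul_add_ne_zero (g x x) hy
  have key : ∀ r : ℝ, g x x + r ^ 2 * g y y ≠ 0 →
      T (x + r • y) (J x + r • J y) (x + r • y) ((r * g y y) • J x + (-g x x) • J y) = 0 := by
    intro r hr
    have := hD.pair (x + r • y) ((r * g y y) • J x + (-g x x) • J y) (by
      have e1 : g (x + r • y) (x + r • y) = g x x + r ^ 2 * g y y := by
        simp [hxy.1, hxy.2.1]; ring
      have e2 : g ((r * g y y) • J x + (-g x x) • J y) ((r * g y y) • J x + (-g x x) • J y) =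
          g x x * g y y * (g x x + r ^ 2 * g y y) := by
        simp [hg.map_J, hxy.1, hxy.2.1]; ring
      simp only [OrthSystem, List.mem_cons, List.not_mem_nil, or_false, forall_eq_or_imp,
        forall_eq, List.pairwise_cons, List.Pairwise.nil, IsEmpty.forall_iff, implies_true,
        and_true]
      refine ⟨⟨by rwa [e1], by rw [e2]; exact mul_ne_zero (mul_ne_zero hx hy) hr⟩, ?_⟩
      refine hg.hOrth_of ?_ ?_
      · simp [hg.self_J, hxy.2.2.1, hxy.2.2.2]
      · simp [hg.J_sq, hxy.1, hxy.2.1]; ring)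
    simpa only [map_add, map_smul] using this
  have k1 := key t ht1
  have k2 := key (-t) (by rwa [neg_sq])
  have k3 := key (2 * t) ht2
  have k4 := key (-(2 * t)) (by rwa [neg_sq])
  simp only [hT.add₁, hT.smul₁, hT.add₂, hT.smul₂, hT.add₃, hT.smul₃, hT.add₄, hT.smul₄]
    at k1 k2 k3 k4
  -- The odd part has the form αr + βr³. This combination of its values at t and 2t eliminates β and
  -- leaves 6αt.
  have : 6 * t * (g y y * T x (J x) x (J x) -
      g x x * (T y (J x) x (J y) + T x (J y) x (J y) + T x (J x) y (J y))) = 0 := by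
    linear_combination 4 * k1 - 4 * k2 - (k3 - k4) / 2
  have := (mul_eq_zero.1 this).resolve_left (by simpa using ht)
  linarith

/-- All lines other than that of x contribute equally to the traces. With H, K, M as set in the
proof, the traces say that g(y,y) H equals both -2(n - 1) g(x,x) K and -2(n - 1) g(x,x) M, while
`holomorphic` gives g(y,y) H = g(x,x)(K + 3M). Hence K = M, and then K = H = 0. -/
theorem sectional_eq_zero [FiniteDimensional ℝ V] {n : ℕ} (h3 : 3 ≤ n)
    (hn : Module.finrank ℝ V = 2 * n) (hF : FrameTraceFree n g J T) {x : V} (hx : g x x ≠ 0) :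
    T x (J x) (J x) x = 0 ∧ ∀ y, g y y ≠ 0 → HOrth g J y x → T x y y x = 0 ∧ T x y (J y) x = 0 := by
  obtain ⟨m, rfl⟩ : ∃ m, n = m + 3 := ⟨n - 3, by omega⟩
  have ratio := @ratio V _ _ g J T hg hT hD
  have ratio_JJ := @ratio_JJ V _ _ g J T hg hT hD
  have diag_J := @diag_J V _ _ g J T hg hT hD
  have mixed_J := @mixed_J V _ _ g J T hg hT hD
  have skew := @skew V _ _ g J T hg hT hD
  have hol := @holomorphic V _ _ g J T hg hT hD
  simp only [OrthSystem, List.mem_cons, List.not_mem_nil, or_false, forall_eq_or_imp, forall_eq,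
    List.pairwise_cons, List.Pairwise.nil, IsEmpty.forall_iff, implies_true, and_true]
    at ratio ratio_JJ diag_J mixed_J skew hol
  -- The holomorphic component does not involve y, but its vanishing is deduced with the help of
  -- some y, which exists for dimension reasons.
  suffices H : ∀ y, g y y ≠ 0 → HOrth g J y x →
      T x (J x) (J x) x = 0 ∧ T x y y x = 0 ∧ T x y (J y) x = 0 by
    have hE₀ : IsFrame g J ![x] :=
      ⟨fun a => by fin_cases a; simpa, fun a b hab => absurd (Subsingleton.elim a b) hab⟩
    obtain ⟨y, hy, hyx⟩ := hE₀.exists_orth_of_lt hg (by omega)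
    exact ⟨(H y hy (by simpa using hyx 0)).1, fun y hy hyx => (H y hy hyx).2⟩
  intro y hy hyx
  have hE₀ : IsFrame g J ![x, y] := by
    refine ⟨fun a => by fin_cases a <;> simpa, fun a b hab => ?_⟩
    fin_cases a <;> fin_cases b <;> first
      | exact absurd rfl hab
      | exact hyx | exact hyx.symm
  obtain ⟨E, hE, hE'⟩ := hE₀.exists_extension hg (show 2 ≤ m + 3 by omega) (by omega)
  have e0 : E 0 = x := hE' 0
  have e1 : E (Fin.succ 0) = y := hE' 1
  obtain ⟨hr, -⟩ := hF E hE x x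
  obtain ⟨-, hs⟩ := hF E hE x (J x)
  rw [Fin.sum_univ_succ, Fin.sum_univ_succ, e0, e1] at hr hs
  set W : Fin (m + 1) → V := fun i => E i.succ.succ with hW
  have wn : ∀ i, g (W i) (W i) ≠ 0 := fun i => hE.ne_zero _
  have wx : ∀ i, HOrth g J (W i) x := fun i => by
    rw [← e0]; exact hE.orth _ _ (Fin.succ_ne_zero _)
  have wy : ∀ i, HOrth g J (W i) y := fun i => by
    rw [← e1]; exact hE.orth _ _ ((Fin.succ_injective _).ne (Fin.succ_ne_zero _))
  obtain ⟨w, hw, hwx, hwy⟩ : ∃ w, g w w ≠ 0 ∧ HOrth g J w x ∧ HOrth g J w y :=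
    ⟨W 0, wn _, wx _, wy _⟩
  have yJ := diag_J (x := y) (y := w) (z := x) ⟨⟨hy, hw, hx⟩, ⟨hwy.symm, hyx⟩, hwx⟩
  have yM := mixed_J (x := y) (y := w) (z := x) ⟨⟨hy, hw, hx⟩, ⟨hwy.symm, hyx⟩, hwx⟩
  have xM := mixed_J (x := x) (y := w) (z := y) ⟨⟨hx, hw, hy⟩, ⟨hwx.symm, hyx.symm⟩, hwy⟩
  have yS := skew (x := y) (y := w) (z := x) ⟨⟨hy, hw, hx⟩, ⟨hwy.symm, hyx⟩, hwx⟩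
  have w1 : ∀ i, g y y * T (W i) x (W i) x = g (W i) (W i) * T y x y x := fun i =>
    ratio ⟨⟨wn i, hy, hx⟩, ⟨wy i, wx i⟩, hyx⟩
  have w2 : ∀ i, T (J (W i)) x (J (W i)) x = T (W i) x (W i) x := fun i =>
    diag_J ⟨⟨wn i, hy, hx⟩, ⟨wy i, wx i⟩, hyx⟩
  have w3 : ∀ i, g y y * T (W i) x (J (W i)) (J x) = g (W i) (W i) * T y x (J y) (J x) := fun i =>
    ratio_JJ ⟨⟨wn i, hy, hx⟩, ⟨wy i, wx i⟩, hyx⟩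
  have w4 : ∀ i, T (J (W i)) x (W i) (J x) = -T (W i) x (J (W i)) (J x) := fun i =>
    mixed_J ⟨⟨wn i, hy, hx⟩, ⟨wy i, wx i⟩, hyx⟩
  have h1 := hol (x := x) (y := y) ⟨⟨hx, hy⟩, hyx.symm⟩
  set K := T y x y x with hK
  set M := T y x (J y) (J x) with hM
  set H := T x (J x) x (J x) with hH
  have c1 : T y (J x) x (J y) = M := by
    rw [hT.swap₁₂, hT.swap₃₄, hT.swap₁₂, hT.swap₃₄]
    have : T x y (J x) (J y) = M := by rw [hT.swap₁₂, hT.swap₃₄]; simp [hM]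
    have e : T (J x) y x (J y) = -M := by rw [xM, this]
    rw [hT.swap₁₂ y (J x), e] ; simp
  have c2 : T x (J y) x (J y) = K := by
    rw [hT.swap₁₂, hT.swap₃₄, yJ]; simp
  have c3 : T x (J x) y (J y) = 2 * M := by
    have b := hT.bianchi x (J x) y (J y)
    have b1 := hT.swap₁₂ y (J x) x (J y)
    have b2 := hT.swap₃₄ y x (J x) (J y)
    linarith
  rw [c1, c2, c3] at h1
  have s0 : (g x x)⁻¹ * (T x x x x + T (J x) x x (J x)) = (g x x)⁻¹ * (-H) := by
    rw [hT.self₁₂, hT.swap₁₂ (J x)]; ring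
  have s1 : (g y y)⁻¹ * (T y x x y + T (J y) x x (J y)) = (g y y)⁻¹ * (-2 * K) := by
    rw [hT.swap₃₄ y, hT.swap₃₄ (J y), yJ]; ring
  have s2 : ∀ i, (g (W i) (W i))⁻¹ * (T (W i) x x (W i) + T (J (W i)) x x (J (W i))) =
      (g y y)⁻¹ * (-2 * K) := fun i => by
    rw [hT.swap₃₄ (W i), hT.swap₃₄ (J (W i)), w2]
    have := wn i
    field_simp
    linarith [w1 i]
  have r0 : (g x x)⁻¹ * (T x x (J x) (J x) - T (J x) x (J x) x) = (g x x)⁻¹ * (-H) := by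
    rw [hT.self₁₂, hT.swap₁₂ (J x), hT.swap₃₄ x (J x)]; ring
  have r1 : (g y y)⁻¹ * (T y x (J x) (J y) - T (J y) x (J x) y) = (g y y)⁻¹ * (-2 * M) := by
    rw [hT.swap₃₄ y, hT.swap₃₄ (J y), yM]; ring
  have r2 : ∀ i, (g (W i) (W i))⁻¹ * (T (W i) x (J x) (J (W i)) - T (J (W i)) x (J x) (W i)) =
      (g y y)⁻¹ * (-2 * M) := fun i => by
    rw [hT.swap₃₄ (W i), hT.swap₃₄ (J (W i)), w4]
    have := wn i
    field_simp
    linarith [w3 i]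
  rw [s0, s1, Finset.sum_congr rfl (fun i _ => s2 i), Finset.sum_const, Finset.card_univ,
    Fintype.card_fin, nsmul_eq_mul] at hr
  rw [r0, r1, Finset.sum_congr rfl (fun i _ => r2 i), Finset.sum_const, Finset.card_univ,
    Fintype.card_fin, nsmul_eq_mul] at hs
  push_cast at hr hs
  field_simp at hr hs
  have hm : (0 : ℝ) ≤ m := Nat.cast_nonneg m
  -- Here n = m + 3, so 2m + 4 is 2(n - 1), and 2m + 8 below is 2(n - 1) + 4.
  have hKM : K = M := by
    have : (g x x * (2 * m + 4)) * (K - M) = 0 := by linear_combination hs - hr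
    have := (mul_eq_zero.1 this).resolve_left (mul_ne_zero hx (by positivity))
    linarith
  have hK0 : K = 0 := by
    rw [← hKM] at h1
    have : (g x x * (2 * m + 8)) * K = 0 := by linear_combination -hr - h1
    exact (mul_eq_zero.1 this).resolve_left (mul_ne_zero hx (by positivity))
  have hH0 : H = 0 := by
    rw [← hKM, hK0] at h1
    simpa [hy] using h1
  refine ⟨?_, ?_, ?_⟩
  · rw [hT.swap₃₄, ← hH, hH0, neg_zero]
  · rw [hT.swap₁₂, ← hK, hK0, neg_zero]
  · rw [hT.swap₁₂, yS, neg_zero]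

/-- The symmetric form T(x,·,·,x) vanishes on all pairs from a unitary frame containing x: distinct
lines by `triple`, a line paired with that of x by `pair`, and a single line by `sectional_eq_zero`.
-/
theorem eq_zero_of_ne_zero [FiniteDimensional ℝ V] {n : ℕ} (h3 : 3 ≤ n)
    (hn : Module.finrank ℝ V = 2 * n) (hF : FrameTraceFree n g J T) {x : V} (hx : g x x ≠ 0)
    (v w : V) : T x v w x = 0 := by
  obtain ⟨hol, sec⟩ := hD.sectional_eq_zero hg hT h3 hn hF hx
  obtain ⟨m, rfl⟩ : ∃ m, n = m + 1 := ⟨n - 1, by omega⟩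
  have hE₀ : IsFrame g J ![x] :=
    ⟨fun a => by fin_cases a; simpa, fun a b hab => absurd (Subsingleton.elim a b) hab⟩
  obtain ⟨E, hE, hE'⟩ := hE₀.exists_extension hg (show 1 ≤ m + 1 by omega) (by omega)
  have e0 : E 0 = x := hE' 0
  have o : ∀ i : Fin m, HOrth g J (E i.succ) x := fun i => by
    rw [← e0]; exact hE.orth _ _ (Fin.succ_ne_zero _)
  have symm : ∀ v w, T x v w x = T x w v x := fun v w => by
    rw [hT.pair_swap, hT.swap₁₂, hT.swap₃₄]; simp
  have mix : ∀ v w, g v v ≠ 0 → g w w ≠ 0 → HOrth g J v x → HOrth g J w x → HOrth g J v w →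
      T x v w x = 0 := fun v w h1 h2 h3 h4 h5 => by
    rw [hT.swap₃₄, hD.triple x v w (by simp [OrthSystem, *, h3.symm, h4.symm]), neg_zero]
  have pair : ∀ u, g u u ≠ 0 → HOrth g J u x → T x (J x) u x = 0 := fun u h1 h2 => by
    rw [hT.swap₃₄, hD.pair x u (by simp [OrthSystem, *, h2.symm]), neg_zero]
  have nJ : ∀ i, g (J (E i)) (J (E i)) ≠ 0 := fun i => by rw [hg.map_J]; exact hE.ne_zero i
  have b1 : ∀ a b, T x (E a) (E b) x = 0 := fun a b => by
    refine Fin.cases ?_ (fun a => ?_) a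
    · rw [e0, hT.self₁₂]
    · refine Fin.cases ?_ (fun b => ?_) b
      · rw [e0, hT.self₃₄]
      · rcases eq_or_ne a b with rfl | hab
        · exact (sec _ (hE.ne_zero _) (o a)).1
        · exact mix _ _ (hE.ne_zero _) (hE.ne_zero _) (o a) (o b)
            (hE.orth _ _ ((Fin.succ_injective _).ne hab))
  have b2 : ∀ a b, T x (E a) (J (E b)) x = 0 := fun a b => by
    refine Fin.cases ?_ (fun a => ?_) a
    · rw [e0, hT.self₁₂]
    · refine Fin.cases ?_ (fun b => ?_) b
      · rw [e0, symm]
        exact pair _ (hE.ne_zero _) (o a)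
      · rcases eq_or_ne a b with rfl | hab
        · exact (sec _ (hE.ne_zero _) (o a)).2
        · exact mix _ _ (hE.ne_zero _) (nJ _) (o a) ((o b).J_left hg)
            ((hE.orth _ _ ((Fin.succ_injective _).ne hab)).J_right hg)
  have b3 : ∀ a b, T x (J (E a)) (J (E b)) x = 0 := fun a b => by
    refine Fin.cases ?_ (fun a => ?_) a
    · refine Fin.cases ?_ (fun b => ?_) b
      · rw [e0, hol]
      · rw [e0]
        exact pair _ (nJ _) ((o b).J_left hg)
    · refine Fin.cases ?_ (fun b => ?_) b
      · rw [e0, symm]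
        exact pair _ (nJ _) ((o a).J_left hg)
      · rcases eq_or_ne a b with rfl | hab
        · exact (sec _ (nJ _) ((o a).J_left hg)).1
        · exact mix _ _ (nJ _) (nJ _) ((o a).J_left hg) ((o b).J_left hg)
            (((hE.orth _ _ ((Fin.succ_injective _).ne hab)).J_right hg).J_left hg)
  let L : V →ₗ[ℝ] V →ₗ[ℝ] ℝ := LinearMap.mk₂ ℝ (fun v w => T x v w x)
    (fun a b c => hT.add₂ _ _ _ _ _) (fun a b c => hT.smul₂ _ _ _ _ _)
    (fun a b c => hT.add₃ _ _ _ _ _) (fun a b c => hT.smul₃ _ _ _ _ _)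
  have l1 : ∀ v b, L v (E b) = 0 ∧ L v (J (E b)) = 0 := fun v b => by
    constructor
    · rw [← L.flip_apply, hE.apply_eq hg hn (L.flip (E b)) v]
      simp [L, b1, symm _ (E b), b2]
    · rw [← L.flip_apply, hE.apply_eq hg hn (L.flip (J (E b))) v]
      simp [L, b2, b3]
  change L v w = 0
  rw [hE.apply_eq hg hn (L v) w]
  simp [l1]

/-- Polarization reduces to T(x,y,y,x). An isotropic x is moved along x + tp with p non-isotropic,
where the expression is affine in t because T(p,y,y,p) = 0. -/
theorem eq_zero [FiniteDimensional ℝ V] {n : ℕ} (h3 : 3 ≤ n)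
    (hn : Module.finrank ℝ V = 2 * n) (hF : FrameTraceFree n g J T) (x y z u : V) :
    T x y z u = 0 := by
  have key := @eq_zero_of_ne_zero V _ _ g J T hg hT hD _ n h3 hn hF
  refine hT.eq_zero_of_diag (fun x y => ?_) x y z u
  by_cases hx : g x x = 0
  · have hE₀ : IsFrame g J (![] : Fin 0 → V) := ⟨fun a => a.elim0, fun a => a.elim0⟩
    obtain ⟨p, hp, -⟩ := hE₀.exists_orth_of_lt hg (by omega)
    have hq : ∀ t : ℝ, t ≠ 0 → 2 * g x p + t * g p p ≠ 0 →
        T x y y x + t * (T p y y x + T x y y p) = 0 := fun t ht h => by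
      have e : g (x + t • p) (x + t • p) = t * (2 * g x p + t * g p p) := by
        simp [hx, hg.symm p x]; ring
      have := key (x := x + t • p) (by rw [e]; exact mul_ne_zero ht h) y y
      simp only [hT.add₁, hT.add₄, hT.smul₁, hT.smul₄, key hp] at this
      linarith
    -- x + tp is isotropic for at most one t ≠ 0, so two of the values 1, 2, 3 are admissible, and
    -- an affine function with two zeros vanishes at t = 0.
    by_cases c1 : 2 * g x p + 1 * g p p = 0
    · have q2 := hq 2 (by norm_num) (fun h => hp (by linarith))
      have q3 := hq 3 (by norm_num) (fun h => hp (by linarith))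
      linarith
    · have q1 := hq 1 (by norm_num) c1
      by_cases c2 : 2 * g x p + 2 * g p p = 0
      · have q3 := hq 3 (by norm_num) (fun h => hp (by linarith))
        linarith
      · have q2 := hq 2 (by norm_num) c2
        linarith
  · exact key hx y y

end VanishesOffPairs

end

end CurvatureAlgebra

end

noncomputable section

namespace CurvatureAlgebra

variable {V : Type*} [AddCommGroup V] [Module ℝ V]
  {g : V →ₗ[ℝ] V →ₗ[ℝ] ℝ} {J : V →ₗ[ℝ] V} {R T : V → V → V → V → ℝ} {S S' : V → V → ℝ}

/-! ### Traces of the tensors `φ(S)` and `ψ(S)` -/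

theorem isBilinearMap_add (h : IsBilinearMap ℝ S) (h' : IsBilinearMap ℝ S') :
    IsBilinearMap ℝ (S + S') where
  add_left x y z := by simp only [Pi.add_apply, h.add_left, h'.add_left]; ring
  smul_left c x y := by simp only [Pi.add_apply, h.smul_left, h'.smul_left, smul_add]
  add_right x y z := by simp only [Pi.add_apply, h.add_right, h'.add_right]; ring
  smul_right c x y := by simp only [Pi.add_apply, h.smul_right, h'.smul_right, smul_add]

theorem isBilinearMap_smul (h : IsBilinearMap ℝ S) (a : ℝ) : IsBilinearMap ℝ (a • S) where
  add_left x y z := by simp only [Pi.smul_apply, h.add_left, smul_add]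
  smul_left c x y := by simp only [Pi.smul_apply, h.smul_left, smul_comm a c]
  add_right x y z := by simp only [Pi.smul_apply, h.add_right, smul_add]
  smul_right c x y := by simp only [Pi.smul_apply, h.smul_right, smul_comm a c]

theorem isBilinearMap_apply (L : V →ₗ[ℝ] V →ₗ[ℝ] ℝ) : IsBilinearMap ℝ (fun x y => L x y) where
  add_left x y z := by simp
  smul_left c x y := by simp
  add_right x y z := by simp
  smul_right c x y := by simp

theorem IsCurvatureLike.isBilinearMap_ricci {m : ℕ} (hR : IsCurvatureLike R) (G : V → V → ℝ)
    (e : Fin m → V) : IsBilinearMap ℝ (ricci G e R) where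
  add_left x y z := by simp only [ricci, hR.add₂, mul_add, Finset.sum_add_distrib]
  smul_left c x y := by simp only [ricci, hR.smul₂, mul_left_comm, Finset.mul_sum, smul_eq_mul]
  add_right x y z := by simp only [ricci, hR.add₃, mul_add, Finset.sum_add_distrib]
  smul_right c x y := by simp only [ricci, hR.smul₃, mul_left_comm, Finset.mul_sum, smul_eq_mul]

theorem IsCurvatureLike.isBilinearMap_starRicci {m : ℕ} (hR : IsCurvatureLike R) (G : V → V → ℝ)
    (J : V →ₗ[ℝ] V) (e : Fin m → V) : IsBilinearMap ℝ (starRicci G J e R) where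
  add_left x y z := by simp only [starRicci, hR.add₂, mul_add, Finset.sum_add_distrib]
  smul_left c x y := by
    simp only [starRicci, hR.smul₂, mul_left_comm, Finset.mul_sum, smul_eq_mul]
  add_right x y z := by simp only [starRicci, map_add, hR.add₃, mul_add, Finset.sum_add_distrib]
  smul_right c x y := by
    simp only [starRicci, map_smul, hR.smul₃, mul_left_comm, Finset.mul_sum, smul_eq_mul]

theorem IsCurvatureLike.conj (hR : IsCurvatureLike R) (J : V →ₗ[ℝ] V) :
    IsCurvatureLike (conj J R) where
  add₁ x x' y z u := by simp only [CurvatureAlgebra.conj, map_add, hR.add₁]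
  smul₁ a x y z u := by simp only [CurvatureAlgebra.conj, map_smul, hR.smul₁]
  swap₁₂ x y z u := hR.swap₁₂ _ _ _ _
  swap₃₄ x y z u := hR.swap₃₄ _ _ _ _
  bianchi x y z u := hR.bianchi _ _ _ _

section linearity

variable {U : Type*} {m : ℕ} (G : U → U → ℝ) (K : U → U) (e : Fin m → U)
  (T T' : U → U → U → U → ℝ) (S S' : U → U → ℝ) (c : ℝ)

theorem ricci_add : ricci G e (T + T') = ricci G e T + ricci G e T' := by
  ext y z; simp only [ricci, Pi.add_apply, mul_add, Finset.sum_add_distrib]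

theorem ricci_smul : ricci G e (c • T) = c • ricci G e T := by
  ext y z; simp only [ricci, Pi.smul_apply, smul_eq_mul, mul_left_comm, Finset.mul_sum]

theorem ricci_sub : ricci G e (T - T') = ricci G e T - ricci G e T' := by
  ext y z; simp only [ricci, Pi.sub_apply, mul_sub, Finset.sum_sub_distrib]

theorem starRicci_add : starRicci G K e (T + T') = starRicci G K e T + starRicci G K e T' := by
  ext y z; simp only [starRicci, Pi.add_apply, mul_add, Finset.sum_add_distrib]

theorem starRicci_smul : starRicci G K e (c • T) = c • starRicci G K e T := by
  ext y z; simp only [starRicci, Pi.smul_apply, smul_eq_mul, mul_left_comm, Finset.mul_sum]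

theorem starRicci_sub : starRicci G K e (T - T') = starRicci G K e T - starRicci G K e T' := by
  ext y z; simp only [starRicci, Pi.sub_apply, mul_sub, Finset.sum_sub_distrib]

theorem metricTrace_add : metricTrace G e (S + S') = metricTrace G e S + metricTrace G e S' := by
  simp only [metricTrace, Pi.add_apply, mul_add, Finset.sum_add_distrib]

theorem metricTrace_smul : metricTrace G e (c • S) = c * metricTrace G e S := by
  simp only [metricTrace, Pi.smul_apply, smul_eq_mul, mul_left_comm, Finset.mul_sum]

end linearity

theorem pi1_eq : pi1 (fun x y => g x y) =
    (1 / 2 : ℝ) • phi (fun x y => g x y) (fun x y => g x y) := by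
  ext x y z u; simp [pi1, phi]; ring

theorem pi2_eq : pi2 (fun x y => g x y) J =
    (1 / 2 : ℝ) • psi (fun x y => g x y) J (fun x y => g x y) := by
  ext x y z u; simp [pi2, psi]; ring

section

variable {n : ℕ} {e : Module.Basis (Fin (2 * n)) ℝ V}

theorem sq_eq_one_of_isOrthonormal (he : IsOrthonormal (fun x y => g x y) e) (i : Fin (2 * n)) :
    g (e i) (e i) * g (e i) (e i) = 1 := by
  rcases he.2 i with h | h <;> simp only [h] <;> norm_num

theorem sum_mul_apply (he : IsOrthonormal (fun x y => g x y) e) (f : V →ₗ[ℝ] ℝ) (x : V) :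
    ∑ i, g (e i) (e i) * (g (e i) x * f (e i)) = f x := by
  have hexp : ∑ i, (g (e i) (e i) * g (e i) x) • e i = x := by
    conv_rhs => rw [← e.sum_repr x]
    refine Finset.sum_congr rfl fun i _ => ?_
    congr 1
    conv_lhs => rw [← e.sum_repr x]
    rw [map_sum, Finset.sum_eq_single i]
    · rw [map_smul, smul_eq_mul, mul_left_comm, sq_eq_one_of_isOrthonormal he, mul_one]
    · intro j _ hj
      rw [map_smul, show g (e i) (e j) = 0 from he.1 i j hj.symm, smul_zero]
    · simp
  conv_rhs => rw [← hexp]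
  simp [mul_assoc]

theorem sum_mul_left (he : IsOrthonormal (fun x y => g x y) e) (hS : IsBilinearMap ℝ S) (x y : V) :
    ∑ i, g (e i) (e i) * (g (e i) x * S (e i) y) = S x y :=
  sum_mul_apply he (hS.toLinearMap.flip y) x

theorem sum_mul_right (he : IsOrthonormal (fun x y => g x y) e) (hS : IsBilinearMap ℝ S)
    (x y : V) : ∑ i, g (e i) (e i) * (g (e i) x * S y (e i)) = S y x :=
  sum_mul_apply he (hS.toLinearMap y) x

theorem sum_sq (he : IsOrthonormal (fun x y => g x y) e) :
    ∑ i, g (e i) (e i) * g (e i) (e i) = 2 * n := by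
  rw [Finset.sum_congr rfl fun i _ => sq_eq_one_of_isOrthonormal he i]
  simp

variable (hg : IsHermitianForm g J) (he : IsOrthonormal (fun x y => g x y) e)

include hg he

/-- Two of the four terms are expansions in the orthonormal basis, each giving -S(y,z), and the sum
of g(eᵢ,eᵢ)² is 2n. No symmetry of S is assumed in these contractions, since ψ is also applied to a
skew tensor. -/
theorem ricci_phi (hS : IsBilinearMap ℝ S) (y z : V) :
    ricci (fun x y => g x y) e (phi (fun x y => g x y) S) y z =
      g y z * metricTrace (fun x y => g x y) e S + (2 * n - 2) * S y z := by
  have h1 := sum_mul_right he hS z y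
  have h2 := sum_mul_left he hS y z
  have : ricci (fun x y => g x y) e (phi (fun x y => g x y) S) y z =
      g y z * metricTrace (fun x y => g x y) e S
        - ∑ i, g (e i) (e i) * (g (e i) z * S y (e i))
        + S y z * ∑ i, g (e i) (e i) * g (e i) (e i)
        - ∑ i, g (e i) (e i) * (g (e i) y * S (e i) z) := by
    simp only [ricci, phi, metricTrace, Finset.mul_sum, ← Finset.sum_add_distrib,
      ← Finset.sum_sub_distrib]
    refine Finset.sum_congr rfl fun i _ => ?_
    rw [hg.symm y (e i)]; ring
  rw [this, h1, h2, sum_sq he]; ring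

theorem starRicci_phi (hS : IsBilinearMap ℝ S) (y z : V) :
    starRicci (fun x y => g x y) J e (phi (fun x y => g x y) S) y z =
      g y (J z) * metricTrace (fun x y => g x y) e (fun x y => S x (J y)) + S y z
        + S (J y) (J z) := by
  have hSJ : IsBilinearMap ℝ (fun x y => S x (J y)) :=
    isBilinearMap_apply (hS.toLinearMap.compl₂ J)
  have h1 := sum_mul_right he hSJ (J z) y
  have h2 := sum_mul_left he hS (J y) (J z)
  have : starRicci (fun x y => g x y) J e (phi (fun x y => g x y) S) y z =
      g y (J z) * metricTrace (fun x y => g x y) e (fun x y => S x (J y))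
        - ∑ i, g (e i) (e i) * (g (e i) (J z) * S y (J (e i)))
        + ∑ i, g (e i) (e i) * (g (e i) (J y) * S (e i) (J z)) := by
    simp only [starRicci, phi, metricTrace, Finset.mul_sum, ← Finset.sum_add_distrib,
      ← Finset.sum_sub_distrib]
    refine Finset.sum_congr rfl fun i _ => ?_
    rw [hg.self_J, hg.symm y (J (e i)), hg.J_left]; ring
  rw [this, h1, h2, hg.J_sq, ← neg_one_smul ℝ z, hS.smul_right]; simp

theorem ricci_psi (hS : IsBilinearMap ℝ S) (y z : V) :
    ricci (fun x y => g x y) e (psi (fun x y => g x y) J S) y z =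
      g y (J z) * metricTrace (fun x y => g x y) e (fun x y => S x (J y)) + S y z + 2 * S z y
        + S (J y) (J z) + 2 * S (J z) (J y) := by
  have hSJ : IsBilinearMap ℝ (fun x y => S x (J y)) :=
    isBilinearMap_apply (hS.toLinearMap.compl₂ J)
  have h1 := sum_mul_right he hSJ (J z) y
  have h2 := sum_mul_left he hS (J y) (J z)
  have h3 := sum_mul_right he hSJ (J y) z
  have h4 := sum_mul_left he hS (J z) (J y)
  have : ricci (fun x y => g x y) e (psi (fun x y => g x y) J S) y z =
      g y (J z) * metricTrace (fun x y => g x y) e (fun x y => S x (J y))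
        - ∑ i, g (e i) (e i) * (g (e i) (J z) * S y (J (e i)))
        - 2 * ∑ i, g (e i) (e i) * (g (e i) (J y) * S z (J (e i)))
        + ∑ i, g (e i) (e i) * (g (e i) (J y) * S (e i) (J z))
        + 2 * ∑ i, g (e i) (e i) * (g (e i) (J z) * S (e i) (J y)) := by
    simp only [ricci, psi, metricTrace, Finset.mul_sum, ← Finset.sum_add_distrib,
      ← Finset.sum_sub_distrib]
    refine Finset.sum_congr rfl fun i _ => ?_
    rw [hg.self_J, hg.symm y (J (e i)), hg.J_left, hg.symm z (J (e i)), hg.J_left]; ring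
  rw [this, h1, h2, h3, h4, hg.J_sq, hg.J_sq, ← neg_one_smul ℝ z, ← neg_one_smul ℝ y,
    hS.smul_right, hS.smul_right]
  simp only [smul_eq_mul]; ring

theorem starRicci_psi (hS : IsBilinearMap ℝ S) (y z : V) :
    starRicci (fun x y => g x y) J e (psi (fun x y => g x y) J S) y z =
      g y z * metricTrace (fun x y => g x y) e S + (2 * n - 2) * S y z + 4 * S (J z) (J y) := by
  have neg : ∀ a b, S a (-b) = -S a b := fun a b => by
    rw [← neg_one_smul ℝ b, hS.smul_right]; simp
  have h1 := sum_mul_right he hS z y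
  have h2 := sum_mul_left he hS y z
  have h3 := sum_mul_right he hS (J y) (J z)
  have h4 := sum_mul_left he hS (J z) (J y)
  have : starRicci (fun x y => g x y) J e (psi (fun x y => g x y) J S) y z =
      g y z * metricTrace (fun x y => g x y) e S
        - ∑ i, g (e i) (e i) * (g (e i) z * S y (e i))
        + 2 * ∑ i, g (e i) (e i) * (g (e i) (J y) * S (J z) (e i))
        + S y z * ∑ i, g (e i) (e i) * g (e i) (e i)
        - ∑ i, g (e i) (e i) * (g (e i) y * S (e i) z)
        + 2 * ∑ i, g (e i) (e i) * (g (e i) (J z) * S (e i) (J y)) := by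
    simp only [starRicci, psi, metricTrace, Finset.mul_sum, ← Finset.sum_add_distrib,
      ← Finset.sum_sub_distrib]
    refine Finset.sum_congr rfl fun i _ => ?_
    simp only [hg.J_sq, map_neg, neg]
    rw [hg.symm y (e i), hg.symm (J z) (e i)]; ring
  rw [this, h1, h2, h3, h4, sum_sq he]; ring

variable [FiniteDimensional ℝ V]

/-- In a unitary frame, J only exchanges the two summands belonging to each complex line. -/
theorem metricTrace_J (hn : Module.finrank ℝ V = 2 * n) (hS : IsBilinearMap ℝ S) :
    metricTrace (fun x y => g x y) e (fun x y => S (J x) (J y)) =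
      metricTrace (fun x y => g x y) e S := by
  have hE₀ : IsFrame g J (![] : Fin 0 → V) := ⟨fun a => a.elim0, fun a => a.elim0⟩
  obtain ⟨E, hE, -⟩ := hE₀.exists_extension hg (Nat.zero_le n) hn.ge
  have hSJ : IsBilinearMap ℝ (fun x y => S (J x) (J y)) :=
    isBilinearMap_apply (hS.toLinearMap.compl₁₂ J J)
  rw [metricTrace_eq_frame hE hg hn e he hS, metricTrace_eq_frame hE hg hn e he hSJ]
  refine Finset.sum_congr rfl fun a _ => ?_
  have : ∀ x, S (-x) (-x) = S x x := fun x => by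
    rw [← neg_one_smul ℝ x, hS.smul_right, hS.smul_left]; simp
  simp only [hg.J_sq, this]
  ring

/-- Applying J to both arguments turns S(x,Jy) into -S(y,Jx), so by `metricTrace_J` the trace equals
its negative. -/
theorem metricTrace_right_J_of_symm (hn : Module.finrank ℝ V = 2 * n) (hS : IsBilinearMap ℝ S)
    (hs : ∀ x y, S x y = S y x) :
    metricTrace (fun x y => g x y) e (fun x y => S x (J y)) = 0 := by
  have hSJ : IsBilinearMap ℝ (fun x y => S x (J y)) :=
    isBilinearMap_apply (hS.toLinearMap.compl₂ J)
  have h := metricTrace_J hg he hn hSJ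
  have : (fun x y => S (J x) (J (J y))) = fun x y => -S y (J x) := by
    ext x y
    rw [hg.J_sq, ← neg_one_smul ℝ y, hS.smul_right, hs]; simp
  rw [this] at h
  simp only [metricTrace, mul_neg, Finset.sum_neg_distrib] at h ⊢
  linarith

theorem ricci_conj (hn : Module.finrank ℝ V = 2 * n) (hR : IsCurvatureLike R) (y z : V) :
    ricci (fun x y => g x y) e (conj J R) y z = ricci (fun x y => g x y) e R (J y) (J z) := by
  refine metricTrace_J hg he hn (S := fun a b => R a (J y) (J z) b) ⟨?_, ?_, ?_, ?_⟩
  · exact fun _ _ _ => hR.add₁ _ _ _ _ _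
  · exact fun _ _ _ => hR.smul₁ _ _ _ _ _
  · exact fun _ _ _ => hR.add₄ _ _ _ _ _
  · exact fun _ _ _ => hR.smul₄ _ _ _ _ _

theorem starRicci_conj (hn : Module.finrank ℝ V = 2 * n) (hR : IsCurvatureLike R) (y z : V) :
    starRicci (fun x y => g x y) J e (conj J R) y z =
      starRicci (fun x y => g x y) J e R (J y) (J z) := by
  refine metricTrace_J hg he hn (S := fun a b => R a (J y) (J (J z)) (J b)) ⟨?_, ?_, ?_, ?_⟩
  · exact fun _ _ _ => hR.add₁ _ _ _ _ _
  · exact fun _ _ _ => hR.smul₁ _ _ _ _ _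
  · exact fun _ _ _ => by rw [map_add, hR.add₄]
  · exact fun _ _ _ => by rw [map_smul, hR.smul₄, smul_eq_mul]

omit hg he [FiniteDimensional ℝ V] in
theorem ricci_symm (hR : IsCurvatureLike R) (y z : V) :
    ricci (fun x y => g x y) e R y z = ricci (fun x y => g x y) e R z y := by
  simp only [ricci]
  refine Finset.sum_congr rfl fun i _ => ?_
  rw [hR.pair_swap, hR.swap₁₂, hR.swap₃₄]; simp

/-- J-invariance of the trace moves J onto the basis vectors; pair symmetry then exchanges the roles
of y and z. -/
theorem starRicci_J_J (hn : Module.finrank ℝ V = 2 * n) (hR : IsCurvatureLike R) (y z : V) :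
    starRicci (fun x y => g x y) J e R (J y) (J z) =
      starRicci (fun x y => g x y) J e R z y := by
  have := metricTrace_J hg he hn (S := fun a b => R a (J y) (J (J z)) (J b)) ⟨
    fun _ _ _ => hR.add₁ _ _ _ _ _, fun _ _ _ => hR.smul₁ _ _ _ _ _,
    fun _ _ _ => by rw [map_add, hR.add₄],
    fun _ _ _ => by rw [map_smul, hR.smul₄, smul_eq_mul]⟩
  refine this.symm.trans ?_
  simp only [metricTrace, starRicci]
  refine Finset.sum_congr rfl fun i _ => ?_
  rw [hg.J_sq, hg.J_sq, hR.neg₃, hR.neg₄, neg_neg, hR.pair_swap, hR.swap₁₂, hR.swap₃₄]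
  simp

end

end CurvatureAlgebra

end

noncomputable section

namespace CurvatureAlgebra

variable {V : Type*} [AddCommGroup V] [Module ℝ V]
  {g : V →ₗ[ℝ] V →ₗ[ℝ] ℝ} {J : V →ₗ[ℝ] V} {R T : V → V → V → V → ℝ} {S S' : V → V → ℝ}

/-! ### The Bochner tensor -/

theorem isCurvatureLike_phi (hg : IsHermitianForm g J) (hS : IsBilinearMap ℝ S)
    (hs : ∀ x y, S x y = S y x) : IsCurvatureLike (phi (fun x y => g x y) S) where
  add₁ x x' y z u := by simp only [phi, map_add, LinearMap.add_apply, hS.add_left]; ring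
  smul₁ a x y z u := by
    simp only [phi, map_smul, LinearMap.smul_apply, hS.smul_left, smul_eq_mul]; ring
  swap₁₂ x y z u := by simp only [phi]; ring
  swap₃₄ x y z u := by simp only [phi]; ring
  bianchi x y z u := by
    simp only [phi]
    rw [hs y x, hs z y, hs z x, hg.symm y x, hg.symm z y, hg.symm z x]; ring

/-- Skewness of S(x,Jy) is all that is used; it holds for symmetric J-invariant S and also for ρ*(R
- R̄), which is skew. -/
theorem isCurvatureLike_psi (hg : IsHermitianForm g J) (hS : IsBilinearMap ℝ S)
    (hs : ∀ x y, S x (J y) = -S y (J x)) :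
    IsCurvatureLike (psi (fun x y => g x y) J S) where
  add₁ x x' y z u := by simp only [psi, map_add, LinearMap.add_apply, hS.add_left]; ring
  smul₁ a x y z u := by
    simp only [psi, map_smul, LinearMap.smul_apply, hS.smul_left, smul_eq_mul]; ring
  swap₁₂ x y z u := by
    simp only [psi]
    rw [hs y x, hg.symm y (J x), hg.J_left]; ring
  swap₃₄ x y z u := by
    simp only [psi]
    rw [hs u z, hg.symm u (J z), hg.J_left]; ring
  bianchi x y z u := by
    simp only [psi]
    rw [hs y x, hs z y, hs z x, hg.symm y (J x), hg.J_left, hg.symm z (J y), hg.J_left,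
      hg.symm z (J x), hg.J_left]; ring

section

variable {n : ℕ} {e : Module.Basis (Fin (2 * n)) ℝ V}
  (hg : IsHermitianForm g J) (he : IsOrthonormal (fun x y => g x y) e)
  [FiniteDimensional ℝ V] (hn : Module.finrank ℝ V = 2 * n) (hR : IsCurvatureLike R)

include hg he hn hR

theorem ricci_add_conj (y z : V) :
    ricci (fun x y => g x y) e (R + conj J R) y z =
      ricci (fun x y => g x y) e R y z + ricci (fun x y => g x y) e R (J y) (J z) := by
  rw [ricci_add, ← ricci_conj hg he hn hR]; rfl

theorem ricci_sub_conj (y z : V) :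
    ricci (fun x y => g x y) e (R - conj J R) y z =
      ricci (fun x y => g x y) e R y z - ricci (fun x y => g x y) e R (J y) (J z) := by
  rw [ricci_sub, ← ricci_conj hg he hn hR]; rfl

theorem starRicci_add_conj (y z : V) :
    starRicci (fun x y => g x y) J e (R + conj J R) y z =
      starRicci (fun x y => g x y) J e R y z + starRicci (fun x y => g x y) J e R z y := by
  rw [starRicci_add, Pi.add_apply, Pi.add_apply, starRicci_conj hg he hn hR,
    starRicci_J_J hg he hn hR]

theorem starRicci_sub_conj (y z : V) :
    starRicci (fun x y => g x y) J e (R - conj J R) y z =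
      starRicci (fun x y => g x y) J e R y z - starRicci (fun x y => g x y) J e R z y := by
  rw [starRicci_sub, Pi.sub_apply, Pi.sub_apply, starRicci_conj hg he hn hR,
    starRicci_J_J hg he hn hR]

omit hg he [FiniteDimensional ℝ V] hn in
theorem ricci_J_J_J_J (hg : IsHermitianForm g J) (y z : V) :
    ricci (fun x y => g x y) e R (J (J y)) (J (J z)) = ricci (fun x y => g x y) e R y z := by
  have b := hR.isBilinearMap_ricci (fun x y => g x y) e
  rw [hg.J_sq, hg.J_sq, ← neg_one_smul ℝ y, ← neg_one_smul ℝ z, b.smul_left, b.smul_right]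
  simp

end

/-- The properties of the (0,2)-tensors that occur in the `J`-invariant part of the Bochner
tensor. -/
structure IsHermitianTensor (J : V →ₗ[ℝ] V) (S : V → V → ℝ) : Prop where
  bilin : IsBilinearMap ℝ S
  symm : ∀ x y, S x y = S y x
  map_J : ∀ x y, S (J x) (J y) = S x y

theorem IsHermitianTensor.right_J (hg : IsHermitianForm g J) (hS : IsHermitianTensor J S)
    (x y : V) : S x (J y) = -S y (J x) := by
  rw [← hS.map_J, hg.J_sq, ← neg_one_smul ℝ y, hS.bilin.smul_right, hS.symm]; simp

theorem IsHermitianForm.isHermitianTensor (hg : IsHermitianForm g J) :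
    IsHermitianTensor J (fun x y => g x y) :=
  ⟨isBilinearMap_apply g, hg.symm, hg.map_J⟩

section

variable {n : ℕ} {e : Module.Basis (Fin (2 * n)) ℝ V}
  (hg : IsHermitianForm g J) (he : IsOrthonormal (fun x y => g x y) e)
  [FiniteDimensional ℝ V] (hn : Module.finrank ℝ V = 2 * n) (hR : IsCurvatureLike R)

include hg he hn hR

theorem isHermitianTensor_ricci :
    IsHermitianTensor J (ricci (fun x y => g x y) e (R + conj J R)) where
  bilin := (hR.add (hR.conj J)).isBilinearMap_ricci _ _
  symm := ricci_symm (hR.add (hR.conj J))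
  map_J x y := by
    simp only [ricci_add_conj hg he hn hR]
    rw [ricci_J_J_J_J hR hg, add_comm]

theorem isHermitianTensor_starRicci :
    IsHermitianTensor J (starRicci (fun x y => g x y) J e (R + conj J R)) where
  bilin := (hR.add (hR.conj J)).isBilinearMap_starRicci _ _ _
  symm x y := by simp only [starRicci_add_conj hg he hn hR, add_comm]
  map_J x y := by simp only [starRicci_add_conj hg he hn hR, starRicci_J_J hg he hn hR, add_comm]

theorem starRicci_sub_conj_right_J (x y : V) :
    starRicci (fun x y => g x y) J e (R - conj J R) x (J y) =
      -starRicci (fun x y => g x y) J e (R - conj J R) y (J x) := by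
  have b := (hR.sub (hR.conj J)).isBilinearMap_starRicci (fun x y => g x y) J e
  have h1 := starRicci_sub_conj hg he hn hR
  have h2 := starRicci_J_J hg he hn hR
  have h3 : starRicci (fun x y => g x y) J e (R - conj J R) (J x) (J (J y)) =
      -starRicci (fun x y => g x y) J e (R - conj J R) x (J y) := by
    rw [h1, h1, h2, h2]; ring
  rw [← neg_eq_iff_eq_neg, ← h3, hg.J_sq, ← neg_one_smul ℝ y, b.smul_right, h1, h1]
  simp

/-- The Bochner tensor uses (a,b) = (1,3) and (1,-1). -/
theorem isHermitianTensor_combination (a b : ℝ) :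
    IsHermitianTensor J (a • ricci (fun x y => g x y) e (R + conj J R) +
      b • starRicci (fun x y => g x y) J e (R + conj J R)) where
  bilin := isBilinearMap_add
    (isBilinearMap_smul (isHermitianTensor_ricci hg he hn hR).bilin a)
    (isBilinearMap_smul (isHermitianTensor_starRicci hg he hn hR).bilin b)
  symm x y := by
    simp only [Pi.add_apply, Pi.smul_apply]
    rw [(isHermitianTensor_ricci hg he hn hR).symm, (isHermitianTensor_starRicci hg he hn hR).symm]
  map_J x y := by
    simp only [Pi.add_apply, Pi.smul_apply, (isHermitianTensor_ricci hg he hn hR).map_J,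
      (isHermitianTensor_starRicci hg he hn hR).map_J]

omit hg he [FiniteDimensional ℝ V] hn hR in
-- Brings every correction term to the form φ(S) or ψ(S), with `S₁`, `S₂` instances of one
-- combination, so that the trace formulas apply uniformly.
theorem bochner_eq : bochner n (fun x y => g x y) J e R =
    let G : V → V → ℝ := fun x y => g x y
    let S₁ := (1 : ℝ) • ricci G e (R + conj J R) + (3 : ℝ) • starRicci G J e (R + conj J R)
    let S₂ := (1 : ℝ) • ricci G e (R + conj J R) + (-1 : ℝ) • starRicci G J e (R + conj J R)
    R - (1 / (16 * ((n : ℝ) + 2))) • (phi G S₁ + psi G J S₁)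
    - (1 / (16 * ((n : ℝ) - 2))) • ((3 : ℝ) • phi G S₂ - psi G J S₂)
    - (1 / (4 * ((n : ℝ) + 1))) • psi G J (starRicci G J e (R - conj J R))
    - (1 / (4 * ((n : ℝ) - 1))) • phi G (ricci G e (R - conj J R))
    + ((scalar G e R + 3 * starScalar G J e R) / (16 * ((n : ℝ) + 1) * ((n : ℝ) + 2))) •
        ((1 / 2 : ℝ) • phi G G + (1 / 2 : ℝ) • psi G J G)
    + ((scalar G e R - starScalar G J e R) / (16 * ((n : ℝ) - 1) * ((n : ℝ) - 2))) •
        ((3 : ℝ) • ((1 / 2 : ℝ) • phi G G) - (1 / 2 : ℝ) • psi G J G) := by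
  simp only [bochner, pi1_eq, pi2_eq, one_smul, neg_one_smul, ← sub_eq_add_neg]

theorem isCurvatureLike_bochner : IsCurvatureLike (bochner n (fun x y => g x y) J e R) := by
  have hQ := hR.sub (hR.conj J)
  have f : ∀ {S}, IsHermitianTensor J S → IsCurvatureLike (phi (fun x y => g x y) S) :=
    fun h => isCurvatureLike_phi hg h.bilin h.symm
  have p : ∀ {S}, IsHermitianTensor J S → IsCurvatureLike (psi (fun x y => g x y) J S) :=
    fun h => isCurvatureLike_psi hg h.bilin (h.right_J hg)
  have c := isHermitianTensor_combination hg he hn hR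
  have hG := hg.isHermitianTensor
  rw [bochner_eq]
  exact (((((hR.sub (((f (c _ _)).add (p (c _ _))).smul _)).sub
    ((((f (c _ _)).smul _).sub (p (c _ _))).smul _)).sub
    ((isCurvatureLike_psi hg (hQ.isBilinearMap_starRicci _ _ _)
      (starRicci_sub_conj_right_J hg he hn hR)).smul _)).sub
    ((isCurvatureLike_phi hg (hQ.isBilinearMap_ricci _ _) (ricci_symm hQ)).smul _)).add
    ((((f hG).smul _).add ((p hG).smul _)).smul _)).add
    (((((f hG).smul _).smul _).sub ((p hG).smul _)).smul _)

omit he [FiniteDimensional ℝ V] hn hR in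
-- Each correction term contains a factor g(a,b) or g(a,Jb) with a, b among x, y, and all of these
-- are zero.
theorem VanishesOnIsotropic.bochner (hS : VanishesOnIsotropic g J R) :
    VanishesOnIsotropic g J (bochner n (fun x y => g x y) J e R) := by
  intro x y h1 h2 h3 h4 h5 h6
  have h7 : g y x = 0 := by rw [hg.symm, h4]
  have h8 : g y (J x) = 0 := by rw [hg.symm, hg.J_left, h6, neg_zero]
  have hR0 := hS x y h1 h2 h3 h4 h5 h6
  simp [CurvatureAlgebra.bochner, phi, psi, pi1, pi2, hR0, h3, h4, h5, h6, h7, h8, hg.self_J]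

omit hR in
theorem IsHermitianTensor.traces (hS : IsHermitianTensor J S) (y z : V) :
    ricci (fun x y => g x y) e (phi (fun x y => g x y) S) y z =
      g y z * metricTrace (fun x y => g x y) e S + (2 * n - 2) * S y z ∧
    ricci (fun x y => g x y) e (psi (fun x y => g x y) J S) y z = 6 * S y z ∧
    starRicci (fun x y => g x y) J e (phi (fun x y => g x y) S) y z = 2 * S y z ∧
    starRicci (fun x y => g x y) J e (psi (fun x y => g x y) J S) y z =
      g y z * metricTrace (fun x y => g x y) e S + (2 * n + 2) * S y z := by
  have h0 := metricTrace_right_J_of_symm hg he hn hS.bilin hS.symm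
  refine ⟨ricci_phi hg he hS.bilin y z, ?_, ?_, ?_⟩
  · rw [ricci_psi hg he hS.bilin, h0, hS.map_J, hS.map_J, hS.symm z y]; ring
  · rw [starRicci_phi hg he hS.bilin, h0, hS.map_J]; ring
  · rw [starRicci_psi hg he hS.bilin, hS.map_J, hS.symm z y]; ring

theorem metricTrace_ricci_add_conj :
    metricTrace (fun x y => g x y) e (ricci (fun x y => g x y) e (R + conj J R)) =
      2 * scalar (fun x y => g x y) e R := by
  have h := metricTrace_J hg he hn (hR.isBilinearMap_ricci (fun x y => g x y) e)
  have : ricci (fun x y => g x y) e (R + conj J R) = ricci (fun x y => g x y) e R +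
      fun y z => ricci (fun x y => g x y) e R (J y) (J z) := by
    ext y z; exact ricci_add_conj hg he hn hR y z
  rw [this, metricTrace_add, h, scalar]; ring

theorem metricTrace_starRicci_add_conj :
    metricTrace (fun x y => g x y) e (starRicci (fun x y => g x y) J e (R + conj J R)) =
      2 * starScalar (fun x y => g x y) J e R := by
  have : starRicci (fun x y => g x y) J e (R + conj J R) = starRicci (fun x y => g x y) J e R +
      fun y z => starRicci (fun x y => g x y) J e R z y := by
    ext y z; exact starRicci_add_conj hg he hn hR y z
  rw [this, metricTrace_add, starScalar]
  simp only [metricTrace]; ring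

/-- ρ(R - R̄) is symmetric and changes sign under J, hence is trace-free; only the multiple 2n - 2
survives. -/
theorem traces_phi_ricci_sub_conj (y z : V) :
    ricci (fun x y => g x y) e
        (phi (fun x y => g x y) (ricci (fun x y => g x y) e (R - conj J R))) y z =
      (2 * n - 2) * ricci (fun x y => g x y) e (R - conj J R) y z ∧
    starRicci (fun x y => g x y) J e
        (phi (fun x y => g x y) (ricci (fun x y => g x y) e (R - conj J R))) y z = 0 := by
  have hQ := hR.sub (hR.conj J)
  have b := hQ.isBilinearMap_ricci (fun x y => g x y) e
  have hJ : ∀ y z, ricci (fun x y => g x y) e (R - conj J R) (J y) (J z) =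
      -ricci (fun x y => g x y) e (R - conj J R) y z := fun y z => by
    simp only [ricci_sub_conj hg he hn hR]
    rw [ricci_J_J_J_J hR hg]; ring
  have h0 := metricTrace_right_J_of_symm hg he hn b (ricci_symm hQ)
  have h1 : metricTrace (fun x y => g x y) e (ricci (fun x y => g x y) e (R - conj J R)) = 0 := by
    have := metricTrace_J hg he hn b
    simp only [hJ, metricTrace, mul_neg, Finset.sum_neg_distrib] at this ⊢
    linarith
  constructor
  · rw [ricci_phi hg he b, h1]; ring
  · rw [starRicci_phi hg he b, h0, hJ]; ring

/-- ρ*(R - R̄) is skew and changes sign under J, so the four terms of the Ricci contraction cancel.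
-/
theorem traces_psi_starRicci_sub_conj (y z : V) :
    ricci (fun x y => g x y) e
        (psi (fun x y => g x y) J (starRicci (fun x y => g x y) J e (R - conj J R))) y z = 0 ∧
    starRicci (fun x y => g x y) J e
        (psi (fun x y => g x y) J (starRicci (fun x y => g x y) J e (R - conj J R))) y z =
      (2 * n + 2) * starRicci (fun x y => g x y) J e (R - conj J R) y z := by
  have hQ := hR.sub (hR.conj J)
  have b := hQ.isBilinearMap_starRicci (fun x y => g x y) J e
  have hs : ∀ y z, starRicci (fun x y => g x y) J e (R - conj J R) z y =
      -starRicci (fun x y => g x y) J e (R - conj J R) y z := fun y z => by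
    simp only [starRicci_sub_conj hg he hn hR]; ring
  have hJ : ∀ y z, starRicci (fun x y => g x y) J e (R - conj J R) (J y) (J z) =
      -starRicci (fun x y => g x y) J e (R - conj J R) y z := fun y z => by
    simp only [starRicci_sub_conj hg he hn hR, starRicci_J_J hg he hn hR]; ring
  have hr := starRicci_sub_conj_right_J hg he hn hR
  have h0 : metricTrace (fun x y => g x y) e
      (fun x y => starRicci (fun x y => g x y) J e (R - conj J R) x (J y)) = 0 :=
    Finset.sum_eq_zero fun i _ => by
      have := hr (e i) (e i)
      simp only
      rw [show starRicci (fun x y => g x y) J e (R - conj J R) (e i) (J (e i)) = 0 by linarith,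
        mul_zero]
  have h1 : metricTrace (fun x y => g x y) e
      (starRicci (fun x y => g x y) J e (R - conj J R)) = 0 :=
    Finset.sum_eq_zero fun i _ => by
      have := hs (e i) (e i)
      rw [show starRicci (fun x y => g x y) J e (R - conj J R) (e i) (e i) = 0 by linarith,
        mul_zero]
  constructor
  · rw [ricci_psi hg he b, h0, hJ, hJ, hs y z]; ring
  · rw [starRicci_psi hg he b, h1, hJ, hs y z]; ring

theorem combination_apply (y z : V) (a b : ℝ) :
    (a • ricci (fun x y => g x y) e (R + conj J R) +
      b • starRicci (fun x y => g x y) J e (R + conj J R)) y z =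
    a * (ricci (fun x y => g x y) e R y z + ricci (fun x y => g x y) e R (J y) (J z)) +
      b * (starRicci (fun x y => g x y) J e R y z + starRicci (fun x y => g x y) J e R z y) := by
  rw [← ricci_add_conj hg he hn hR, ← starRicci_add_conj hg he hn hR]; rfl

theorem metricTrace_combination (a b : ℝ) :
    metricTrace (fun x y => g x y) e (a • ricci (fun x y => g x y) e (R + conj J R) +
      b • starRicci (fun x y => g x y) J e (R + conj J R)) =
    2 * a * scalar (fun x y => g x y) e R + 2 * b * starScalar (fun x y => g x y) J e R := by
  rw [metricTrace_add, metricTrace_smul, metricTrace_smul, metricTrace_ricci_add_conj hg he hn hR,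
    metricTrace_starRicci_add_conj hg he hn hR]; ring

/-- The contraction of each correction term is known, and the coefficients of B are chosen so that
the sum cancels ρ(R). The bound n ≥ 3 makes all denominators nonzero. -/
theorem ricci_bochner (h3 : 3 ≤ n) (y z : V) :
    ricci (fun x y => g x y) e (bochner n (fun x y => g x y) J e R) y z = 0 := by
  have tG : metricTrace (fun x y => g x y) e (fun x y => g x y) = 2 * n := sum_sq he
  have hG := hg.isHermitianTensor.traces hg he hn y z
  have c₁ := (isHermitianTensor_combination hg he hn hR 1 3).traces hg he hn y z
  have c₂ := (isHermitianTensor_combination hg he hn hR 1 (-1)).traces hg he hn y z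
  have q₁ := traces_phi_ricci_sub_conj hg he hn hR y z
  have q₂ := traces_psi_starRicci_sub_conj hg he hn hR y z
  have v := combination_apply hg he hn hR y z
  have t := metricTrace_combination hg he hn hR
  have v₁ := v 1 3
  have v₂ := v 1 (-1)
  have t₁ := t 1 3
  have t₂ := t 1 (-1)
  have w₁ := ricci_sub_conj hg he hn hR y z
  have w₂ := starRicci_sub_conj hg he hn hR y z
  clear v t
  rw [bochner_eq]
  dsimp only
  -- With these tensors abstracted, only their recorded values and traces remain, and the claim is a
  -- rational identity in n and finitely many numbers.
  generalize (1 : ℝ) • ricci (fun x y => g x y) e (R + conj J R) +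
    (3 : ℝ) • starRicci (fun x y => g x y) J e (R + conj J R) = S₁ at *
  generalize (1 : ℝ) • ricci (fun x y => g x y) e (R + conj J R) +
    (-1 : ℝ) • starRicci (fun x y => g x y) J e (R + conj J R) = S₂ at *
  generalize ricci (fun x y => g x y) e (R - conj J R) = Q₁ at *
  generalize starRicci (fun x y => g x y) J e (R - conj J R) = Q₂ at *
  simp only [ricci_add, ricci_sub, ricci_smul, Pi.add_apply, Pi.sub_apply,
    Pi.smul_apply, smul_eq_mul, c₁.1, c₁.2.1, c₂.1, c₂.2.1, hG.1, hG.2.1, tG, q₁.1, q₂.1, t₁, t₂,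
    v₁, v₂, w₁]
  have hN : (3 : ℝ) ≤ n := by exact_mod_cast h3
  have n1 : (n : ℝ) - 1 ≠ 0 := by linarith
  have n2 : (n : ℝ) - 2 ≠ 0 := by linarith
  have n3 : (n : ℝ) + 1 ≠ 0 := by linarith
  have n4 : (n : ℝ) + 2 ≠ 0 := by linarith
  field_simp
  ring

theorem starRicci_bochner (h3 : 3 ≤ n) (y z : V) :
    starRicci (fun x y => g x y) J e (bochner n (fun x y => g x y) J e R) y z = 0 := by
  have tG : metricTrace (fun x y => g x y) e (fun x y => g x y) = 2 * n := sum_sq he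
  have hG := hg.isHermitianTensor.traces hg he hn y z
  have c₁ := (isHermitianTensor_combination hg he hn hR 1 3).traces hg he hn y z
  have c₂ := (isHermitianTensor_combination hg he hn hR 1 (-1)).traces hg he hn y z
  have q₁ := traces_phi_ricci_sub_conj hg he hn hR y z
  have q₂ := traces_psi_starRicci_sub_conj hg he hn hR y z
  have v := combination_apply hg he hn hR y z
  have t := metricTrace_combination hg he hn hR
  have v₁ := v 1 3
  have v₂ := v 1 (-1)
  have t₁ := t 1 3
  have t₂ := t 1 (-1)
  have w₁ := ricci_sub_conj hg he hn hR y z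
  have w₂ := starRicci_sub_conj hg he hn hR y z
  clear v t
  rw [bochner_eq]
  dsimp only
  generalize (1 : ℝ) • ricci (fun x y => g x y) e (R + conj J R) +
    (3 : ℝ) • starRicci (fun x y => g x y) J e (R + conj J R) = S₁ at *
  generalize (1 : ℝ) • ricci (fun x y => g x y) e (R + conj J R) +
    (-1 : ℝ) • starRicci (fun x y => g x y) J e (R + conj J R) = S₂ at *
  generalize ricci (fun x y => g x y) e (R - conj J R) = Q₁ at *
  generalize starRicci (fun x y => g x y) J e (R - conj J R) = Q₂ at *
  simp only [starRicci_add, starRicci_sub, starRicci_smul, Pi.add_apply, Pi.sub_apply,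
    Pi.smul_apply, smul_eq_mul, c₁.2.2.1, c₁.2.2.2, c₂.2.2.1, c₂.2.2.2, hG.2.2.1, hG.2.2.2, tG, q₁.2, q₂.2, t₁, t₂,
    v₁, v₂, w₂]
  have hN : (3 : ℝ) ≤ n := by exact_mod_cast h3
  have n1 : (n : ℝ) - 1 ≠ 0 := by linarith
  have n2 : (n : ℝ) - 2 ≠ 0 := by linarith
  have n3 : (n : ℝ) + 1 ≠ 0 := by linarith
  have n4 : (n : ℝ) + 2 ≠ 0 := by linarith
  field_simp
  ring

end

/-- The Bochner tensor of a curvature-like tensor vanishing on strongly isotropic antiholomorphic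
planes is zero. -/
theorem bochner_eq_zero {n : ℕ} {e : Module.Basis (Fin (2 * n)) ℝ V}
    (hg : IsHermitianForm g J) (he : IsOrthonormal (fun x y => g x y) e)
    (hR : IsCurvatureLike R) (hS : VanishesOnIsotropic g J R) (h4 : 4 ≤ n) {ν ν' : Fin 3 → V}
    (hν : ∀ i j, g (ν i) (ν j) = if i = j then 1 else 0)
    (hν' : ∀ i j, g (ν' i) (ν' j) = if i = j then -1 else 0) (x y z u : V) :
    bochner n (fun x y => g x y) J e R x y z u = 0 := by
  have : FiniteDimensional ℝ V := e.finiteDimensional_of_finite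
  have hn : Module.finrank ℝ V = 2 * n := by simp [Module.finrank_eq_card_basis e]
  have hB := isCurvatureLike_bochner hg he hn hR
  have hC := (hS.bochner (n := n) (e := e) hg).vanishesOnOrth hg hB h4 hn hν hν'
  have hF : FrameTraceFree n g J (bochner n (fun x y => g x y) J e R) := by
    intro E hE z u
    have r := ricci_bochner hg he hn hR (by omega) z u
    -- ρ* applies J to its third argument, so -Ju is inserted to obtain u there.
    have s := starRicci_bochner hg he hn hR (by omega) z (-J u)
    constructor
    · rw [← r]
      refine (metricTrace_eq_frame hE hg hn e he (S := fun a b =>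
        bochner n (fun x y => g x y) J e R a z u b) ⟨?_, ?_, ?_, ?_⟩).symm
      · exact fun _ _ _ => hB.add₁ _ _ _ _ _
      · exact fun _ _ _ => hB.smul₁ _ _ _ _ _
      · exact fun _ _ _ => hB.add₄ _ _ _ _ _
      · exact fun _ _ _ => hB.smul₄ _ _ _ _ _
    · have hu : J (-J u) = u := by rw [map_neg, hg.J_sq, neg_neg]
      have key := metricTrace_eq_frame hE hg hn e he (S := fun a b =>
        bochner n (fun x y => g x y) J e R a z (J (-J u)) (J b)) ⟨
          fun _ _ _ => hB.add₁ _ _ _ _ _, fun _ _ _ => hB.smul₁ _ _ _ _ _,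
          fun _ _ _ => by rw [map_add, hB.add₄],
          fun _ _ _ => by rw [map_smul, hB.smul₄, smul_eq_mul]⟩
      rw [show metricTrace (fun x y => g x y) e (fun a b =>
        bochner n (fun x y => g x y) J e R a z (J (-J u)) (J b)) = 0 from s] at key
      rw [key]
      refine Finset.sum_congr rfl fun a _ => ?_
      rw [hu, hg.J_sq, hB.neg₄, sub_eq_add_neg]
  have hD : VanishesOffPairs g J (bochner n (fun x y => g x y) J e R) :=
    ⟨fun x z u h => (hF.eq_zero_of_triple hg hB hC h4 hn h).1,
      fun x z u h => (hF.eq_zero_of_triple hg hB hC h4 hn h).2,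
      fun x u h => hF.eq_zero_of_pair hg hB hC h4 hn h⟩
  exact hD.eq_zero hg hB (by omega) hn hF x y z u

end CurvatureAlgebra

end

noncomputable section

/-! ### Levi-Civita connections in coordinates -/

section LocalGeometry

open Filter Topology

/-- The product rule for a variable bilinear map applied to variable vectors. -/
theorem exists_hasFDerivAt_bilin {X P Q Z : Type*} [NormedAddCommGroup X] [NormedSpace ℝ X]
    [NormedAddCommGroup P] [NormedSpace ℝ P] [NormedAddCommGroup Q] [NormedSpace ℝ Q]
    [NormedAddCommGroup Z] [NormedSpace ℝ Z] {A : X → P →L[ℝ] Q →L[ℝ] Z} {p : X → P} {q : X → Q}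
    {A' : X →L[ℝ] P →L[ℝ] Q →L[ℝ] Z} {p' : X →L[ℝ] P} {q' : X →L[ℝ] Q} {x : X}
    (hA : HasFDerivAt A A' x) (hp : HasFDerivAt p p' x) (hq : HasFDerivAt q q' x) :
    ∃ L : X →L[ℝ] Z, HasFDerivAt (fun y => A y (p y) (q y)) L x ∧
      ∀ e, L e = A' e (p x) (q x) + A x (p' e) (q x) + A x (p x) (q' e) := by
  refine ⟨_, (hA.clm_apply hp).clm_apply hq, fun e => ?_⟩
  simp
  abel

theorem DifferentiableAt.exists_hasFDerivAt_comp {Y X W : Type*} [NormedAddCommGroup Y]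
    [NormedSpace ℝ Y] [NormedAddCommGroup X] [NormedSpace ℝ X] [NormedAddCommGroup W]
    [NormedSpace ℝ W] {A : X → W} {f : Y → X} {y : Y} {f' : Y →L[ℝ] X}
    (hA : DifferentiableAt ℝ A (f y)) (hf : HasFDerivAt f f' y) :
    ∃ L : Y →L[ℝ] W, HasFDerivAt (fun z => A (f z)) L y ∧ ∀ e, L e = fderiv ℝ A (f y) (f' e) :=
  ⟨_, hA.hasFDerivAt.comp y hf, fun _ => rfl⟩

theorem exists_hasFDerivAt_comp_bilin {Y X P Q Z : Type*} [NormedAddCommGroup Y] [NormedSpace ℝ Y]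
    [NormedAddCommGroup X] [NormedSpace ℝ X]
    [NormedAddCommGroup P] [NormedSpace ℝ P] [NormedAddCommGroup Q] [NormedSpace ℝ Q]
    [NormedAddCommGroup Z] [NormedSpace ℝ Z] {A : X → P →L[ℝ] Q →L[ℝ] Z} {f : Y → X}
    {y : Y} {f' : Y →L[ℝ] X} (hA : DifferentiableAt ℝ A (f y)) (hf : HasFDerivAt f f' y) :
    ∃ L : Y →L[ℝ] P →L[ℝ] Q →L[ℝ] Z, HasFDerivAt (fun z => A (f z)) L y ∧
      ∀ e, L e = fderiv ℝ A (f y) (f' e) :=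
  DifferentiableAt.exists_hasFDerivAt_comp (W := P →L[ℝ] Q →L[ℝ] Z) hA hf

/-- The product rule for a bilinear map depending on `f y`, applied to variable vectors. -/
theorem exists_hasFDerivAt_bilin_comp {Y X P Q Z : Type*} [NormedAddCommGroup Y] [NormedSpace ℝ Y]
    [NormedAddCommGroup X] [NormedSpace ℝ X]
    [NormedAddCommGroup P] [NormedSpace ℝ P] [NormedAddCommGroup Q] [NormedSpace ℝ Q]
    [NormedAddCommGroup Z] [NormedSpace ℝ Z] {A : X → P →L[ℝ] Q →L[ℝ] Z} {f : Y → X}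
    {p : Y → P} {q : Y → Q} {y : Y} {f' : Y →L[ℝ] X} {p' : Y →L[ℝ] P} {q' : Y →L[ℝ] Q}
    (hA : DifferentiableAt ℝ A (f y)) (hf : HasFDerivAt f f' y)
    (hp : HasFDerivAt p p' y) (hq : HasFDerivAt q q' y) :
    ∃ L : Y →L[ℝ] Z, HasFDerivAt (fun z => A (f z) (p z) (q z)) L y ∧
      ∀ e, L e = fderiv ℝ A (f y) (f' e) (p y) (q y) + A (f y) (p' e) (q y) +
        A (f y) (p y) (q' e) := by
  obtain ⟨L, hL, h⟩ := exists_hasFDerivAt_comp_bilin hA hf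
  obtain ⟨L', hL', h'⟩ := exists_hasFDerivAt_bilin hL hp hq
  exact ⟨L', hL', fun e => by rw [h', h]⟩

theorem exists_hasFDerivAt_bilin_const {X P Q Z : Type*} [NormedAddCommGroup X] [NormedSpace ℝ X]
    [NormedAddCommGroup P] [NormedSpace ℝ P] [NormedAddCommGroup Q] [NormedSpace ℝ Q]
    [NormedAddCommGroup Z] [NormedSpace ℝ Z] {A : X → P →L[ℝ] Q →L[ℝ] Z}
    {x : X} (hA : DifferentiableAt ℝ A x) (p : P) (q : Q) :
    ∃ L : X →L[ℝ] Z, HasFDerivAt (fun y => A y p q) L x ∧ ∀ e, L e = fderiv ℝ A x e p q := by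
  obtain ⟨L, hL, h⟩ := exists_hasFDerivAt_bilin hA.hasFDerivAt (hasFDerivAt_const p x) (hasFDerivAt_const q x)
  exact ⟨L, hL, fun e => by simp [h]⟩

theorem fderiv_bilin_const {X P Q Z : Type*} [NormedAddCommGroup X] [NormedSpace ℝ X]
    [NormedAddCommGroup P] [NormedSpace ℝ P] [NormedAddCommGroup Q] [NormedSpace ℝ Q]
    [NormedAddCommGroup Z] [NormedSpace ℝ Z] {A : X → P →L[ℝ] Q →L[ℝ] Z} {x : X}
    (hA : DifferentiableAt ℝ A x) (p : P) (q : Q) (e : X) :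
    fderiv ℝ (fun y => A y p q) x e = fderiv ℝ A x e p q := by
  obtain ⟨L, hL, h⟩ := exists_hasFDerivAt_bilin_const hA p q
  rw [hL.fderiv, h]

variable {E : Type*} [NormedAddCommGroup E] [NormedSpace ℝ E]
  {G : E → E →L[ℝ] E →L[ℝ] ℝ} {Γ : E → E →L[ℝ] E →L[ℝ] E} {x : E}

/-- The curvature operator of the connection with Christoffel symbols `Γ`. -/
def connCurvature (Γ : E → E →L[ℝ] E →L[ℝ] E) (x u v w : E) : E :=
  fderiv ℝ Γ x u v w - fderiv ℝ Γ x v u w + Γ x u (Γ x v w) - Γ x v (Γ x u w)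

theorem connCurvature_swap (u v w : E) : connCurvature Γ x u v w = -connCurvature Γ x v u w := by
  simp only [connCurvature]; abel

/-- Symmetry of Γ near x passes to its derivative, after which the terms cancel in pairs. -/
theorem connCurvature_bianchi (hΓ : DifferentiableAt ℝ Γ x)
    (hs : ∀ᶠ y in 𝓝 x, ∀ u v, Γ y u v = Γ y v u) (u v w : E) :
    connCurvature Γ x u v w + connCurvature Γ x v w u + connCurvature Γ x w u v = 0 := by
  have hx := hs.self_of_nhds
  have hd : ∀ a b c, fderiv ℝ Γ x a b c = fderiv ℝ Γ x a c b := fun a b c => by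
    rw [← fderiv_bilin_const hΓ, ← fderiv_bilin_const hΓ,
      Filter.EventuallyEq.fderiv_eq (hs.mono fun y hy => hy b c)]
  simp only [connCurvature]
  rw [hd u v w, hd v w u, hd w u v, hx v w, hx w u, hx v u]
  abel

/-- The second derivative of y ↦ G(w,z) is symmetric. Computed twice from metric compatibility, its
commutator is G(R(u,v)w,z) + G(w,R(u,v)z). -/
theorem metric_connCurvature_skew (hG : ContDiffAt ℝ 2 G x) (hΓ : DifferentiableAt ℝ Γ x)
    (hs : ∀ᶠ y in 𝓝 x, ∀ u v, G y u v = G y v u)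
    (hc : ∀ᶠ y in 𝓝 x, ∀ u v w, fderiv ℝ G y u v w = G y (Γ y u v) w + G y v (Γ y u w))
    (u v w z : E) :
    G x (connCurvature Γ x u v w) z = -G x (connCurvature Γ x u v z) w := by
  have hG1 : DifferentiableAt ℝ G x := hG.differentiableAt (by norm_num)
  have gs := hs.self_of_nhds
  have c0 := hc.self_of_nhds
  set f : E → ℝ := fun y => G y w z with hf
  have hf2 : ContDiffAt ℝ 2 f x :=
    (hG.clm_apply contDiffAt_const).clm_apply contDiffAt_const
  have hf1 : HasFDerivAt (fderiv ℝ f) (fderiv ℝ (fderiv ℝ f) x) x :=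
    ((hf2.fderiv_right (m := 1) (by norm_num)).differentiableAt (by norm_num)).hasFDerivAt
  have hev : ∀ᶠ y in 𝓝 x, ∀ a, fderiv ℝ f y a = G y (Γ y a w) z + G y w (Γ y a z) := by
    filter_upwards [hc, hG.eventually (by simp)] with y hy hy' a
    rw [← hy a w z, fderiv_bilin_const (hy'.differentiableAt (by norm_num))]
  have key : ∀ a b, fderiv ℝ (fderiv ℝ f) x a b =
      fderiv ℝ G x a (Γ x b w) z + G x (fderiv ℝ Γ x a b w) z +
        (fderiv ℝ G x a w (Γ x b z) + G x w (fderiv ℝ Γ x a b z)) := by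
    intro a b
    have h1 : HasFDerivAt (fun y => fderiv ℝ f y b) _ x := hf1.clm_apply (hasFDerivAt_const b x)
    obtain ⟨L₁, hL₁, e₁⟩ := exists_hasFDerivAt_bilin_const hΓ b w
    obtain ⟨L₂, hL₂, e₂⟩ := exists_hasFDerivAt_bilin_const hΓ b z
    obtain ⟨L₃, hL₃, e₃⟩ := exists_hasFDerivAt_bilin_comp hG1 (hasFDerivAt_id x) hL₁ (hasFDerivAt_const z x)
    obtain ⟨L₄, hL₄, e₄⟩ := exists_hasFDerivAt_bilin_comp hG1 (hasFDerivAt_id x) (hasFDerivAt_const w x) hL₂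
    have h3 := h1.unique ((hL₃.add hL₄).congr_of_eventuallyEq (hev.mono fun y hy => hy b))
    have h4 := congrArg (fun L => L a) h3
    simpa [e₁, e₂, e₃, e₄] using h4
  have k1 := key u v
  have k2 := key v u
  rw [(hf2.isSymmSndFDerivAt (by simp)).eq u v, k2, c0, c0, c0, c0] at k1
  simp only [connCurvature, map_add, map_sub, add_apply, sub_apply]
  rw [gs (fderiv ℝ Γ x u v z) w, gs (fderiv ℝ Γ x v u z) w, gs (Γ x u (Γ x v z)) w,
    gs (Γ x v (Γ x u z)) w]
  linarith

/-- The Gauss equation of a totally geodesic, totally isotropic submanifold. -/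
theorem metric_connCurvature_eq_zero_of_totallyGeodesic {H : Type*} [NormedAddCommGroup H]
    [NormedSpace ℝ H] {F : H → E} {y₀ : H} (hF : ContDiffAt ℝ 3 F y₀)
    (hG : DifferentiableAt ℝ G (F y₀)) (hΓ : DifferentiableAt ℝ Γ (F y₀))
    (hc : ∀ u v w, fderiv ℝ G (F y₀) u v w =
      G (F y₀) (Γ (F y₀) u v) w + G (F y₀) v (Γ (F y₀) u w))
    (hiso : ∀ᶠ y in 𝓝 y₀, ∀ a b, G (F y) (fderiv ℝ F y a) (fderiv ℝ F y b) = 0)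
    (hgeo : ∀ᶠ y in 𝓝 y₀, ∀ a b, ∃ c, fderiv ℝ (fderiv ℝ F) y a b +
      Γ (F y) (fderiv ℝ F y a) (fderiv ℝ F y b) = fderiv ℝ F y c) (a b c d : H) :
    G (F y₀) (connCurvature Γ (F y₀) (fderiv ℝ F y₀ a) (fderiv ℝ F y₀ b) (fderiv ℝ F y₀ c))
      (fderiv ℝ F y₀ d) = 0 := by
  have hF1 : HasFDerivAt F (fderiv ℝ F y₀) y₀ := (hF.differentiableAt (by norm_num)).hasFDerivAt
  set p : H → H → E := fun a y => fderiv ℝ F y a with hp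
  have hp2 : ∀ a, ContDiffAt ℝ 2 (p a) y₀ := fun a =>
    (hF.fderiv_right (by norm_num)).clm_apply contDiffAt_const
  have hp1 : ∀ a, HasFDerivAt (p a) (fderiv ℝ (p a) y₀) y₀ := fun a =>
    ((hp2 a).differentiableAt (by norm_num)).hasFDerivAt
  have hpp : ∀ a, HasFDerivAt (fderiv ℝ (p a)) (fderiv ℝ (fderiv ℝ (p a)) y₀) y₀ := fun a =>
    (((hp2 a).fderiv_right (m := 1) (by norm_num)).differentiableAt (by norm_num)).hasFDerivAt
  have hpF : ∀ᶠ y in 𝓝 y₀, ∀ a b, fderiv ℝ (fderiv ℝ F) y a b = fderiv ℝ (p b) y a := by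
    filter_upwards [hF.eventually (by simp)] with y hy a b
    have h1 : HasFDerivAt (fderiv ℝ F) (fderiv ℝ (fderiv ℝ F) y) y :=
      ((hy.fderiv_right (m := 1) (by norm_num)).differentiableAt (by norm_num)).hasFDerivAt
    rw [(h1.clm_apply (hasFDerivAt_const b y)).fderiv]
    simp
  have sym2 : ∀ a b, fderiv ℝ (p b) y₀ a = fderiv ℝ (p a) y₀ b := fun a b => by
    rw [← hpF.self_of_nhds, ← hpF.self_of_nhds]
    exact (hF.isSymmSndFDerivAt (by simp; norm_num)).eq a b
  have sym3 : ∀ a b c, fderiv ℝ (fderiv ℝ (p c)) y₀ a b = fderiv ℝ (fderiv ℝ (p c)) y₀ b a :=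
    fun a b c => ((hp2 c).isSymmSndFDerivAt (by simp)).eq a b
  have hgeo' : ∀ᶠ y in 𝓝 y₀, ∀ a b, ∃ c, fderiv ℝ (p b) y a + Γ (F y) (p a y) (p b y) = p c y := by
    filter_upwards [hgeo, hpF] with y h1 h2 a b
    rw [← h2]; exact h1 a b
  -- The long argument is ∇ₑ∇ₐ of the coordinate field `p b` along F. Since ∇ₐ(p b) is tangent, its
  -- product with `p d` is identically zero; differentiating along e leaves also G(∇ₐ(p b), ∇ₑ(p
  -- d)), a product of tangent vectors and hence zero.
  have key : ∀ e a b, G (F y₀) (fderiv ℝ (fderiv ℝ (p b)) y₀ e a +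
      fderiv ℝ Γ (F y₀) (p e y₀) (p a y₀) (p b y₀) + Γ (F y₀) (fderiv ℝ (p a) y₀ e) (p b y₀) +
      Γ (F y₀) (p a y₀) (fderiv ℝ (p b) y₀ e) +
      Γ (F y₀) (p e y₀) (fderiv ℝ (p b) y₀ a + Γ (F y₀) (p a y₀) (p b y₀))) (p d y₀) = 0 := by
    intro e a b
    obtain ⟨L₁, hL₁, e₁⟩ := exists_hasFDerivAt_bilin_comp hΓ hF1 (hp1 a) (hp1 b)
    have hw : HasFDerivAt (fun y => fderiv ℝ (p b) y a + Γ (F y) (p a y) (p b y)) _ y₀ :=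
      ((hpp b).clm_apply (hasFDerivAt_const a y₀)).add hL₁
    obtain ⟨L₂, hL₂, e₂⟩ := exists_hasFDerivAt_bilin_comp hG hF1 hw (hp1 d)
    have h2 := hL₂.unique ((hasFDerivAt_const (0 : ℝ) y₀).congr_of_eventuallyEq (by
      filter_upwards [hiso, hgeo'] with y h h'
      obtain ⟨c, hc⟩ := h' a b
      rw [hc]
      exact h c d))
    have h3 : L₂ e = 0 := by rw [h2]; rfl
    obtain ⟨c₁, hc₁⟩ := hgeo'.self_of_nhds a b
    obtain ⟨c₂, hc₂⟩ := hgeo'.self_of_nhds e d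
    have h4 : G (F y₀) (p c₁ y₀) (p c₂ y₀) = 0 := hiso.self_of_nhds c₁ c₂
    rw [← hc₁, ← hc₂] at h4
    rw [e₂] at h3
    simp only [add_apply, e₁, ContinuousLinearMap.flip_apply, zero_add, hc,
      ContinuousLinearMap.comp_zero] at h3
    simp only [map_add, add_apply] at h3 h4 ⊢
    have : fderiv ℝ F y₀ e = p e y₀ := rfl
    rw [this] at h3
    linarith
  -- The difference of the two orders is the curvature, since the second derivatives of F and of `p
  -- c` are symmetric and coordinate fields commute.
  have k1 := key a b c
  have k2 := key b a c
  rw [sym3 a b, sym2 a b] at k1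
  change G (F y₀) (connCurvature Γ (F y₀) (p a y₀) (p b y₀) (p c y₀)) (p d y₀) = 0
  simp only [connCurvature, map_add, map_sub, add_apply, sub_apply] at k1 k2 ⊢
  linarith

end LocalGeometry

end

/-! ### Smoothness of the metric in a chart -/

noncomputable section

namespace AlmostHermitianStructure

open Filter Topology

section Chart

variable {n s : ℕ} {E : Type v} [NormedAddCommGroup E] [NormedSpace ℝ E]
  {M : Type u} [TopologicalSpace M] [ChartedSpace E M] [IsManifold 𝓘(ℝ, E) ∞ M]
  (A : AlmostHermitianStructure n s E M)

/-- The derivative of the inverse of the chart at `p₀`, as a map of the model space. -/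
def chartFrame (E : Type v) [NormedAddCommGroup E] [NormedSpace ℝ E]
    {M : Type u} [TopologicalSpace M] [ChartedSpace E M] (p₀ : M) (x : E) :
    E →L[ℝ] TangentSpace 𝓘(ℝ, E) ((extChartAt 𝓘(ℝ, E) p₀).symm x) :=
  mfderiv 𝓘(ℝ, E) 𝓘(ℝ, E) (extChartAt 𝓘(ℝ, E) p₀).symm x

theorem chartMetric_apply (p₀ : M) (x u v : E) :
    A.chartMetric p₀ x u v =
      A.g ((extChartAt 𝓘(ℝ, E) p₀).symm x) (chartFrame E p₀ x u) (chartFrame E p₀ x v) := rfl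

/-- Smoothness of g is given in the bundle of bilinear forms. Over the chart domain the inverse of
the tangent trivialization is the derivative of the inverse chart, so the bundle coordinates of g
are the chart metric. -/
theorem chartMetric_eq_inCoordinates {p₀ : M} {x : E} (hx : x ∈ (extChartAt 𝓘(ℝ, E) p₀).target) :
    A.chartMetric p₀ x = ContinuousLinearMap.inCoordinates E (fun p : M => TangentSpace 𝓘(ℝ, E) p)
      (E →L[ℝ] ℝ) (fun p : M => TangentSpace 𝓘(ℝ, E) p →L[ℝ] ℝ) p₀
      ((extChartAt 𝓘(ℝ, E) p₀).symm x) p₀ ((extChartAt 𝓘(ℝ, E) p₀).symm x)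
      (A.g ((extChartAt 𝓘(ℝ, E) p₀).symm x)) := by
  have hs : (extChartAt 𝓘(ℝ, E) p₀).symm x ∈ (chartAt E p₀).source := by
    rw [← extChartAt_source 𝓘(ℝ, E)]
    exact (extChartAt 𝓘(ℝ, E) p₀).map_target hx
  ext u v
  have hb : (extChartAt 𝓘(ℝ, E) p₀).symm x ∈
      (trivializationAt E (fun p : M => TangentSpace 𝓘(ℝ, E) p) p₀).baseSet := hs
  have key : ∀ w : E, (trivializationAt E (fun p : M => TangentSpace 𝓘(ℝ, E) p) p₀).symm
      ((extChartAt 𝓘(ℝ, E) p₀).symm x) w = chartFrame E p₀ x w := by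
    intro w
    have := TangentBundle.symmL_trivializationAt (I := 𝓘(ℝ, E)) hs
    rw [(extChartAt 𝓘(ℝ, E) p₀).right_inv hx, modelWithCornersSelf_coe, Set.range_id,
      mfderivWithin_univ] at this
    rw [← Bundle.Trivialization.symmL_apply (R := ℝ) _ hb, this]
    rfl
  have h := inCoordinates_apply_eq₂ (𝕜 := ℝ) (F₁ := E) (F₂ := E) (F₃ := ℝ)
    (E₁ := fun p : M => TangentSpace 𝓘(ℝ, E) p) (E₂ := fun p : M => TangentSpace 𝓘(ℝ, E) p)
    (E₃ := Bundle.Trivial M ℝ) (x₀ := p₀) (ϕ := A.g ((extChartAt 𝓘(ℝ, E) p₀).symm x))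
    (v := u) (w := v) hb hb (Set.mem_univ _)
  rw [key, key] at h
  rw [chartMetric_apply]
  refine Eq.trans ?_ h.symm
  simp

set_option synthInstance.maxHeartbeats 200000 in
theorem contDiffOn_chartMetric (p₀ : M) :
    ContDiffOn ℝ ∞ (A.chartMetric p₀) (extChartAt 𝓘(ℝ, E) p₀).target := by
  intro x hx
  have hs : (extChartAt 𝓘(ℝ, E) p₀).symm x ∈ (chartAt E p₀).source := by
    rw [← extChartAt_source 𝓘(ℝ, E)]
    exact (extChartAt 𝓘(ℝ, E) p₀).map_target hx
  have h1 : ContMDiffAt 𝓘(ℝ, E) 𝓘(ℝ, E →L[ℝ] E →L[ℝ] ℝ) ∞ (fun q =>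
      ContinuousLinearMap.inCoordinates E (fun p : M => TangentSpace 𝓘(ℝ, E) p)
        (E →L[ℝ] ℝ) (fun p : M => TangentSpace 𝓘(ℝ, E) p →L[ℝ] ℝ) p₀ q p₀ q (A.g q))
      ((extChartAt 𝓘(ℝ, E) p₀).symm x) := by
    refine ((Bundle.Trivialization.contMDiffAt_section_iff (trivializationAt (E →L[ℝ] E →L[ℝ] ℝ)
      (fun p : M => TangentSpace 𝓘(ℝ, E) p →L[ℝ] TangentSpace 𝓘(ℝ, E) p →L[ℝ] ℝ) p₀) ?_).1
      (A.contMDiff_g _)).congr_of_eventuallyEq (Eventually.of_forall fun q => ?_)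
    · exact ⟨hs, hs, Set.mem_univ _⟩
    · rfl
  have h2 : ContMDiffWithinAt 𝓘(ℝ, E) 𝓘(ℝ, E) ∞ (extChartAt 𝓘(ℝ, E) p₀).symm
      (extChartAt 𝓘(ℝ, E) p₀).target x := contMDiffOn_extChartAt_symm p₀ x hx
  have h3 := h1.comp_contMDiffWithinAt x h2
  exact (contMDiffWithinAt_iff_contDiffWithinAt.1 h3).congr
    (fun y hy => A.chartMetric_eq_inCoordinates hy) (A.chartMetric_eq_inCoordinates hx)

end Chart

end AlmostHermitianStructure

end

noncomputable section

/-! ### The Levi-Civita connection of a metric in coordinates -/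

section LeviCivita

set_option synthInstance.maxHeartbeats 200000

open Filter Topology

variable {E : Type*} [NormedAddCommGroup E] [NormedSpace ℝ E]
  {G : E → E →L[ℝ] E →L[ℝ] ℝ} {U : Set E} {x : E}

/-- A smooth pseudo-Riemannian metric on the open set `U`. -/
structure IsSmoothMetricOn (G : E → E →L[ℝ] E →L[ℝ] ℝ) (U : Set E) : Prop where
  isOpen : IsOpen U
  contDiffOn : ContDiffOn ℝ ∞ G U
  symm : ∀ x ∈ U, ∀ u v, G x u v = G x v u
  nondeg : ∀ x ∈ U, ∀ u, (∀ v, G x u v = 0) → u = 0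

/-- The covector `2 Γ(u,v)` determined by the derivative `T` of the metric. -/
def koszul (T : E →L[ℝ] E →L[ℝ] E →L[ℝ] ℝ) (u v : E) : E →L[ℝ] ℝ :=
  T u v + T v u - (T.flip u).flip v

theorem koszul_apply (T : E →L[ℝ] E →L[ℝ] E →L[ℝ] ℝ) (u v w : E) :
    koszul T u v w = T u v w + T v u w - T w u v := rfl

theorem koszul_add_left (T : E →L[ℝ] E →L[ℝ] E →L[ℝ] ℝ) (u u' v : E) :
    koszul T (u + u') v = koszul T u v + koszul T u' v := by
  ext w
  simp only [koszul_apply, map_add, add_apply]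
  ring

theorem koszul_smul_left (T : E →L[ℝ] E →L[ℝ] E →L[ℝ] ℝ) (c : ℝ) (u v : E) :
    koszul T (c • u) v = c • koszul T u v := by
  ext w
  simp only [koszul_apply, map_smul, smul_apply, smul_eq_mul]
  ring

theorem koszul_add_right (T : E →L[ℝ] E →L[ℝ] E →L[ℝ] ℝ) (u v v' : E) :
    koszul T u (v + v') = koszul T u v + koszul T u v' := by
  ext w
  simp only [koszul_apply, map_add, add_apply]
  ring

theorem koszul_smul_right (T : E →L[ℝ] E →L[ℝ] E →L[ℝ] ℝ) (c : ℝ) (u v : E) :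
    koszul T u (c • v) = c • koszul T u v := by
  ext w
  simp only [koszul_apply, map_smul, smul_apply, smul_eq_mul]
  ring

/-- The Christoffel symbols of the metric `G`. -/
def christoffelSymbol (G : E → E →L[ℝ] E →L[ℝ] ℝ) (x u v : E) : E :=
  (1 / 2 : ℝ) • (G x).inverse (koszul (fderiv ℝ G x) u v)

theorem ContinuousLinearMap.isInvertible_of_nondeg [FiniteDimensional ℝ E] (B : E →L[ℝ] E →L[ℝ] ℝ)
    (h : ∀ u, (∀ v, B u v = 0) → u = 0) : B.IsInvertible := by
  have hinj : Function.Injective B := (injective_iff_map_eq_zero B).2 fun u hu =>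
    h u fun v => by rw [hu]; rfl
  have hfr : Module.finrank ℝ E = Module.finrank ℝ (E →L[ℝ] ℝ) := by
    rw [← (LinearMap.toContinuousLinearMap (𝕜 := ℝ) (E := E) (F' := ℝ)).finrank_eq]
    exact (Subspace.dual_finrank_eq (K := ℝ) (V := E)).symm
  refine ⟨(LinearEquiv.ofInjectiveOfFinrankEq (B : E →ₗ[ℝ] E →L[ℝ] ℝ) hinj
    hfr).toContinuousLinearEquiv, ?_⟩
  ext u v
  rfl

/-- Bundling Γ as a continuous bilinear map makes it a function into a normed space that can be
differentiated; finite dimension gives continuity. -/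
theorem exists_christoffelSymbol_bilin [FiniteDimensional ℝ E] (G : E → E →L[ℝ] E →L[ℝ] ℝ) :
    ∃ Γ : E → E →L[ℝ] E →L[ℝ] E, ∀ x u v, Γ x u v = christoffelSymbol G x u v := by
  have h : ∀ x, ∃ L : E →L[ℝ] E →L[ℝ] E, ∀ u v, L u v = christoffelSymbol G x u v := fun x => by
    refine ⟨LinearMap.toContinuousLinearMap ((LinearMap.toContinuousLinearMap (𝕜 := ℝ) (E := E)
      (F' := E)).toLinearMap ∘ₗ LinearMap.mk₂ ℝ (christoffelSymbol G x) ?_ ?_ ?_ ?_),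
      fun u v => rfl⟩
    · intro u u' v
      rw [christoffelSymbol, koszul_add_left, map_add, smul_add]; rfl
    · intro c u v
      rw [christoffelSymbol, koszul_smul_left, map_smul, smul_comm]; rfl
    · intro u v v'
      rw [christoffelSymbol, koszul_add_right, map_add, smul_add]; rfl
    · intro c u v
      rw [christoffelSymbol, koszul_smul_right, map_smul, smul_comm]; rfl
  choose Γ hΓ using h
  exact ⟨Γ, hΓ⟩

namespace IsSmoothMetricOn

variable (hG : IsSmoothMetricOn G U) (hx : x ∈ U)
include hG hx

theorem contDiffAt : ContDiffAt ℝ ∞ G x := hG.contDiffOn.contDiffAt (hG.isOpen.mem_nhds hx)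

theorem differentiableAt : DifferentiableAt ℝ G x :=
  (hG.contDiffAt hx).differentiableAt (by simp)

theorem eventually_symm : ∀ᶠ y in 𝓝 x, ∀ u v, G y u v = G y v u :=
  Filter.mem_of_superset (hG.isOpen.mem_nhds hx) hG.symm

theorem fderiv_symm (u v w : E) : fderiv ℝ G x u v w = fderiv ℝ G x u w v := by
  rw [← fderiv_bilin_const (hG.differentiableAt hx), ← fderiv_bilin_const (hG.differentiableAt hx),
    Filter.EventuallyEq.fderiv_eq ((hG.eventually_symm hx).mono fun y hy => hy v w)]

theorem christoffelSymbol_symm (u v : E) : christoffelSymbol G x u v = christoffelSymbol G x v u := by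
  have h : koszul (fderiv ℝ G x) u v = koszul (fderiv ℝ G x) v u := by
    ext w
    rw [koszul_apply, koszul_apply, hG.fderiv_symm hx w u v]
    ring
  rw [christoffelSymbol, christoffelSymbol, h]

variable [FiniteDimensional ℝ E]

theorem isInvertible : (G x).IsInvertible :=
  (G x).isInvertible_of_nondeg (hG.nondeg x hx)

theorem apply_christoffelSymbol (u v w : E) : G x (christoffelSymbol G x u v) w =
    1 / 2 * (fderiv ℝ G x u v w + fderiv ℝ G x v u w - fderiv ℝ G x w u v) := by
  obtain ⟨e, he⟩ := hG.isInvertible hx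
  rw [← koszul_apply, christoffelSymbol, map_smul, ← he, ContinuousLinearMap.inverse_equiv]
  simp

/-- When the Koszul formulas for G(Γ(u,v),w) and G(Γ(u,w),v) are added, every derivative except the
one along u cancels. -/
theorem compat (u v w : E) : fderiv ℝ G x u v w =
    G x (christoffelSymbol G x u v) w + G x v (christoffelSymbol G x u w) := by
  rw [hG.symm x hx v, hG.apply_christoffelSymbol hx, hG.apply_christoffelSymbol hx,
    hG.fderiv_symm hx u w v, hG.fderiv_symm hx w u v, hG.fderiv_symm hx v u w]
  ring

/-- Inversion is smooth at invertible operators, and Γ is C¹ as soon as all its values on fixed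
vectors are. -/
theorem differentiableAt_christoffelSymbol {Γ : E → E →L[ℝ] E →L[ℝ] E}
    (hΓ : ∀ x u v, Γ x u v = christoffelSymbol G x u v) : DifferentiableAt ℝ Γ x := by
  suffices ContDiffOn ℝ 1 Γ U from
    (this.contDiffAt (hG.isOpen.mem_nhds hx)).differentiableAt (by simp)
  refine contDiffOn_clm_apply.2 fun u => contDiffOn_clm_apply.2 fun v => ?_
  simp only [hΓ, christoffelSymbol]
  have hinv : ContDiffOn ℝ 1 (fun y => (G y).inverse) U := fun y hy =>
    (hG.isInvertible hy).contDiffAt_map_inverse.comp_contDiffWithinAt y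
      ((hG.contDiffOn y hy).of_le (by simp))
  have hd : ∀ a b c, ContDiffOn ℝ 1 (fun y => fderiv ℝ G y a b c) U := fun a b c y hy => by
    have h1 : ContDiffAt ℝ ∞ (fun z => G z b c) y :=
      ((hG.contDiffAt hy).clm_apply contDiffAt_const).clm_apply contDiffAt_const
    have h2 : ContDiffAt ℝ 1 (fun z => fderiv ℝ (fun z => G z b c) z a) y :=
      (h1.fderiv_right (m := 1) (by norm_cast)).clm_apply contDiffAt_const
    refine (h2.congr_of_eventuallyEq ?_).contDiffWithinAt
    filter_upwards [hG.isOpen.mem_nhds hy] with z hz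
    rw [fderiv_bilin_const (hG.differentiableAt hz)]
  have hK : ContDiffOn ℝ 1 (fun y => koszul (fderiv ℝ G y) u v) U :=
    contDiffOn_clm_apply.2 fun w => ((hd u v w).add (hd v u w)).sub (hd w u v)
  exact contDiffOn_const.smul (hinv.clm_apply hK)

end IsSmoothMetricOn

end LeviCivita

end

noncomputable section

/-! ### The curvature tensor of an almost Hermitian structure -/

section LeviCivitaCurvature

variable {E : Type*} [NormedAddCommGroup E] [NormedSpace ℝ E]
  {G : E → E →L[ℝ] E →L[ℝ] ℝ} {U : Set E} {x : E}

theorem ContinuousLinearMap.add_apply_apply {X P Z : Type*} [NormedAddCommGroup X]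
    [NormedSpace ℝ X] [NormedAddCommGroup P] [NormedSpace ℝ P] [NormedAddCommGroup Z]
    [NormedSpace ℝ Z] (T : X →L[ℝ] P →L[ℝ] Z) (u u' : X) (v : P) :
    T (u + u') v = T u v + T u' v := by
  rw [map_add, add_apply]

theorem ContinuousLinearMap.smul_apply_apply {X P Z : Type*} [NormedAddCommGroup X]
    [NormedSpace ℝ X] [NormedAddCommGroup P] [NormedSpace ℝ P] [NormedAddCommGroup Z]
    [NormedSpace ℝ Z] (T : X →L[ℝ] P →L[ℝ] Z) (a : ℝ) (u : X) (v : P) :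
    T (a • u) v = a • T u v := by
  rw [map_smul, smul_apply]

set_option synthInstance.maxHeartbeats 200000 in
theorem connCurvature_add_left (Γ : E → E →L[ℝ] E →L[ℝ] E) (x u u' v w : E) :
    connCurvature Γ x (u + u') v w = connCurvature Γ x u v w + connCurvature Γ x u' v w := by
  have h1 : fderiv ℝ Γ x (u + u') v w = fderiv ℝ Γ x u v w + fderiv ℝ Γ x u' v w := by
    rw [map_add]; rfl
  have h2 : fderiv ℝ Γ x v (u + u') w = fderiv ℝ Γ x v u w + fderiv ℝ Γ x v u' w :=
    ContinuousLinearMap.add_apply_apply _ _ _ _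
  have h3 : ∀ z, Γ x (u + u') z = Γ x u z + Γ x u' z :=
    ContinuousLinearMap.add_apply_apply _ _ _
  have h4 : ∀ z z', Γ x v (z + z') = Γ x v z + Γ x v z' := fun z z' => map_add (Γ x v) z z'
  simp only [connCurvature, h1, h2, h3, h4]
  abel

set_option synthInstance.maxHeartbeats 200000 in
theorem connCurvature_smul_left (Γ : E → E →L[ℝ] E →L[ℝ] E) (x : E) (a : ℝ) (u v w : E) :
    connCurvature Γ x (a • u) v w = a • connCurvature Γ x u v w := by
  have h1 : fderiv ℝ Γ x (a • u) v w = a • fderiv ℝ Γ x u v w := by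
    rw [map_smul]; rfl
  have h2 : fderiv ℝ Γ x v (a • u) w = a • fderiv ℝ Γ x v u w :=
    ContinuousLinearMap.smul_apply_apply _ _ _ _
  have h3 : ∀ z, Γ x (a • u) z = a • Γ x u z := ContinuousLinearMap.smul_apply_apply _ _ _
  have h4 : ∀ z, Γ x v (a • z) = a • Γ x v z := fun z => map_smul (Γ x v) a z
  simp only [connCurvature, h1, h2, h3, h4, smul_add, smul_sub]

theorem IsSmoothMetricOn.isCurvatureLike [FiniteDimensional ℝ E] (hG : IsSmoothMetricOn G U)
    (hx : x ∈ U) {Γ : E → E →L[ℝ] E →L[ℝ] E} (hΓ : ∀ x u v, Γ x u v = christoffelSymbol G x u v) :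
    CurvatureAlgebra.IsCurvatureLike fun u v w z : E => G x (connCurvature Γ x u v w) z where
  add₁ u u' v w z := by
    rw [connCurvature_add_left, ContinuousLinearMap.add_apply_apply]
  smul₁ a u v w z := by
    rw [connCurvature_smul_left, ContinuousLinearMap.smul_apply_apply, smul_eq_mul]
  swap₁₂ u v w z := by
    rw [connCurvature_swap, map_neg, neg_apply]
  swap₃₄ u v w z :=
    metric_connCurvature_skew ((hG.contDiffAt hx).of_le (by norm_cast))
      (hG.differentiableAt_christoffelSymbol hx hΓ) (hG.eventually_symm hx)
      (Filter.mem_of_superset (hG.isOpen.mem_nhds hx) fun y hy u v w => by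
        simp only [hΓ]; exact hG.compat hy u v w) u v w z
  bianchi u v w z := by
    have h := connCurvature_bianchi (hG.differentiableAt_christoffelSymbol hx hΓ)
      (Filter.mem_of_superset (hG.isOpen.mem_nhds hx) fun y hy u v => by
        simp only [hΓ]; exact hG.christoffelSymbol_symm hy u v) u v w
    rw [← add_apply, ← add_apply, ← map_add, ← map_add, h, map_zero]
    rfl

end LeviCivitaCurvature

namespace AlmostHermitianStructure

open Filter Topology

variable {n s : ℕ} {E : Type v} [NormedAddCommGroup E] [NormedSpace ℝ E]
  {M : Type u} [TopologicalSpace M] [ChartedSpace E M] [IsManifold 𝓘(ℝ, E) ∞ M]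
  (A : AlmostHermitianStructure n s E M)

theorem g_nondeg (p : M) (x : TangentSpace 𝓘(ℝ, E) p) (h : ∀ y, A.g p x y = 0) : x = 0 := by
  obtain ⟨e, he⟩ := A.signature p
  refine e.ext_elem fun j => ?_
  have h1 : A.g p x (e j) = e.repr x j * (if (j : ℕ) < 2 * s then -1 else 1) := by
    calc A.g p x (e j) = A.g p (∑ i, e.repr x i • e i) (e j) := by rw [e.sum_repr]
      _ = _ := by
        rw [map_sum, sum_apply]
        simp only [map_smul, smul_apply, he, smul_eq_mul]
        rw [Finset.sum_eq_single j (fun i _ hij => by simp [hij]) (by simp)]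
        simp
  rw [h] at h1
  rcases mul_eq_zero.1 h1.symm with h2 | h2
  · simpa using h2
  · split_ifs at h2 <;> norm_num at h2

theorem chartFrame_surjective {p₀ : M} {x : E} (hx : x ∈ (extChartAt 𝓘(ℝ, E) p₀).target) :
    Function.Surjective (chartFrame E p₀ x) := by
  have h := isInvertible_mfderivWithin_extChartAt_symm (I := 𝓘(ℝ, E)) hx
  rw [modelWithCornersSelf_coe, Set.range_id, mfderivWithin_univ] at h
  exact h.bijective.surjective

theorem chartFrame_injective {p₀ : M} {x : E} (hx : x ∈ (extChartAt 𝓘(ℝ, E) p₀).target) :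
    Function.Injective (chartFrame E p₀ x) := by
  have h := isInvertible_mfderivWithin_extChartAt_symm (I := 𝓘(ℝ, E)) hx
  rw [modelWithCornersSelf_coe, Set.range_id, mfderivWithin_univ] at h
  exact h.bijective.injective

theorem isSmoothMetricOn_chartMetric (p₀ : M) :
    IsSmoothMetricOn (A.chartMetric p₀) (extChartAt 𝓘(ℝ, E) p₀).target where
  isOpen := isOpen_extChartAt_target p₀
  contDiffOn := A.contDiffOn_chartMetric p₀
  symm x _ u v := A.g_symm _ _ _
  nondeg x hx u h := by
    refine chartFrame_injective hx ?_
    rw [map_zero]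
    refine A.g_nondeg _ _ fun y => ?_
    obtain ⟨v, rfl⟩ := chartFrame_surjective hx y
    exact h v

theorem chartFrame_self (p : M) (u : E) :
    chartFrame E p (extChartAt 𝓘(ℝ, E) p p) u = u := by
  have h := mfderivWithin_range_extChartAt_symm (I := 𝓘(ℝ, E)) (x := p)
  rw [modelWithCornersSelf_coe, Set.range_id, mfderivWithin_univ] at h
  exact congrArg (fun L => L u) h

/-- The metric at `p` on vectors of the model space. -/
def modelMetric (p : M) (u v : E) : ℝ :=
  A.g p (u : TangentSpace 𝓘(ℝ, E) p) (v : TangentSpace 𝓘(ℝ, E) p)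

variable [FiniteDimensional ℝ E]

/-- At the base point the derivative of the preferred chart is the identity, so tangent vectors at p
are used directly as coordinate vectors. -/
theorem curvature_eq (p : M) {Γ : E → E →L[ℝ] E →L[ℝ] E}
    (hΓ : ∀ x u v, Γ x u v = A.christoffel p x u v) (x y z u : E) :
    A.curvature p x y z u = A.chartMetric p (extChartAt 𝓘(ℝ, E) p p)
      (connCurvature Γ (extChartAt 𝓘(ℝ, E) p p) x y z) u := by
  have hd := (A.isSmoothMetricOn_chartMetric p).differentiableAt_christoffelSymbol
    (mem_extChartAt_target p) hΓ
  have hD : ∀ w : E, (mfderiv 𝓘(ℝ, E) 𝓘(ℝ, E) (extChartAt 𝓘(ℝ, E) p) p : E →L[ℝ] E) w = w :=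
    fun w => congrArg (fun L => L w) (mfderiv_extChartAt_self (I := 𝓘(ℝ, E)) (x := p))
  have hc : A.chartCurvature p (extChartAt 𝓘(ℝ, E) p p) x y z =
      connCurvature Γ (extChartAt 𝓘(ℝ, E) p p) x y z := by
    simp only [chartCurvature, connCurvature, ← hΓ]
    rw [fderiv_bilin_const hd, fderiv_bilin_const hd]
  rw [← hc]
  conv_rhs => rw [← hD x, ← hD y, ← hD z, ← hD u]
  rfl

theorem exists_christoffel_bilin (p : M) :
    ∃ Γ : E → E →L[ℝ] E →L[ℝ] E, ∀ x u v, Γ x u v = A.christoffel p x u v :=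
  exists_christoffelSymbol_bilin (A.chartMetric p)

theorem isCurvatureLike_curvature (p : M) : CurvatureAlgebra.IsCurvatureLike (A.curvature p) := by
  obtain ⟨Γ, hΓ⟩ := A.exists_christoffel_bilin p
  have h := (A.isSmoothMetricOn_chartMetric p).isCurvatureLike (mem_extChartAt_target p) hΓ
  have : A.curvature p = fun u v w z : E => A.chartMetric p (extChartAt 𝓘(ℝ, E) p p)
      (connCurvature Γ (extChartAt 𝓘(ℝ, E) p p) u v w) z := by
    funext x y z u
    exact A.curvature_eq p hΓ x y z u
  rw [this]
  exact h

end AlmostHermitianStructure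

end

noncomputable section

namespace AlmostHermitianStructure

open Filter Topology

variable {n s : ℕ} {E : Type v} [NormedAddCommGroup E] [NormedSpace ℝ E]
  {M : Type u} [TopologicalSpace M] [ChartedSpace E M] [IsManifold 𝓘(ℝ, E) ∞ M]
  (A : AlmostHermitianStructure n s E M)

/-! ### Strongly isotropic antiholomorphic planes -/

section Planes

variable {p : M} {x y : TangentSpace 𝓘(ℝ, E) p}

theorem g_J_left (x y : TangentSpace 𝓘(ℝ, E) p) : A.g p (A.J p x) y = -A.g p x (A.J p y) := by
  rw [← A.g_J p (A.J p x) y, A.J_sq, map_neg, neg_apply]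

theorem isStronglyIsotropicPlane_span (hxy : LinearIndependent ℝ ![x, y]) (hxx : A.g p x x = 0)
    (hxy' : A.g p x y = 0) (hyy : A.g p y y = 0) :
    A.IsStronglyIsotropicPlane (Submodule.span ℝ {x, y}) := by
  constructor
  · have := finrank_span_eq_card hxy
    rw [Matrix.range_cons_cons_empty] at this
    simpa using this
  · intro a ha b hb
    obtain ⟨a₁, a₂, rfl⟩ := Submodule.mem_span_pair.1 ha
    obtain ⟨b₁, b₂, rfl⟩ := Submodule.mem_span_pair.1 hb
    simp only [map_add, map_smul, add_apply, smul_apply, hxx, hxy', hyy, A.g_symm p y x]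
    simp

theorem isAntiholomorphic_span (hJ : ∀ a b : ℝ, A.J p x ≠ a • x + b • y)
    (hxJy : A.g p x (A.J p y) = 0) : A.IsAntiholomorphic (Submodule.span ℝ {x, y}) := by
  have self : ∀ z, A.g p (A.J p z) z = 0 := fun z => by
    have h1 := A.g_J_left z z
    rw [A.g_symm p z] at h1
    linarith
  constructor
  · intro a ha b hb
    obtain ⟨a₁, a₂, rfl⟩ := Submodule.mem_span_pair.1 ha
    obtain ⟨b₁, b₂, rfl⟩ := Submodule.mem_span_pair.1 hb
    have h1 : A.g p (A.J p x) y = 0 := by rw [A.g_J_left, hxJy, neg_zero]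
    have h2 : A.g p (A.J p y) x = 0 := by rw [A.g_symm, hxJy]
    simp only [map_add, map_smul, add_apply, smul_apply, self, h1, h2]
    simp
  · intro h
    have hx : A.J p x ∈ Submodule.span ℝ {x, y} := by
      have h1 : A.J p x ∈ (Submodule.span ℝ {x, y}).map (A.J p).toLinearMap :=
        ⟨x, Submodule.subset_span (by simp), rfl⟩
      rwa [h] at h1
    obtain ⟨a, b, hab⟩ := Submodule.mem_span_pair.1 hx
    exact hJ a b hab.symm

end Planes

/-! ### Totally geodesic surfaces in coordinates -/

section Surface

variable {N : Type u} [TopologicalSpace N] [ChartedSpace (EuclideanSpace ℝ (Fin 2)) N]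
  [IsManifold 𝓘(ℝ, EuclideanSpace ℝ (Fin 2)) ∞ N] {f : N → M}

/-- The coordinate expression of `f` in the charts at `q` and `f q`. -/
def surfaceCoord (E : Type v) [NormedAddCommGroup E] [NormedSpace ℝ E]
    {M : Type u} [TopologicalSpace M] [ChartedSpace E M] {N : Type u} [TopologicalSpace N]
    [ChartedSpace (EuclideanSpace ℝ (Fin 2)) N] (f : N → M) (q : N) :
    EuclideanSpace ℝ (Fin 2) → E :=
  fun y => extChartAt 𝓘(ℝ, E) (f q) (f ((extChartAt 𝓘(ℝ, EuclideanSpace ℝ (Fin 2)) q).symm y))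

omit [IsManifold 𝓘(ℝ, E) ∞ M] [IsManifold 𝓘(ℝ, EuclideanSpace ℝ (Fin 2)) ∞ N] in
theorem eventually_mem_chart (hf : Continuous f) (q : N) :
    ∀ᶠ y in 𝓝 (extChartAt 𝓘(ℝ, EuclideanSpace ℝ (Fin 2)) q q),
      y ∈ (extChartAt 𝓘(ℝ, EuclideanSpace ℝ (Fin 2)) q).target ∧
      f ((extChartAt 𝓘(ℝ, EuclideanSpace ℝ (Fin 2)) q).symm y) ∈
        (extChartAt 𝓘(ℝ, E) (f q)).source := by
  refine Filter.inter_mem (extChartAt_target_mem_nhds q) ?_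
  have h1 : ContinuousAt (extChartAt 𝓘(ℝ, EuclideanSpace ℝ (Fin 2)) q).symm
      (extChartAt 𝓘(ℝ, EuclideanSpace ℝ (Fin 2)) q q) := continuousAt_extChartAt_symm q
  refine (hf.continuousAt.comp h1).preimage_mem_nhds ?_
  rw [Function.comp, extChartAt_to_inv]
  exact extChartAt_source_mem_nhds (f q)

theorem contDiffAt_surfaceCoord (hf : ContMDiff 𝓘(ℝ, EuclideanSpace ℝ (Fin 2)) 𝓘(ℝ, E) ∞ f)
    {q : N} {y : EuclideanSpace ℝ (Fin 2)}
    (hy : y ∈ (extChartAt 𝓘(ℝ, EuclideanSpace ℝ (Fin 2)) q).target)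
    (hy' : f ((extChartAt 𝓘(ℝ, EuclideanSpace ℝ (Fin 2)) q).symm y) ∈
        (extChartAt 𝓘(ℝ, E) (f q)).source) : ContDiffAt ℝ ∞ (surfaceCoord E f q) y := by
  have h1 : ContMDiffAt 𝓘(ℝ, EuclideanSpace ℝ (Fin 2)) 𝓘(ℝ, EuclideanSpace ℝ (Fin 2)) ∞
      (extChartAt 𝓘(ℝ, EuclideanSpace ℝ (Fin 2)) q).symm y :=
    (contMDiffOn_extChartAt_symm q).contMDiffAt ((isOpen_extChartAt_target q).mem_nhds hy)
  have h2 : ContMDiffAt 𝓘(ℝ, E) 𝓘(ℝ, E) ∞ (extChartAt 𝓘(ℝ, E) (f q))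
      (f ((extChartAt 𝓘(ℝ, EuclideanSpace ℝ (Fin 2)) q).symm y)) :=
    contMDiffAt_extChartAt' (by rwa [extChartAt_source] at hy')
  exact contMDiffAt_iff_contDiffAt.1 (h2.comp y ((hf _).comp y h1))

/-- The chain rule for φ⁻¹ ∘ F = f ∘ ψ⁻¹ near y. It shows that dF(a), read through the chart frame,
is tangent to the surface. -/
theorem mfderiv_comp_chart_eq (hf : ContMDiff 𝓘(ℝ, EuclideanSpace ℝ (Fin 2)) 𝓘(ℝ, E) ∞ f)
    {q : N} {y : EuclideanSpace ℝ (Fin 2)}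
    (hy : y ∈ (extChartAt 𝓘(ℝ, EuclideanSpace ℝ (Fin 2)) q).target)
    (hy' : f ((extChartAt 𝓘(ℝ, EuclideanSpace ℝ (Fin 2)) q).symm y) ∈
        (extChartAt 𝓘(ℝ, E) (f q)).source) (a : EuclideanSpace ℝ (Fin 2)) :
    (chartFrame E (f q) (surfaceCoord E f q y) (fderiv ℝ (surfaceCoord E f q) y a) : E) =
      mfderiv 𝓘(ℝ, EuclideanSpace ℝ (Fin 2)) 𝓘(ℝ, E) f
        ((extChartAt 𝓘(ℝ, EuclideanSpace ℝ (Fin 2)) q).symm y)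
        (mfderiv 𝓘(ℝ, EuclideanSpace ℝ (Fin 2)) 𝓘(ℝ, EuclideanSpace ℝ (Fin 2))
          (extChartAt 𝓘(ℝ, EuclideanSpace ℝ (Fin 2)) q).symm y a) := by
  have h1 : MDifferentiableAt 𝓘(ℝ, EuclideanSpace ℝ (Fin 2)) 𝓘(ℝ, EuclideanSpace ℝ (Fin 2))
      (extChartAt 𝓘(ℝ, EuclideanSpace ℝ (Fin 2)) q).symm y :=
    ((contMDiffOn_extChartAt_symm (n := ∞) q).contMDiffAt
      ((isOpen_extChartAt_target q).mem_nhds hy)).mdifferentiableAt (by simp)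
  have h2 : MDifferentiableAt 𝓘(ℝ, EuclideanSpace ℝ (Fin 2)) 𝓘(ℝ, E)
      (surfaceCoord E f q) y :=
    ((contDiffAt_surfaceCoord hf hy hy').differentiableAt (by simp)).mdifferentiableAt
  have ht : surfaceCoord E f q y ∈ (extChartAt 𝓘(ℝ, E) (f q)).target :=
    (extChartAt 𝓘(ℝ, E) (f q)).map_source hy'
  have h3 : MDifferentiableAt 𝓘(ℝ, E) 𝓘(ℝ, E) (extChartAt 𝓘(ℝ, E) (f q)).symm
      (surfaceCoord E f q y) :=
    ((contMDiffOn_extChartAt_symm (n := ∞) (f q)).contMDiffAt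
      ((isOpen_extChartAt_target (f q)).mem_nhds ht)).mdifferentiableAt (by simp)
  have hev : (extChartAt 𝓘(ℝ, E) (f q)).symm ∘ surfaceCoord E f q =ᶠ[𝓝 y]
      f ∘ (extChartAt 𝓘(ℝ, EuclideanSpace ℝ (Fin 2)) q).symm := by
    have hc : ContinuousAt (fun y => f ((extChartAt 𝓘(ℝ, EuclideanSpace ℝ (Fin 2)) q).symm y)) y :=
      hf.continuous.continuousAt.comp h1.continuousAt
    filter_upwards [hc.preimage_mem_nhds ((isOpen_extChartAt_source (f q)).mem_nhds hy')] with z hz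
    exact (extChartAt 𝓘(ℝ, E) (f q)).left_inv hz
  have e1 := mfderiv_comp_apply y h3 h2 a
  have e2 := mfderiv_comp_apply y (((hf _).mdifferentiableAt (by simp))) h1 a
  have e3 := hev.mfderiv_eq (I := 𝓘(ℝ, EuclideanSpace ℝ (Fin 2))) (I' := 𝓘(ℝ, E))
  rw [mfderiv_eq_fderiv] at e1
  exact e1.symm.trans ((congrArg (fun L => L a) e3).trans e2)

theorem fderiv_surfaceCoord_self (hf : ContMDiff 𝓘(ℝ, EuclideanSpace ℝ (Fin 2)) 𝓘(ℝ, E) ∞ f)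
    (q : N) (a : EuclideanSpace ℝ (Fin 2)) :
    fderiv ℝ (surfaceCoord E f q) (extChartAt 𝓘(ℝ, EuclideanSpace ℝ (Fin 2)) q q) a =
      (mfderiv 𝓘(ℝ, EuclideanSpace ℝ (Fin 2)) 𝓘(ℝ, E) f q a : E) := by
  have h := mfderiv_comp_chart_eq hf (mem_extChartAt_target q)
    (by rw [extChartAt_to_inv]; exact mem_extChartAt_source (f q)) a
  have h1 : ∀ z w : E, z = extChartAt 𝓘(ℝ, E) (f q) (f q) → (chartFrame E (f q) z w : E) = w := by
    rintro _ w rfl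
    exact chartFrame_self _ w
  have h2 : ∀ q', q' = q → ∀ b : EuclideanSpace ℝ (Fin 2),
      (mfderiv 𝓘(ℝ, EuclideanSpace ℝ (Fin 2)) 𝓘(ℝ, E) f q' b : E) =
        mfderiv 𝓘(ℝ, EuclideanSpace ℝ (Fin 2)) 𝓘(ℝ, E) f q b := by
    rintro _ rfl b
    rfl
  rw [h1 _ _ (by simp [surfaceCoord])] at h
  refine h.trans ((h2 _ (extChartAt_to_inv q) _).trans ?_)
  exact congrArg (fun b : EuclideanSpace ℝ (Fin 2) =>
    (mfderiv 𝓘(ℝ, EuclideanSpace ℝ (Fin 2)) 𝓘(ℝ, E) f q b : E))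
    (chartFrame_self (E := EuclideanSpace ℝ (Fin 2)) q a)

variable [FiniteDimensional ℝ E]

/-- The curvature tensor vanishes on a totally geodesic surface whose tangent spaces are
isotropic. -/
theorem curvature_eq_zero_of_mem_surfaceTangent (hf : A.IsTotallyGeodesicSurface f)
    (hiso : ∀ q : N, A.IsStronglyIsotropicPlane (surfaceTangent E f q)) (q : N)
    {x y z u : TangentSpace 𝓘(ℝ, E) (f q)} (hx : x ∈ surfaceTangent E f q)
    (hy : y ∈ surfaceTangent E f q) (hz : z ∈ surfaceTangent E f q)
    (hu : u ∈ surfaceTangent E f q) : A.curvature (f q) x y z u = 0 := by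
  obtain ⟨a, rfl⟩ := hx
  obtain ⟨b, rfl⟩ := hy
  obtain ⟨c, rfl⟩ := hz
  obtain ⟨d, rfl⟩ := hu
  obtain ⟨Γ, hΓ⟩ := A.exists_christoffel_bilin (f q)
  have hm := A.isSmoothMetricOn_chartMetric (f q)
  have ht := mem_extChartAt_target (I := 𝓘(ℝ, E)) (f q)
  have hF : surfaceCoord E f q (extChartAt 𝓘(ℝ, EuclideanSpace ℝ (Fin 2)) q q) =
      extChartAt 𝓘(ℝ, E) (f q) (f q) := by simp [surfaceCoord]
  have hmem := eventually_mem_chart (E := E) hf.contMDiff.continuous q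
  have hmem' := hmem.self_of_nhds
  have key := metric_connCurvature_eq_zero_of_totallyGeodesic (G := A.chartMetric (f q)) (Γ := Γ)
    (F := surfaceCoord E f q) (y₀ := extChartAt 𝓘(ℝ, EuclideanSpace ℝ (Fin 2)) q q)
    ((contDiffAt_surfaceCoord hf.contMDiff hmem'.1 hmem'.2).of_le (by norm_cast))
    (by rw [hF]; exact hm.differentiableAt ht)
    (by rw [hF]; exact hm.differentiableAt_christoffelSymbol ht hΓ)
    (by rw [hF]; simp only [hΓ]; exact hm.compat ht)
    (hmem.mono fun y hy a b => by
      rw [chartMetric_apply]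
      -- The base point φ⁻¹(F y) equals f(ψ⁻¹ y) only propositionally; with p and the model vectors
      -- quantified, the equality can be substituted without transporting vectors.
      have h1 : ∀ p : M, ∀ v w : E, p = f ((extChartAt 𝓘(ℝ, EuclideanSpace ℝ (Fin 2)) q).symm y) →
          v ∈ surfaceTangent E f ((extChartAt 𝓘(ℝ, EuclideanSpace ℝ (Fin 2)) q).symm y) →
          w ∈ surfaceTangent E f ((extChartAt 𝓘(ℝ, EuclideanSpace ℝ (Fin 2)) q).symm y) →
          A.modelMetric p v w = 0 := by
        rintro _ v w rfl hv hw
        exact (hiso _).2 v hv w hw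
      refine h1 _ _ _ ((extChartAt 𝓘(ℝ, E) (f q)).left_inv hy.2) ?_ ?_
      · rw [mfderiv_comp_chart_eq hf.contMDiff hy.1 hy.2]
        exact ⟨_, rfl⟩
      · rw [mfderiv_comp_chart_eq hf.contMDiff hy.1 hy.2]
        exact ⟨_, rfl⟩)
    (hmem.mono fun y hy a b => by
      obtain ⟨c, hc⟩ := hf.totallyGeodesic q (f q) y hy.1 hy.2 a b
      exact ⟨c, by rw [hΓ]; exact hc⟩) a b c d
  rw [hF] at key
  have hd := fderiv_surfaceCoord_self hf.contMDiff q
  rw [hd a, hd b, hd c, hd d] at key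
  exact (A.curvature_eq (f q) hΓ _ _ _ _).trans key

end Surface

theorem vanishesOnIsotropic_curvature [FiniteDimensional ℝ E]
    (hA : A.AxiomStronglyIsotropicAntiholomorphicPlanes) (p : M) {x y : TangentSpace 𝓘(ℝ, E) p}
    (hxy : LinearIndependent ℝ ![x, y]) (hJ : ∀ a b : ℝ, A.J p x ≠ a • x + b • y)
    (hxx : A.g p x x = 0) (hxy' : A.g p x y = 0) (hyy : A.g p y y = 0)
    (hxJy : A.g p x (A.J p y) = 0) : A.curvature p x y y x = 0 := by
  -- Substituting p = f q removes the transport of the plane in the axiom.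
  obtain ⟨N, _, _, _, f, hf, ⟨q, rfl, hq⟩, hN⟩ := hA p (Submodule.span ℝ {x, y})
    (A.isStronglyIsotropicPlane_span hxy hxx hxy' hyy) (A.isAntiholomorphic_span hJ hxJy)
  have hx : x ∈ surfaceTangent E f q := hq ▸ Submodule.subset_span (by simp)
  have hy : y ∈ surfaceTangent E f q := hq ▸ Submodule.subset_span (by simp)
  exact A.curvature_eq_zero_of_mem_surfaceTangent hf (fun q => (hN q).1) q hx hy hy hx

end AlmostHermitianStructure

end

/-! ### Passage from the manifold to the algebra of one tangent space -/

noncomputable section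

namespace AlmostHermitianStructure

variable {n s : ℕ} {E : Type v} [NormedAddCommGroup E] [NormedSpace ℝ E]
  {M : Type u} [TopologicalSpace M] [ChartedSpace E M] [IsManifold 𝓘(ℝ, E) ∞ M]
  (A : AlmostHermitianStructure n s E M)

/-- The metric at `p` as a bilinear form. -/
def metricForm (p : M) :
    TangentSpace 𝓘(ℝ, E) p →ₗ[ℝ] TangentSpace 𝓘(ℝ, E) p →ₗ[ℝ] ℝ :=
  LinearMap.mk₂ ℝ (fun x y => A.g p x y) (by simp) (by simp) (by simp) (by simp)

theorem isHermitianForm_metricForm (p : M) :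
    CurvatureAlgebra.IsHermitianForm (A.metricForm p) (A.J p).toLinearMap where
  symm x y := A.g_symm p x y
  J_sq x := A.J_sq p x
  map_J x y := A.g_J p x y
  nondeg x h := A.g_nondeg p x h

end AlmostHermitianStructure

end

theorem theorem9 (n s : ℕ) (hs : 2 ≤ s) (hn : s + 2 ≤ n)
    (E : Type v) [NormedAddCommGroup E] [NormedSpace ℝ E] [FiniteDimensional ℝ E]
    (M : Type u) [TopologicalSpace M] [ChartedSpace E M] [IsManifold 𝓘(ℝ, E) ∞ M]
    (A : AlmostHermitianStructure n s E M)
    (hA : A.AxiomStronglyIsotropicAntiholomorphicPlanes) :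
    A.BochnerVanishes := by
  intro p e he x y z u
  obtain ⟨b, hb⟩ := A.signature p
  refine CurvatureAlgebra.bochner_eq_zero (g := A.metricForm p) (J := (A.J p).toLinearMap)
    (R := A.curvature p) (e := e)
    -- The signature basis has its 2s ≥ 4 negative vectors first, followed by 2(n - s) ≥ 4 positive
    -- ones; three of each sign suffice.
    (ν := fun i => b ⟨2 * s + i, by have := i.isLt; omega⟩)
    (ν' := fun i => b ⟨i, by have := i.isLt; omega⟩)
    (A.isHermitianForm_metricForm p) he (A.isCurvatureLike_curvature p)
    (fun x y hxy hJ hxx hxy' hyy hxJy =>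
      A.vanishesOnIsotropic_curvature hA p hxy hJ hxx hxy' hyy hxJy)
    (by omega) (fun i j => ?_) (fun i j => ?_) x y z u
  · refine (hb _ _).trans ?_
    simp [Fin.ext_iff]
  · refine (hb _ _).trans ?_
    have hi : (i : ℕ) < 2 * s := by have := i.isLt; omega
    simp [Fin.ext_iff, hi]
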